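/- **Setting.** Let $(\mathcal V,\mathcal R)$ be a finite directed graph; $r_-,r_+\in\mathcal V$ denote the source and target of $r\in\mathcal R$. Let $\kappa:\mathcal R\to[0,\infty)$ be weights such that the graph is diconnected (strongly connected) through edges of positive weight. The edges are a disjoint union $\mathcal R=\mathcal R_{\rm slow}\cup\mathcal R_{\rm fast}$, and for $\epsilon>0$ put $\kappa^\epsilon_r=\kappa_r$ for $r\in\mathcal R_{\rm slow}$ and $\kappa^\epsilon_r=\kappa_r/\epsilon$ for $r\in\mathcal R_{\rm fast}$. Write $(\operatorname{div}A)_x=\sum_{r_-=x}A_r-\sum_{r_+=x}A_r$. Let $\pi^\epsilon$ be the equilibrium, i.e. $\pi^\epsilon_x>0$, $\sum_x\pi^\epsilon_x=1$, and $\operatorname{div}(\kappa^\epsilon_r\pi^\epsilon_{r_-})_r=0$. Put $$\mathcal V_0=\{x:\lim_{\epsilon\downarrow0}\pi^\epsilon_x=\pi_x\text{ for some }\pi_x>0\},\qquad \mathcal V_1=\{x:\lim_{\epsilon\downarrow0}\tfrac1\epsilon\pi^\epsilon_x=\tilde\pi_x\text{ for some }\tilde\pi_x>0\},$$ and assume that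 $\mathcal V=\mathcal V_0\cup\mathcal V_1$ and that there are no leak edges: $r_-\notin\mathcal V_1$ for all $r\in\mathcal R_{\rm slow}$. Let $\mathcal R_{\rm fcyc}=\{r\in\mathcal R_{\rm fast}:r_-\in\mathcal V_0\}$, $\mathcal R_{\rm damp}=\{r\in\mathcal R_{\rm fast}:r_-\in\mathcal V_1\}$, $\mathcal V_{0\rm fcyc}=\{x\in\mathcal V_0:x=r_-\text{ for some }r\in\mathcal R_{\rm fcyc}\}$, $\mathcal V_{0\rm slow}=\mathcal V_0\setminus\mathcal V_{0\rm fcyc}$. Let $\mathfrak C$ be the set of diconnected components of $(\mathcal V_0,\mathcal R_{\rm fcyc})$, i.e. the maximal nonempty $\mathfrak c\subset\mathcal V_0$ such that for all $x,y\in\mathfrak c$ there is a path of at least one edge of $\mathcal R_{\rm fcyc}$ from $x$ to $y$; put $\pi^\epsilon_{\mathfrak c}=\sum_{x\in\mathfrak c}\pi^\epsilon_x$ and $\pi_{\mathfrak c}=\sum_{x\in\mathfrak c}\pi_x$. **Costs.** Let $s(a\mid b)=a\log\frac ab-a+b$ for $a,b>0$, $s(0\mid b)=b$ for $b\ge0$,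 and $s(a\mid b)=\infty$ otherwise. Let $\mathscr C(a)=\inf_{p-q=a}s(p\mid1)+s(q\mid1)$ and $\mathscr C^*(p)=\sup_a(pa-\mathscr C(a))$. Fix $T>0$. The Orlicz space $L^{\mathscr C}([0,T])$ consists of the $f$ with $\int_0^T\mathscr C(f/a)\,dt<\infty$ for some $a>0$; its weak-$*$ topology is given by duality with the space of all $\zeta$ such that $\int_0^T\mathscr C^*(\zeta/a)\,dt<\infty$ for every $a>0$. Let $$\Theta=C([0,T];\mathbb R^{\mathcal V_{0\rm slow}})\times L^\infty([0,T];\mathbb R^{\mathcal V_{0\rm fcyc}})\times C([0,T];\mathbb R^{\mathfrak C})\times\mathcal M([0,T];\mathbb R^{\mathcal V_1})\times L^{\mathscr C}([0,T];\mathbb R^{\mathcal R_{\rm slow}})\times\mathcal M([0,T];\mathbb R^{\mathcal R_{\rm damp}})\times L^{\mathscr C}([0,T];\mathbb R^{\mathcal R_{\rm fcyc}}),$$ where $\mathcal M$ denotes bounded signed measures, with the product of the uniform topologies (on $C$), the weak-$*$ topologies (on $L^\infty=(L^1)^*$ and on $L^{\mathscr C}$) and the narrow topologies (on $\mathcal M$,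 by duality with $C([0,T])$). Write $(u,j)=(u_{\mathcal V_{0\rm slow}},u_{\mathcal V_{0\rm fcyc}},u_{\mathfrak C},u_{\mathcal V_1},j_{\mathcal R_{\rm slow}},j_{\mathcal R_{\rm damp}},\tilde\jmath_{\mathcal R_{\rm fcyc}})$ for its elements. Put $\rho_x=\pi^\epsilon_xu_x$ for $x\in\mathcal V$, and $J_r=j_r$ for $r\in\mathcal R_{\rm slow}\cup\mathcal R_{\rm damp}$, $J_r=\frac1\epsilon\kappa_r\pi^\epsilon_{r_-}u_{r_-}+\frac1{\sqrt\epsilon}\tilde\jmath_r$ for $r\in\mathcal R_{\rm fcyc}$. If the measures $u_{\mathcal V_1}$, $j_{\mathcal R_{\rm damp}}$ have Lebesgue densities, $\rho\in W^{1,1}([0,T];\mathbb R^{\mathcal V})$, $J\in L^1([0,T];\mathbb R^{\mathcal R})$, $\dot\rho=-\operatorname{div}J$, and $\pi^\epsilon_{\mathfrak c}u_{\mathfrak c}=\sum_{x\in\mathfrak c}\pi^\epsilon_xu_x$ for all $\mathfrak c\in\mathfrak C$, put $$\tilde{\mathcal I}^\epsilon_0(u(0))+\tilde{\mathcal J}^\epsilon(u,j)=\sum_{x\in\mathcal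 V}s\big(\pi^\epsilon_xu_x(0)\mid\pi^\epsilon_x\big)+\sum_{r\in\mathcal R}\int_0^Ts\big(J_r(t)\mid\kappa^\epsilon_r\pi^\epsilon_{r_-}u_{r_-}(t)\big)\,dt,$$ where $u(0)$ is read off from the absolutely continuous representative; otherwise put $\tilde{\mathcal I}^\epsilon_0(u(0))+\tilde{\mathcal J}^\epsilon(u,j)=\infty$. **Theorem 1.1 (Equicoercivity).** Let $\epsilon_n>0$, $\epsilon_n\to0$, and let $(u^{\epsilon_n},j^{\epsilon_n})\in\Theta$ satisfy $$\tilde{\mathcal I}^{\epsilon_n}_0(u^{\epsilon_n}(0))+\tilde{\mathcal J}^{\epsilon_n}(u^{\epsilon_n},j^{\epsilon_n})\le C\qquad\text{for all }n$$ with a constant $C$ independent of $n$. Then there is a subsequence that converges in $\Theta$ to some $(u,j)\in\Theta$: uniformly for $u_{\mathcal V_{0\rm slow}}$ and $u_{\mathfrak C}$, weakly-$*$ in $L^\infty$ for $u_{\mathcal V_{0\rm fcyc}}$, narrowly for $u_{\mathcal V_1}$ and $j_{\mathcal R_{\rm damp}}$, and weakly-$*$ in $L^{\mathscr C}$ for $j_{\mathcal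 R_{\rm slow}}$ and $\tilde\jmath_{\mathcal R_{\rm fcyc}}$. Moreover the limit satisfies $\pi_{\mathfrak c}u_{\mathfrak c}=\sum_{x\in\mathfrak c}\pi_xu_x$ a.e. on $[0,T]$ for every $\mathfrak c\in\mathfrak C$. -/

import Mathlib

open MeasureTheory Filter Topology
open scoped ENNReal NNReal

noncomputable section

/-! ### Entropy function and the Young pair -/

/-- The relative entropy density `s(a | b) ∈ [0,∞]`. For `a, b > 0` the real number
`a log (a/b) - a + b` is nonnegative, so `ENNReal.ofReal` truncates nothing. -/
def relEnt (a b : ℝ) : ℝ≥0∞ :=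
  if 0 < a ∧ 0 < b then ENNReal.ofReal (a * Real.log (a / b) - a + b)
  else if a = 0 ∧ 0 ≤ b then ENNReal.ofReal b
  else ⊤

/-- The Young function `𝒞(a) = inf_{p - q = a} s(p | 1) + s(q | 1)`. -/
def youngC (a : ℝ) : ℝ≥0∞ :=
  ⨅ (p : ℝ) (q : ℝ) (_ : p - q = a), relEnt p 1 + relEnt q 1

/-- The convex conjugate `𝒞*(p) = sup_a (p a - 𝒞(a))`. The supremum is nonnegative (take `a = 0`),
so it may be computed with truncated subtraction in `[0,∞]`. -/
def youngCconj (p : ℝ) : ℝ≥0∞ :=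
  ⨆ a : ℝ, (ENNReal.ofReal (p * a) - youngC a)

/-! ### Function and measure spaces on `[0,T]` -/

/-- The time interval `[0,T]`. -/
abbrev TimeIcc (T : ℝ) : Type := Set.Icc (0 : ℝ) T

/-- Lebesgue measure on `[0,T]`. -/
def timeVol (T : ℝ) : Measure (TimeIcc T) := Measure.comap Subtype.val volume

/-- The space `L^∞([0,T])`, to be equipped with its weak-* topology. -/
structure LInfTime (T : ℝ) where
  toLp : Lp ℝ ∞ (timeVol T)

/-- The weak-* topology of `L^∞([0,T])`, i.e. the one given by duality with `L¹([0,T])`. -/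
instance (T : ℝ) : TopologicalSpace (LInfTime T) :=
  TopologicalSpace.induced
    (fun (f : LInfTime T) (g : Lp ℝ 1 (timeVol T)) => ∫ t, f.toLp t * g t ∂(timeVol T))
    inferInstance

/-- The space `𝓜([0,T])` of bounded signed measures, to be equipped with the narrow topology. -/
structure MeasTime (T : ℝ) where
  toSigned : SignedMeasure (TimeIcc T)

/-- The narrow topology, given by duality with continuous functions on `[0,T]`. -/
instance (T : ℝ) : TopologicalSpace (MeasTime T) :=
  TopologicalSpace.induced
    (fun (μ : MeasTime T) (φ : C(TimeIcc T, ℝ)) => ∫ᵛ t, φ t ∂<•μ.toSigned)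
    inferInstance

/-- The Orlicz space `L^𝒞([0,T])` of (classes of) functions `f` such that
`∫ 𝒞(f / a) < ∞` for some `a > 0`; to be equipped with its weak-* topology. -/
structure OrliczTime (T : ℝ) where
  toFun : TimeIcc T →ₘ[timeVol T] ℝ
  mem_orlicz : ∃ a : ℝ, 0 < a ∧ ∫⁻ t, youngC (toFun t / a) ∂(timeVol T) < ∞

/-- The space `M^{𝒞*}([0,T])` of (classes of) functions `ζ` such that
`∫ 𝒞*(ζ / a) < ∞` for all `a > 0`; it is the predual of `L^𝒞([0,T])`. -/
def MorseTime (T : ℝ) : Set (TimeIcc T →ₘ[timeVol T] ℝ) :=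
  {ζ | ∀ a : ℝ, 0 < a → ∫⁻ t, youngCconj (ζ t / a) ∂(timeVol T) < ∞}

/-- The weak-* topology of `L^𝒞([0,T])`, given by duality with `M^{𝒞*}([0,T])`. -/
instance (T : ℝ) : TopologicalSpace (OrliczTime T) :=
  TopologicalSpace.induced
    (fun (f : OrliczTime T) (ζ : MorseTime T) => ∫ t, f.toFun t * ζ.1 t ∂(timeVol T))
    inferInstance

/-! ### Slow-fast networks -/

/-- A directed graph with nodes `V`, edges `R`, source map `r ↦ r₋`, target map `r ↦ r₊`,
edge weights `κ ≥ 0`, and a set of fast edges (all the other edges are slow). The graph is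
diconnected (strongly connected) through edges of positive weight. -/
structure SlowFastNetwork (V R : Type*) where
  src : R → V
  tgt : R → V
  κ : R → ℝ
  fast : Set R
  κ_nonneg : ∀ r, 0 ≤ κ r
  diconnected : ∀ x y : V,
    Relation.ReflTransGen (fun a b => ∃ r, 0 < κ r ∧ src r = a ∧ tgt r = b) x y

/-- The nodes of order one: `π^ε_x` has a positive limit as `ε ↓ 0`. -/
def nodesV0 {V : Type*} (π : ℝ → V → ℝ) : Set V :=
  {x | ∃ p : ℝ, 0 < p ∧ Tendsto (fun ε => π ε x) (𝓝[>] 0) (𝓝 p)}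

/-- The nodes of order `ε`: `π^ε_x / ε` has a positive limit as `ε ↓ 0`. -/
def nodesV1 {V : Type*} (π : ℝ → V → ℝ) : Set V :=
  {x | ∃ p : ℝ, 0 < p ∧ Tendsto (fun ε => π ε x / ε) (𝓝[>] 0) (𝓝 p)}

namespace SlowFastNetwork

variable {V R : Type*} (N : SlowFastNetwork V R)

open Classical in
/-- The rates `κ^ε`: equal to `κ` on slow edges and to `κ / ε` on fast edges. -/
def rate (ε : ℝ) (r : R) : ℝ := if r ∈ N.fast then 1 / ε * N.κ r else N.κ r

open Classical in
/-- The discrete divergence `(div A)_x = ∑_{r₋ = x} A_r - ∑_{r₊ = x} A_r`. -/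
def div [Fintype R] (A : R → ℝ) (x : V) : ℝ :=
  (∑ r with N.src r = x, A r) - (∑ r with N.tgt r = x, A r)

/-- `p` is the (unique) positive equilibrium of total mass one of the dynamics
`ρ' = - div (κ^ε ⊗ ρ)`. -/
structure IsEquilibrium [Fintype V] [Fintype R] (ε : ℝ) (p : V → ℝ) : Prop where
  pos : ∀ x, 0 < p x
  sum_eq_one : ∑ x, p x = 1
  stationary : ∀ x, N.div (fun r => N.rate ε r * p (N.src r)) x = 0

variable (π : ℝ → V → ℝ)

/-- The slow edges. -/
def Rslow : Set R := N.fastᶜ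

/-- The fast-cycle edges: fast edges with source in `V₀`. -/
def Rfcyc : Set R := {r | r ∈ N.fast ∧ N.src r ∈ nodesV0 π}

/-- The damped edges: fast edges with source in `V₁`. -/
def Rdamp : Set R := {r | r ∈ N.fast ∧ N.src r ∈ nodesV1 π}

/-- The nodes of `V₀` that are the source of a fast-cycle edge. -/
def V0fcyc : Set V := {x | x ∈ nodesV0 π ∧ ∃ r ∈ N.Rfcyc π, N.src r = x}

/-- The other nodes of `V₀`. -/
def V0slow : Set V := nodesV0 π \ N.V0fcyc π

/-- There is a path of at least one fast-cycle edge from `x` to `y`. -/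
def FcycPath (x y : V) : Prop :=
  Relation.TransGen (fun a b => ∃ r ∈ N.Rfcyc π, N.src r = a ∧ N.tgt r = b) x y

/-- The set `ℭ` of diconnected components of the graph `(V₀, R_fcyc)`: the maximal nonempty sets of
nodes of `V₀` all of which are joined by paths of fast-cycle edges. -/
def components : Set (Set V) :=
  {c | Maximal (fun d : Set V =>
    d.Nonempty ∧ d ⊆ nodesV0 π ∧ ∀ x ∈ d, ∀ y ∈ d, N.FcycPath π x y) c}

/-- The space `Θ`. A space of `ℝ^I`-valued functions or measures on `[0,T]`, `I` finite, is
the `I`-fold power of the space of scalar ones. -/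
structure Theta (T : ℝ) where
  uSlow : C(TimeIcc T, N.V0slow π → ℝ)
  uFcyc : N.V0fcyc π → LInfTime T
  uComp : C(TimeIcc T, N.components π → ℝ)
  uOne : nodesV1 π → MeasTime T
  jSlow : N.Rslow → OrliczTime T
  jDamp : N.Rdamp π → MeasTime T
  jFcyc : N.Rfcyc π → OrliczTime T

/-- The product topology on `Θ`: uniform convergence for the continuous components, the weak-*
topologies for those in `L^∞` and `L^𝒞`, and the narrow topology for the measures. -/
instance (T : ℝ) : TopologicalSpace (N.Theta π T) :=
  TopologicalSpace.induced
    (fun θ => (θ.uSlow, θ.uFcyc, θ.uComp, θ.uOne, θ.jSlow, θ.jDamp, θ.jFcyc))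
    inferInstance

variable {π}

open Classical in
/-- The relation `p_c u_c = ∑_{x ∈ c} p_x u_x` between the densities of the fast components and of
the fast-cycle nodes, where `p_c = ∑_{x ∈ c} p_x`. (Every component consists of fast-cycle
nodes.) -/
def ComponentRelation [Fintype V] {T : ℝ} (p : V → ℝ) (θ : N.Theta π T) : Prop :=
  ∀ c : N.components π, ∀ᵐ t ∂(timeVol T),
    (∑ x with x ∈ (c : Set V), p x) * θ.uComp t c =
      ∑ x : N.V0fcyc π, if (x : V) ∈ (c : Set V) then p x * (θ.uFcyc x).toLp t else 0

/-- The functions `u_x` (for all nodes) and `j_r` (for all edges; the rescaled flux if `r` is a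
fast-cycle edge) represent the element `θ` of `Θ`: its function components agree with them,
and its measure components have them as Lebesgue densities. -/
structure Represents {T : ℝ} (θ : N.Theta π T) (u : V → ℝ → ℝ) (j : R → ℝ → ℝ) : Prop where
  uSlow : ∀ (t : TimeIcc T) (x : N.V0slow π), θ.uSlow t x = u x t
  uFcyc : ∀ x : N.V0fcyc π, ∀ᵐ t ∂(timeVol T), (θ.uFcyc x).toLp t = u x t
  uOne_integrable : ∀ x : nodesV1 π, Integrable (fun t : TimeIcc T => u x t) (timeVol T)
  uOne : ∀ x : nodesV1 π,
    (θ.uOne x).toSigned = (timeVol T).withDensityᵥ (fun t : TimeIcc T => u x t)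
  jSlow : ∀ r : N.Rslow, ∀ᵐ t ∂(timeVol T), (θ.jSlow r).toFun t = j r t
  jDamp_integrable : ∀ r : N.Rdamp π, Integrable (fun t : TimeIcc T => j r t) (timeVol T)
  jDamp : ∀ r : N.Rdamp π,
    (θ.jDamp r).toSigned = (timeVol T).withDensityᵥ (fun t : TimeIcc T => j r t)
  jFcyc : ∀ r : N.Rfcyc π, ∀ᵐ t ∂(timeVol T), (θ.jFcyc r).toFun t = j r t

/-! ### The functionals -/

/-- The initial cost `∑_x s(ρ_x(0) | p_x)`. -/
def initialCost [Fintype V] (p ρ₀ : V → ℝ) : ℝ≥0∞ := ∑ x, relEnt (ρ₀ x) (p x)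

open Classical in
/-- The flux cost of concentrations `ρ` and fluxes `J`: it equals
`∑_r ∫_{[0,T]} s(J_r(t) | κ^ε_r ρ_{r₋}(t)) dt` if `ρ` is in `W^{1,1}` (that is, absolutely
continuous), `J` is in `L¹` and `ρ' = - div J`, and it is infinite otherwise. -/
def fluxCost [Fintype R] (T ε : ℝ) (ρ : V → ℝ → ℝ) (J : R → ℝ → ℝ) : ℝ≥0∞ :=
  if (∀ x, AbsolutelyContinuousOnInterval (ρ x) 0 T) ∧
      (∀ r, IntegrableOn (J r) (Set.Icc 0 T)) ∧
      (∀ x, ∀ᵐ t ∂(volume.restrict (Set.Icc 0 T)),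
        HasDerivAt (ρ x) (-(N.div (fun r => J r t) x)) t)
  then ∑ r, ∫⁻ t in Set.Icc 0 T, relEnt (J r t) (N.rate ε r * ρ (N.src r) t)
  else ⊤

variable (π)

open Classical in
/-- The physical fluxes: `j_r` itself on slow and damped edges, and
`(1/ε) κ_r π^ε_{r₋} u_{r₋}(t) + j_r(t) / √ε` on fast-cycle edges. -/
def physicalFlux (ε : ℝ) (u : V → ℝ → ℝ) (j : R → ℝ → ℝ) (r : R) (t : ℝ) : ℝ :=
  if r ∈ N.Rfcyc π then
    1 / ε * N.κ r * π ε (N.src r) * u (N.src r) t + 1 / √ε * j r t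
  else j r t

variable {π}

open Classical in
/-- The rescaled cost, initial cost plus flux cost, of an element of `Θ`. It is infinite if the
relation between `u_c` and `u_x` is violated, or if `θ` is not represented by functions with
finite flux cost. The representing functions enter only through the flux cost, where they
are unique (absolutely continuous densities, and fluxes up to null sets), so the infimum is over
equal finite values; the infimum over the empty set is `∞`. -/
def cost [Fintype V] [Fintype R] {T : ℝ} (ε : ℝ) (θ : N.Theta π T) : ℝ≥0∞ :=
  if N.ComponentRelation (π ε) θ then
    ⨅ (u : V → ℝ → ℝ) (j : R → ℝ → ℝ) (_ : N.Represents θ u j),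
      initialCost (π ε) (fun x => π ε x * u x 0) +
        N.fluxCost T ε (fun x t => π ε x * u x t) (N.physicalFlux π ε u j)
  else ⊤

end SlowFastNetwork

end

/-!
# Equicoercivity of the rescaled flux large-deviation costs of slow-fast networks

A bound on the cost is converted into a priori estimates by Fenchel's inequality
`s(a | b) ≥ a q - b (exp q - 1)` (`ofReal_fenchel_le_relEnt`), with a suitable `q` each time.

*Fluxes of Orlicz type.* The total mass is conserved and bounded by the initial cost, and all
concentrations are nonnegative, so slow rates are bounded and slow fluxes are bounded in the Orlicz
class of `𝒞`, in particular equi-integrable in time. On a fast-cycle edge the conjugate of the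
rescaled cost is `q ↦ (w / ε) (exp (√ε q) - 1 - √ε q) ≤ w 𝒞*(q)` for `ε ≤ 1`, which gives the same
bound for the rescaled excess fluxes (`mul_youngC_le_relEnt_rescaled`).

*Nodes of order `ε`.* Mass enters `V₁` only through slow edges: at order `1 / ε` the equilibrium is a
divergence-free flow on the fast-cycle edges, so those of positive weight lie on cycles inside `V₀`
(`fcycPath_of_pos`). Hence the flux out of `V₁` is bounded. A bounded flux on an edge bounds its rate
`κ_r ρ_{r₋} / ε`, and going backwards along paths to `V₀` gives an `L¹` bound of order `ε` for every
concentration in `V₁` and an `L¹` bound for the damped fluxes (`exists_integral_concentration_le`).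

*Equicontinuity.* As `V₁` is fed by equi-integrable fluxes, starts with vanishing mass, and has mass
of order `ε` in `L¹`, its mass tends to zero uniformly in time (`eventually_mass_nodesV1_le`). So the
flux from `V₁` into `V₀` during a short time is small. The mass of a slow node or of a fast component
changes only through this flux and through the slow fluxes, because no fast-cycle edge of positive
weight enters or leaves such a set (`FastClosed`); this yields asymptotic equicontinuity
(`exists_mass_modulus`).

*Compactness.* The subsequences come from Arzelà–Ascoli (`exists_subseq_tendsto_uniform`),
from Riesz–Markov and Banach–Alaoglu for the measures (`exists_subseq_tendsto_narrow`), and from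
a Dunford–Pettis argument for `L^∞` and for the Orlicz space (`exists_subseq_tendsto_setIntegral`):
integrals over the sets of a countable measure-dense family converge by compactness,
equi-integrability extends this to all measurable sets, and Radon–Nikodym represents the limit.
The relation between the components and their nodes is linear, so it survives when integrated
over sets of times.
-/

open scoped symmDiff

/-! ### The entropy function and the Young pair -/

/-- Fenchel's inequality for `s(· | b)`, whose convex conjugate is `p ↦ b (e ^ p - 1)`. All lower
bounds on the costs come from it. -/
lemma ofReal_fenchel_le_relEnt (a b p : ℝ) :
    ENNReal.ofReal (a * p - b * (Real.exp p - 1)) ≤ relEnt a b := by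
  unfold relEnt
  split_ifs with h1 h2
  · obtain ⟨ha, hb⟩ := h1
    refine ENNReal.ofReal_le_ofReal ?_
    have h := Real.add_one_le_exp (p - Real.log (a / b))
    have h3 : b * Real.exp p = a * Real.exp (p - Real.log (a / b)) := by
      rw [Real.exp_sub, Real.exp_log (by positivity)]
      field_simp
    nlinarith [mul_le_mul_of_nonneg_left h ha.le]
  · obtain ⟨rfl, hb⟩ := h2
    refine ENNReal.ofReal_le_ofReal ?_
    nlinarith [mul_nonneg hb (Real.exp_pos p).le]
  · exact le_top

lemma nonneg_of_relEnt_ne_top {a b : ℝ} (h : relEnt a b ≠ ⊤) : 0 ≤ a ∧ 0 ≤ b := by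
  unfold relEnt at h
  split_ifs at h with h1 h2
  · exact ⟨h1.1.le, h1.2.le⟩
  · exact ⟨h2.1.ge, h2.2⟩
  · exact absurd rfl h

lemma eq_zero_of_relEnt_zero_right_ne_top {a : ℝ} (h : relEnt a 0 ≠ ⊤) : a = 0 := by
  unfold relEnt at h
  split_ifs at h with h1 h2
  · exact absurd h1.2 (lt_irrefl _)
  · exact h2.1
  · exact absurd rfl h

lemma measurable_relEnt : Measurable fun z : ℝ × ℝ => relEnt z.1 z.2 := by
  unfold relEnt
  refine Measurable.ite ?_ (by fun_prop) (Measurable.ite ?_ (by fun_prop) measurable_const)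
  · exact (measurableSet_lt measurable_const measurable_fst).inter
      (measurableSet_lt measurable_const measurable_snd)
  · exact (measurableSet_eq_fun measurable_fst measurable_const).inter
      (measurableSet_le measurable_const measurable_snd)

/-- Half of the duality between `𝒞` and `q ↦ 2 cosh q - 2`. -/
lemma ofReal_fenchel_le_youngC (a q : ℝ) :
    ENNReal.ofReal (a * q - (2 * Real.cosh q - 2)) ≤ youngC a := by
  refine le_iInf fun p => le_iInf fun p' => le_iInf fun h => ?_
  calc ENNReal.ofReal (a * q - (2 * Real.cosh q - 2))
      = ENNReal.ofReal ((p * q - 1 * (Real.exp q - 1))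
          + (p' * (-q) - 1 * (Real.exp (-q) - 1))) := by
        rw [Real.cosh_eq, ← h]; congr 1; ring
    _ ≤ _ := ENNReal.ofReal_add_le
    _ ≤ _ := add_le_add (ofReal_fenchel_le_relEnt _ _ _) (ofReal_fenchel_le_relEnt _ _ _)

lemma exp_mul_self_sub_nonneg (x : ℝ) : 0 ≤ Real.exp x * x - Real.exp x + 1 := by
  have h1 := Real.add_one_le_exp (-x)
  have h2 : Real.exp x * Real.exp (-x) = 1 := by rw [← Real.exp_add]; simp
  nlinarith [mul_le_mul_of_nonneg_left h1 (Real.exp_pos x).le]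

lemma eq_exp_sub_exp_arsinh (a : ℝ) :
    a = Real.exp (Real.arsinh (a / 2)) - Real.exp (-Real.arsinh (a / 2)) := by
  have := Real.sinh_arsinh (a / 2)
  rw [Real.sinh_eq] at this
  linarith

/-- The supremum in the dual formula for `𝒞` is attained at `q = arsinh (a / 2)`. -/
lemma youngC_eq (a : ℝ) : youngC a = ENNReal.ofReal
    (a * Real.arsinh (a / 2) - (2 * Real.cosh (Real.arsinh (a / 2)) - 2)) := by
  refine le_antisymm ?_ (ofReal_fenchel_le_youngC _ _)
  set q := Real.arsinh (a / 2) with hq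
  have ha : a = Real.exp q - Real.exp (-q) := eq_exp_sub_exp_arsinh a
  have hs : ∀ x : ℝ, relEnt (Real.exp x) 1 = ENNReal.ofReal (Real.exp x * x - Real.exp x + 1) := by
    intro x
    rw [relEnt, if_pos ⟨Real.exp_pos x, one_pos⟩, div_one, Real.log_exp]
  calc youngC a ≤ relEnt (Real.exp q) 1 + relEnt (Real.exp (-q)) 1 :=
        iInf_le_of_le _ (iInf_le_of_le _ (iInf_le_of_le ha.symm le_rfl))
    _ = ENNReal.ofReal (a * q - (2 * Real.cosh q - 2)) := by
        rw [hs, hs, ← ENNReal.ofReal_add (exp_mul_self_sub_nonneg _) (exp_mul_self_sub_nonneg _), Real.cosh_eq]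
        congr 1
        linear_combination (-q) * ha

lemma youngC_formula_nonneg (a : ℝ) :
    0 ≤ a * Real.arsinh (a / 2) - (2 * Real.cosh (Real.arsinh (a / 2)) - 2) := by
  have ha := eq_exp_sub_exp_arsinh a
  set q := Real.arsinh (a / 2)
  have h1 := exp_mul_self_sub_nonneg q
  have h2 := exp_mul_self_sub_nonneg (-q)
  rw [Real.cosh_eq, ha]
  linarith

lemma measurable_youngC : Measurable youngC := by
  have : youngC = fun a => ENNReal.ofReal
      (a * Real.arsinh (a / 2) - (2 * Real.cosh (Real.arsinh (a / 2)) - 2)) :=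
    funext youngC_eq
  rw [this]
  have h : Continuous Real.arsinh := Real.continuous_arsinh
  have h' : Continuous Real.cosh := Real.continuous_cosh
  exact (ENNReal.continuous_ofReal.comp (by fun_prop)).measurable

lemma youngC_neg (a : ℝ) : youngC (-a) = youngC a := by
  rw [youngC_eq, youngC_eq, neg_div, Real.arsinh_neg, Real.cosh_neg, neg_mul_neg]

lemma youngCconj_le (p : ℝ) : youngCconj p ≤ ENNReal.ofReal (2 * Real.cosh p - 2) := by
  refine iSup_le fun a => tsub_le_iff_left.2 ?_
  calc ENNReal.ofReal (p * a)
      = ENNReal.ofReal ((a * p - (2 * Real.cosh p - 2)) + (2 * Real.cosh p - 2)) := by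
        congr 1; ring
    _ ≤ _ := ENNReal.ofReal_add_le
    _ ≤ _ := by gcongr; exact ofReal_fenchel_le_youngC _ _

/-- The Young inequality of the pair `𝒞`, `𝒞*`. -/
lemma ofReal_abs_mul_le (a p : ℝ) : ENNReal.ofReal |a * p| ≤ youngC a + youngCconj p := by
  have key : ∀ b : ℝ, ENNReal.ofReal (p * b) ≤ youngC b + youngCconj p := fun b =>
    tsub_le_iff_left.1 (le_iSup (fun b : ℝ => ENNReal.ofReal (p * b) - youngC b) b)
  rcases abs_cases (a * p) with h | h
  · rw [h.1, mul_comm]; exact key a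
  · rw [h.1, ← youngC_neg]
    convert key (-a) using 2
    ring

/-- A flux `j` of finite cost with respect to a bounded rate is controlled by the Young function. -/
lemma mul_youngC_le_relEnt_add {W b j : ℝ} (hW : 0 < W) (hb : 0 ≤ b) (hbW : b ≤ W) :
    ENNReal.ofReal W * youngC (j / W) ≤ relEnt j b + ENNReal.ofReal W := by
  rw [youngC_eq, ← ENNReal.ofReal_mul hW.le]
  set q := Real.arsinh (j / W / 2)
  refine le_trans ?_ (add_le_add_left (ofReal_fenchel_le_relEnt j b q) _)
  refine le_trans (ENNReal.ofReal_le_ofReal ?_) ENNReal.ofReal_add_le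
  have h1 : W * (j / W * q) = j * q := by field_simp
  have h2 : b * (Real.exp q - 1) ≤ W * (2 * Real.cosh q - 1) := by
    have h3 : Real.exp q - 1 ≤ 2 * Real.cosh q - 1 := by
      rw [Real.cosh_eq]
      linarith [Real.exp_pos (-q)]
    calc b * (Real.exp q - 1) ≤ b * (2 * Real.cosh q - 1) := by gcongr
      _ ≤ _ := by
        gcongr
        linarith [Real.one_le_cosh q]
  nlinarith

lemma exp_mul_sub_le {s : ℝ} (hs : 0 < s) (hs1 : s ≤ 1) (q : ℝ) :
    Real.exp (s * q) - 1 - s * q ≤ s ^ 2 * (2 * Real.cosh q - 2) := by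
  -- compare the power series of `exp (s q) - 1 - s q` and of `exp |q| - 1 - |q|`
  have hsum : ∀ x : ℝ, HasSum (fun n : ℕ => x ^ (n + 2) / (n + 2).factorial)
      (Real.exp x - 1 - x) := by
    intro x
    have h := (NormedSpace.expSeries_div_hasSum_exp (𝔸 := ℝ) x)
    rw [← Real.exp_eq_exp_ℝ] at h
    have := (hasSum_nat_add_iff' 2).2 h
    simpa [Finset.sum_range_succ, sub_sub] using this
  have h1 : Real.exp (s * q) - 1 - s * q ≤ s ^ 2 * (Real.exp |q| - 1 - |q|) := by
    refine hasSum_le (fun n => ?_) (hsum (s * q)) ((hsum |q|).mul_left (s ^ 2))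
    rw [← mul_div_assoc, mul_pow]
    gcongr ?_ / _
    have h2 : s ^ (n + 2) ≤ s ^ 2 := pow_le_pow_of_le_one hs.le hs1 (by omega)
    calc s ^ (n + 2) * q ^ (n + 2) ≤ s ^ (n + 2) * |q| ^ (n + 2) := by
          rw [← abs_pow]; gcongr; exact le_abs_self _
      _ ≤ _ := by gcongr
  refine h1.trans (mul_le_mul_of_nonneg_left ?_ (by positivity))
  have h3 := Real.add_one_le_exp (-|q|)
  rw [← Real.cosh_abs, Real.cosh_eq]
  linarith

/-- The rescaled excess flux on a fast edge is controlled by the Young function, uniformly for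
`ε ≤ 1`: the conjugate of the rescaled cost is `q ↦ (w / ε) (exp (√ε q) - 1 - √ε q)`, which is at
most `w 𝒞*(q)`. -/
lemma mul_youngC_le_relEnt_rescaled {W w ε j : ℝ} (hW : 0 < W) (hw : 0 ≤ w) (hwW : w ≤ W)
    (hε : 0 < ε) (hε1 : ε ≤ 1) :
    ENNReal.ofReal W * youngC (j / W) ≤ relEnt (1 / ε * w + 1 / √ε * j) (1 / ε * w) := by
  rw [youngC_eq, ← ENNReal.ofReal_mul hW.le]
  set q := Real.arsinh (j / W / 2)
  refine le_trans (ENNReal.ofReal_le_ofReal ?_) (ofReal_fenchel_le_relEnt _ _ (√ε * q))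
  have hs : 0 < √ε := Real.sqrt_pos.2 hε
  have hss : √ε ^ 2 = ε := Real.sq_sqrt hε.le
  have h1 : W * (j / W * q) = j * q := by field_simp
  have h2 := exp_mul_sub_le hs (Real.sqrt_le_one.2 hε1) q
  rw [hss] at h2
  have h3 : 1 / √ε * j * (√ε * q) = j * q := by field_simp
  have h4 : 1 / ε * w * (Real.exp (√ε * q) - 1 - √ε * q) ≤ W * (2 * Real.cosh q - 2) := by
    calc 1 / ε * w * (Real.exp (√ε * q) - 1 - √ε * q)
        ≤ 1 / ε * w * (ε * (2 * Real.cosh q - 2)) := by gcongr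
      _ = w * (2 * Real.cosh q - 2) := by field_simp
      _ ≤ _ := by
        gcongr
        linarith [Real.one_le_cosh q]
  nlinarith

/-! ### Weak compactness in `L¹` -/

section WeakCompactness

variable {X : Type*} [MeasurableSpace X] {μ : Measure X}

/-- Convergence of the integrals over measurable sets, for an equi-integrable sequence, defines a
signed measure with a density. -/
lemma exists_density_of_tendsto_setIntegral [IsFiniteMeasure μ] {f : ℕ → X → ℝ}
    (hf : ∀ n, Integrable (f n) μ) {K : ℝ} (hK : ∀ n, ∫ x, |f n x| ∂μ ≤ K)
    (hui : ∀ e : ℝ, 0 < e → ∃ δ : ℝ, 0 < δ ∧ ∀ n E, MeasurableSet E → μ.real E < δ →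
      ∫ x in E, |f n x| ∂μ ≤ e)
    {ν : Set X → ℝ}
    (hν : ∀ E, MeasurableSet E → Tendsto (fun n => ∫ x in E, f n x ∂μ) atTop (𝓝 (ν E))) :
    ∃ g : X → ℝ, Integrable g μ ∧ ∀ E, MeasurableSet E → ∫ x in E, g x ∂μ = ν E := by
  classical
  have hsmall : ∀ e : ℝ, 0 < e → ∃ δ : ℝ, 0 < δ ∧ ∀ E, MeasurableSet E → μ.real E < δ →
      |ν E| ≤ e := by
    intro e he
    obtain ⟨δ, hδ, h⟩ := hui e he
    refine ⟨δ, hδ, fun E hE hEδ => le_of_tendsto (hν E hE).abs (Eventually.of_forall fun n => ?_)⟩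
    exact (abs_integral_le_integral_abs).trans (h n E hE hEδ)
  have hfin : ∀ (A : ℕ → Set X), (∀ i, MeasurableSet (A i)) → Pairwise (Function.onFun Disjoint A) →
      ∀ s : Finset ℕ, ν (⋃ i ∈ s, A i) = ∑ i ∈ s, ν (A i) := by
    intro A hA hd s
    refine tendsto_nhds_unique (hν _ (s.measurableSet_biUnion fun i _ => hA i)) ?_
    have h : ∀ n, ∫ x in ⋃ i ∈ s, A i, f n x ∂μ = ∑ i ∈ s, ∫ x in A i, f n x ∂μ := fun n =>
      integral_biUnion_finset s (fun i _ => hA i) (fun i _ j _ hij => hd hij)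
        (fun i _ => (hf n).integrableOn)
    simp only [h]
    exact tendsto_finsetSum s fun i _ => hν _ (hA i)
  have habs : ∀ (A : ℕ → Set X), (∀ i, MeasurableSet (A i)) →
      Pairwise (Function.onFun Disjoint A) → Summable fun i => |ν (A i)| := by
    intro A hA hd
    refine summable_of_sum_le (c := K) (fun i => abs_nonneg _) fun s => ?_
    refine le_of_tendsto (tendsto_finsetSum s fun i _ => (hν _ (hA i)).abs)
      (Eventually.of_forall fun n => ?_)
    calc ∑ i ∈ s, |∫ x in A i, f n x ∂μ| ≤ ∑ i ∈ s, ∫ x in A i, |f n x| ∂μ :=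
          Finset.sum_le_sum fun i _ => abs_integral_le_integral_abs
      _ = ∫ x in ⋃ i ∈ s, A i, |f n x| ∂μ :=
          (integral_biUnion_finset s (fun i _ => hA i) (fun i _ j _ hij => hd hij)
            (fun i _ => (hf n).abs.integrableOn)).symm
      _ ≤ ∫ x, |f n x| ∂μ :=
          setIntegral_le_integral (hf n).abs (Eventually.of_forall fun x => abs_nonneg _)
      _ ≤ K := hK n
  have hsum : ∀ (A : ℕ → Set X), (∀ i, MeasurableSet (A i)) →
      Pairwise (Function.onFun Disjoint A) → HasSum (fun i => ν (A i)) (ν (⋃ i, A i)) := by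
    intro A hA hd
    rw [(habs A hA hd).of_abs.hasSum_iff_tendsto_nat, Metric.tendsto_atTop]
    intro e he
    obtain ⟨δ, hδ, h⟩ := hsmall (e / 2) (by positivity)
    have hμ : Tendsto (fun n => ∑ i ∈ Finset.range n, μ.real (A i)) atTop
        (𝓝 (μ.real (⋃ i, A i))) := by
      have hsum : ∑' i, μ (A i) ≠ ⊤ := by
        rw [← measure_iUnion hd hA]; exact measure_ne_top _ _
      have := (ENNReal.hasSum_toReal hsum).tendsto_sum_nat
      rwa [← ENNReal.tsum_toReal_eq fun i => measure_ne_top _ _, ← measure_iUnion hd hA] at this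
    obtain ⟨N, hN⟩ := (Metric.tendsto_atTop.1 hμ) δ hδ
    refine ⟨N, fun n hn => ?_⟩
    set B := ⋃ i ∈ Finset.range n, A i with hB
    have hBm : MeasurableSet B := Finset.measurableSet_biUnion _ fun i _ => hA i
    have hUm : MeasurableSet (⋃ i, A i) := MeasurableSet.iUnion hA
    have hBU : B ⊆ ⋃ i, A i := Set.iUnion₂_subset fun i _ => Set.subset_iUnion A i
    have h1 : ν (⋃ i, A i) - ∑ i ∈ Finset.range n, ν (A i) = ν ((⋃ i, A i) \ B) := by
      rw [← hfin A hA hd]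
      refine tendsto_nhds_unique ((hν _ hUm).sub (hν _ hBm)) ?_
      refine (hν _ (hUm.diff hBm)).congr fun m => ?_
      rw [setIntegral_sdiff hBm (hf m).integrableOn hBU]
    have h2 : μ.real ((⋃ i, A i) \ B) < δ := by
      rw [measureReal_sdiff hBU hBm, measureReal_biUnion_finset (fun i _ j _ hij => hd hij)
        (fun i _ => hA i)]
      have := hN n hn
      rw [Real.dist_eq, abs_sub_comm] at this
      exact (le_abs_self _).trans_lt this
    rw [dist_comm, Real.dist_eq, h1]
    linarith [h _ (hUm.diff hBm) h2]
  let s : SignedMeasure X :=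
    { measureOf' := fun E => if MeasurableSet E then ν E else 0
      empty' := by
        have := hν ∅ MeasurableSet.empty
        simp only [Measure.restrict_empty, integral_zero_measure] at this
        simp [tendsto_nhds_unique this tendsto_const_nhds]
      not_measurable' := fun E hE => if_neg hE
      m_iUnion' := fun A hA hd => by
        simpa only [hA, MeasurableSet.iUnion hA, if_true] using hsum A hA hd }
  have hs : ∀ E, MeasurableSet E → s E = ν E := fun E hE => if_pos hE
  have hac : s ≪ᵥ μ.toENNRealVectorMeasure := by
    refine VectorMeasure.AbsolutelyContinuous.mk fun E hE h0 => ?_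
    rw [Measure.toENNRealVectorMeasure_apply_measurable hE] at h0
    rw [hs E hE]
    refine tendsto_nhds_unique (hν E hE) ?_
    simp [setIntegral_measure_zero _ h0]
  refine ⟨s.rnDeriv μ, SignedMeasure.integrable_rnDeriv _ _, fun E hE => ?_⟩
  rw [← withDensityᵥ_apply (SignedMeasure.integrable_rnDeriv _ _) hE,
    SignedMeasure.withDensityᵥ_rnDeriv_eq s μ hac, hs E hE]

/-- **Dunford–Pettis**, sequential version: an equi-integrable sequence which is bounded in `L¹` has
a subsequence whose integrals over all measurable sets converge to those of an integrable
function. -/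
theorem exists_subseq_tendsto_setIntegral [IsFiniteMeasure μ] [IsSeparable μ] {f : ℕ → X → ℝ}
    (hf : ∀ n, Integrable (f n) μ) {K : ℝ} (hK : ∀ n, ∫ x, |f n x| ∂μ ≤ K)
    (hui : ∀ e : ℝ, 0 < e → ∃ δ : ℝ, 0 < δ ∧ ∀ n E, MeasurableSet E → μ.real E < δ →
      ∫ x in E, |f n x| ∂μ ≤ e) :
    ∃ φ : ℕ → ℕ, StrictMono φ ∧ ∃ g : X → ℝ, Integrable g μ ∧ ∀ E, MeasurableSet E →
      Tendsto (fun n => ∫ x in E, f (φ n) x ∂μ) atTop (𝓝 (∫ x in E, g x ∂μ)) := by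
  obtain ⟨𝒜, h𝒜c, h𝒜⟩ := exists_countable_measureDense μ
  have : Countable 𝒜 := h𝒜c.to_subtype
  have hbound : ∀ n E, |∫ x in E, f n x ∂μ| ≤ K := fun n E =>
    abs_integral_le_integral_abs.trans ((setIntegral_le_integral (hf n).abs
      (Eventually.of_forall fun x => abs_nonneg _)).trans (hK n))
  obtain ⟨a, -, φ, hφ, ha⟩ := (isCompact_univ_pi fun _ : 𝒜 => isCompact_Icc (a := -K)
    (b := K)).tendsto_subseq (x := fun n (A : 𝒜) => ∫ x in (A : Set X), f n x ∂μ)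
    (fun n A _ => abs_le.1 (hbound n A))
  have hcauchy : ∀ E, MeasurableSet E → ∃ b, Tendsto (fun n => ∫ x in E, f (φ n) x ∂μ) atTop
      (𝓝 b) := by
    intro E hE
    refine cauchySeq_tendsto_of_complete (Metric.cauchySeq_iff.2 fun e he => ?_)
    obtain ⟨δ, hδ, h⟩ := hui (e / 8) (by positivity)
    obtain ⟨A, hA, hEA⟩ := h𝒜.approx E hE (measure_ne_top μ E) δ hδ
    have hAm := h𝒜.measurable A hA
    have hd : ∀ B ⊆ E ∆ A, μ.real B < δ := fun B hB =>
      (measureReal_mono hB).trans_lt ((ENNReal.toReal_lt_of_lt_ofReal hEA))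
    have hclose : ∀ n, |∫ x in E, f n x ∂μ - ∫ x in A, f n x ∂μ| ≤ e / 4 := by
      intro n
      have h1 := integral_inter_add_sdiff (μ := μ) (s := E) hAm (hf n).integrableOn
      have h2 := integral_inter_add_sdiff (μ := μ) (s := A) hE (hf n).integrableOn
      rw [Set.inter_comm] at h2
      have h3 := abs_integral_le_integral_abs.trans (h n (E \ A) (hE.diff hAm)
        (hd _ Set.subset_union_left))
      have h4 := abs_integral_le_integral_abs.trans (h n (A \ E) (hAm.diff hE)
        (hd _ Set.subset_union_right))
      rw [← h1, ← h2]
      rw [abs_le] at *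
      constructor <;> linarith [h3.1, h3.2, h4.1, h4.2]
    have hA' : CauchySeq fun n => ∫ x in A, f (φ n) x ∂μ :=
      ((tendsto_pi_nhds.1 ha) ⟨A, hA⟩).cauchySeq
    obtain ⟨N, hN⟩ := Metric.cauchySeq_iff.1 hA' (e / 2) (by positivity)
    refine ⟨N, fun m hm n hn => ?_⟩
    have h1 := hN m hm n hn
    have h2 := hclose (φ m)
    have h3 := hclose (φ n)
    rw [Real.dist_eq] at *
    rw [abs_le] at h2 h3
    rw [abs_lt] at *
    constructor <;> linarith [h1.1, h1.2, h2.1, h2.2, h3.1, h3.2]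
  choose! ν hν using hcauchy
  obtain ⟨g, hg, hgν⟩ := exists_density_of_tendsto_setIntegral (fun n => hf (φ n))
    (fun n => hK (φ n)) (fun e he => by
      obtain ⟨δ, hδ, h⟩ := hui e he
      exact ⟨δ, hδ, fun n => h (φ n)⟩) hν
  exact ⟨φ, hφ, g, hg, fun E hE => by rw [hgν E hE]; exact hν E hE⟩

/-- Convergence of the integrals over sets implies convergence of those against bounded measurable
functions. -/
lemma tendsto_integral_mul_of_bounded {f : ℕ → X → ℝ} {g : X → ℝ} (hf : ∀ n, Integrable (f n) μ)
    (hg : Integrable g μ) {K : ℝ} (hK : ∀ n, ∫ x, |f n x| ∂μ ≤ K)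
    (hfg : ∀ E, MeasurableSet E → Tendsto (fun n => ∫ x in E, f n x ∂μ) atTop
      (𝓝 (∫ x in E, g x ∂μ)))
    {h : X → ℝ} (hh : Measurable h) {B : ℝ} (hB : ∀ x, |h x| ≤ B) :
    Tendsto (fun n => ∫ x, f n x * h x ∂μ) atTop (𝓝 (∫ x, g x * h x ∂μ)) := by
  have hint : ∀ {u : X → ℝ} {v : X → ℝ} {B : ℝ}, Integrable u μ → Measurable v →
      (∀ x, |v x| ≤ B) → Integrable (fun x => u x * v x) μ := by
    intro u v B hu hv hvB
    exact hu.mul_bdd hv.aestronglyMeasurable (Eventually.of_forall hvB)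
  have hsimple : ∀ s : SimpleFunc X ℝ, Tendsto (fun n => ∫ x, f n x * s x ∂μ) atTop
      (𝓝 (∫ x, g x * s x ∂μ)) := by
    intro s
    have hbd : ∀ s : SimpleFunc X ℝ, ∃ B, ∀ x, |s x| ≤ B := fun s => s.exists_forall_norm_le
    induction s using SimpleFunc.induction with
    | @const c E hE =>
      have : ∀ u : X → ℝ, ∫ x, u x * (SimpleFunc.piecewise E hE (SimpleFunc.const X c)
          (SimpleFunc.const X 0)) x ∂μ = (∫ x in E, u x ∂μ) * c := by
        intro u
        rw [← integral_mul_const, ← integral_indicator hE]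
        refine integral_congr_ae (Eventually.of_forall fun x => ?_)
        by_cases hx : x ∈ E <;> simp [hx]
      simp only [this]
      exact (hfg E hE).mul_const c
    | @add s t hd hs ht =>
      obtain ⟨B₁, hB₁⟩ := hbd s
      obtain ⟨B₂, hB₂⟩ := hbd t
      have : ∀ u : X → ℝ, Integrable u μ → ∫ x, u x * (s + t) x ∂μ =
          (∫ x, u x * s x ∂μ) + ∫ x, u x * t x ∂μ := by
        intro u hu
        rw [← integral_add (hint hu s.measurable hB₁) (hint hu t.measurable hB₂)]
        refine integral_congr_ae (Eventually.of_forall fun x => ?_)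
        simp [mul_add]
      rw [this g hg]
      simp only [this _ (hf _)]
      exact hs.add ht
  rw [Metric.tendsto_atTop]
  intro e he
  have hK0 : 0 ≤ K := (integral_nonneg fun x => abs_nonneg _).trans (hK 0)
  set L := K + ∫ x, |g x| ∂μ + 1 with hL
  have hg0 : 0 ≤ ∫ x, |g x| ∂μ := integral_nonneg fun x => abs_nonneg _
  have hLpos : 0 < L := by positivity
  -- discretize the values of `h` with step `d`
  set d := e / (4 * L) with hd
  have hdpos : 0 < d := by positivity
  have hfin : (Set.range fun x => (⌊h x / d⌋ : ℝ) * d).Finite := by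
    have hsub : (Set.range fun x => (⌊h x / d⌋ : ℝ) * d) ⊆
        (fun k : ℤ => (k : ℝ) * d) '' Set.Icc ⌊-B / d⌋ ⌊B / d⌋ := by
      rintro _ ⟨x, rfl⟩
      refine ⟨⌊h x / d⌋, ⟨?_, ?_⟩, rfl⟩
      · exact Int.floor_le_floor (by gcongr; exact (abs_le.1 (hB x)).1)
      · exact Int.floor_le_floor (by gcongr; exact (abs_le.1 (hB x)).2)
    exact ((Set.finite_Icc _ _).image _).subset hsub
  let s : SimpleFunc X ℝ :=
    { toFun := fun x => (⌊h x / d⌋ : ℝ) * d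
      measurableSet_fiber' := fun y => by
        have : Measurable fun x => (⌊h x / d⌋ : ℝ) * d := by fun_prop
        exact this (measurableSet_singleton y)
      finite_range' := hfin }
  have hs : ∀ x, |h x - s x| ≤ d := by
    intro x
    change |h x - (⌊h x / d⌋ : ℝ) * d| ≤ d
    have h1 := Int.floor_le (h x / d)
    have h2 := (Int.lt_floor_add_one (h x / d)).le
    rw [le_div_iff₀ hdpos] at h1
    rw [div_le_iff₀ hdpos] at h2
    rw [abs_le]
    constructor <;> linarith
  obtain ⟨Bs, hBs⟩ := s.exists_forall_norm_le
  have hclose : ∀ u : X → ℝ, Integrable u μ → ∫ x, |u x| ∂μ ≤ L →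
      |∫ x, u x * h x ∂μ - ∫ x, u x * s x ∂μ| ≤ e / 4 := by
    intro u hu huL
    rw [← integral_sub (hint hu hh hB) (hint hu s.measurable hBs)]
    calc |∫ x, (u x * h x - u x * s x) ∂μ| ≤ ∫ x, |u x * h x - u x * s x| ∂μ :=
          abs_integral_le_integral_abs
      _ ≤ ∫ x, |u x| * d ∂μ := by
          refine integral_mono_of_nonneg (Eventually.of_forall fun x => abs_nonneg _)
            (hu.abs.mul_const d) (Eventually.of_forall fun x => ?_)
          simp only
          rw [← mul_sub, abs_mul]
          gcongr
          exact hs x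
      _ = (∫ x, |u x| ∂μ) * d := integral_mul_const _ _
      _ ≤ L * d := by gcongr
      _ = e / 4 := by rw [hd]; field_simp
  obtain ⟨N, hN⟩ := Metric.tendsto_atTop.1 (hsimple s) (e / 4) (by positivity)
  refine ⟨N, fun n hn => ?_⟩
  have h1 := hN n hn
  have h2 := hclose (f n) (hf n) (by linarith [hK n])
  have h3 := hclose g hg (by linarith)
  rw [Real.dist_eq] at *
  rw [abs_le] at h2 h3
  rw [abs_lt] at *
  constructor <;> linarith [h1.1, h1.2, h2.1, h2.2, h3.1, h3.2]

/-- If moreover the products with `ζ` have uniformly small integrals where `ζ` is large, then the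
integrals against the unbounded function `ζ` converge. -/
lemma tendsto_integral_mul_of_tail {f : ℕ → X → ℝ} {g : X → ℝ} (hf : ∀ n, Integrable (f n) μ)
    (hg : Integrable g μ) {K : ℝ} (hK : ∀ n, ∫ x, |f n x| ∂μ ≤ K)
    (hfg : ∀ E, MeasurableSet E → Tendsto (fun n => ∫ x in E, f n x ∂μ) atTop
      (𝓝 (∫ x in E, g x ∂μ)))
    {ζ : X → ℝ} (hζ : Measurable ζ) (hfζ : ∀ n, Integrable (fun x => f n x * ζ x) μ)
    (hgζ : Integrable (fun x => g x * ζ x) μ)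
    (htail : ∀ e : ℝ, 0 < e → ∃ k : ℝ, (∀ n, ∫ x in {x | k < |ζ x|}, |f n x * ζ x| ∂μ ≤ e) ∧
      ∫ x in {x | k < |ζ x|}, |g x * ζ x| ∂μ ≤ e) :
    Tendsto (fun n => ∫ x, f n x * ζ x ∂μ) atTop (𝓝 (∫ x, g x * ζ x ∂μ)) := by
  rw [Metric.tendsto_atTop]
  intro e he
  obtain ⟨k, hkf, hkg⟩ := htail (e / 4) (by positivity)
  set E := {x | k < |ζ x|} with hE
  have hEm : MeasurableSet E := measurableSet_lt measurable_const hζ.abs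
  have hb : ∀ x, |Eᶜ.indicator ζ x| ≤ |k| := by
    intro x
    by_cases hx : x ∈ E
    · simp [hx]
    · rw [Set.indicator_of_mem (by exact hx)]
      exact (not_lt.1 hx).trans (le_abs_self k)
  have hlim := tendsto_integral_mul_of_bounded hf hg hK hfg (hζ.indicator hEm.compl) hb
  have hclose : ∀ u : X → ℝ, Integrable (fun x => u x * ζ x) μ →
      ∫ x in E, |u x * ζ x| ∂μ ≤ e / 4 →
      |∫ x, u x * ζ x ∂μ - ∫ x, u x * Eᶜ.indicator ζ x ∂μ| ≤ e / 4 := by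
    intro u hu huE
    have h1 : ∫ x, u x * Eᶜ.indicator ζ x ∂μ = ∫ x in Eᶜ, u x * ζ x ∂μ := by
      rw [← integral_indicator hEm.compl]
      refine integral_congr_ae (Eventually.of_forall fun x => ?_)
      by_cases hx : x ∈ E <;> simp [hx]
    rw [h1, ← integral_add_compl hEm hu, add_sub_cancel_right]
    exact abs_integral_le_integral_abs.trans huE
  obtain ⟨N, hN⟩ := Metric.tendsto_atTop.1 hlim (e / 4) (by positivity)
  refine ⟨N, fun n hn => ?_⟩
  have h1 := hN n hn
  have h2 := hclose (f n) (hfζ n) (hkf n)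
  have h3 := hclose g hgζ hkg
  rw [Real.dist_eq] at *
  rw [abs_le] at h2 h3
  rw [abs_lt] at *
  constructor <;> linarith [h1.1, h1.2, h2.1, h2.2, h3.1, h3.2]

end WeakCompactness

/-! ### Estimates in the Orlicz class -/

section Orlicz

lemma integral_le_of_lintegral_ofReal_le {X : Type*} [MeasurableSpace X] {μ : Measure X}
    {u : X → ℝ} (hu : Integrable u μ) {K : ℝ≥0} (h : ∫⁻ x, ENNReal.ofReal (u x) ∂μ ≤ K) :
    ∫ x, u x ∂μ ≤ K := by
  rw [integral_eq_lintegral_pos_part_sub_lintegral_neg_part hu]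
  have h1 := ENNReal.toReal_mono ENNReal.coe_ne_top h
  have h2 : 0 ≤ (∫⁻ x, ENNReal.ofReal (-u x) ∂μ).toReal := ENNReal.toReal_nonneg
  rw [ENNReal.coe_toReal] at h1
  linarith

variable {X : Type*} [MeasurableSpace X] {μ : Measure X}

/-- Young's inequality, with free scales `a` and `b`. -/
lemma ofReal_abs_mul_le_scaled {a b : ℝ} (ha : 0 < a) (hb : 0 < b) (x y : ℝ) :
    ENNReal.ofReal |x * y| ≤ ENNReal.ofReal (a * b) * (youngC (x / a) + youngCconj (y / b)) := by
  calc ENNReal.ofReal |x * y| = ENNReal.ofReal (a * b) * ENNReal.ofReal |x / a * (y / b)| := by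
        rw [← ENNReal.ofReal_mul (by positivity)]
        congr 1
        rw [← abs_of_pos (mul_pos ha hb), ← abs_mul]
        congr 1
        field_simp
    _ ≤ _ := by gcongr; exact ofReal_abs_mul_le _ _

lemma lintegral_abs_mul_le {a b : ℝ} (ha : 0 < a) (hb : 0 < b) {f : X → ℝ}
    (hf : AEMeasurable f μ) (ζ : X → ℝ) :
    ∫⁻ x, ENNReal.ofReal |f x * ζ x| ∂μ ≤ ENNReal.ofReal (a * b) *
      (∫⁻ x, youngC (f x / a) ∂μ + ∫⁻ x, youngCconj (ζ x / b) ∂μ) := by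
  have hm : AEMeasurable (fun x => youngC (f x / a)) μ :=
    measurable_youngC.comp_aemeasurable (hf.div_const a)
  rw [← lintegral_add_left' hm,
    ← lintegral_const_mul' _ _ ENNReal.ofReal_ne_top]
  exact lintegral_mono fun x => ofReal_abs_mul_le_scaled ha hb _ _

lemma integrable_mul_of_young {a : ℝ} (ha : 0 < a) {f ζ : X → ℝ}
    (hf : AEStronglyMeasurable f μ) (hζ : AEStronglyMeasurable ζ μ)
    (hfa : ∫⁻ x, youngC (f x / a) ∂μ ≠ ⊤) {b : ℝ} (hb : 0 < b)
    (hζb : ∫⁻ x, youngCconj (ζ x / b) ∂μ ≠ ⊤) : Integrable (fun x => f x * ζ x) μ := by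
  refine ⟨hf.mul hζ, ?_⟩
  rw [hasFiniteIntegral_iff_norm]
  refine (lintegral_abs_mul_le ha hb hf.aemeasurable ζ).trans_lt ?_
  exact ENNReal.mul_lt_top ENNReal.ofReal_lt_top
    (ENNReal.add_lt_top.2 ⟨hfa.lt_top, hζb.lt_top⟩)

/-- A bound in the Orlicz class controls the integral over a set by its measure; the scale `l` is
free. -/
lemma setLIntegral_abs_le {a l : ℝ} (ha : 0 < a) (hl : 0 < l) {f : X → ℝ}
    (hf : AEMeasurable f μ) (E : Set X) :
    ∫⁻ x in E, ENNReal.ofReal |f x| ∂μ ≤ ENNReal.ofReal (a / l) *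
      (∫⁻ x, youngC (f x / a) ∂μ + ENNReal.ofReal (2 * Real.cosh l - 2) * μ E) := by
  have h := lintegral_abs_mul_le (μ := μ.restrict E) ha (one_div_pos.2 hl) hf.restrict
    (fun _ => 1)
  simp only [mul_one, one_div, lintegral_const, Measure.restrict_apply_univ, div_inv_eq_mul,
    one_mul] at h
  refine h.trans ?_
  rw [← div_eq_mul_inv]
  exact mul_le_mul_right (add_le_add (setLIntegral_le_lintegral _ _)
    (mul_le_mul_left (youngCconj_le l) _)) _

variable [IsFiniteMeasure μ]

lemma setIntegral_abs_le {a l : ℝ} (ha : 0 < a) (hl : 0 < l) {f : X → ℝ}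
    (hf : AEStronglyMeasurable f μ) {K : ℝ≥0} (hK : ∫⁻ x, youngC (f x / a) ∂μ ≤ K) (E : Set X) :
    ∫ x in E, |f x| ∂μ ≤ a / l * (K + (2 * Real.cosh l - 2) * μ.real E) := by
  have hc : 0 ≤ 2 * Real.cosh l - 2 := by linarith [Real.one_le_cosh l]
  rw [integral_eq_lintegral_of_nonneg_ae (Eventually.of_forall fun x => abs_nonneg _)
    (continuous_abs.comp_aestronglyMeasurable hf.restrict)]
  refine ENNReal.toReal_le_of_le_ofReal (by positivity) ?_
  refine (setLIntegral_abs_le ha hl hf.aemeasurable E).trans ?_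
  rw [ENNReal.ofReal_mul (by positivity), ENNReal.ofReal_add (by positivity) (by positivity),
    ENNReal.ofReal_mul hc, measureReal_def, ENNReal.ofReal_toReal (measure_ne_top _ _),
    ENNReal.ofReal_coe_nnreal]
  gcongr

lemma integrable_of_youngC {a : ℝ} (ha : 0 < a) {f : X → ℝ} (hf : AEStronglyMeasurable f μ)
    (hK : ∫⁻ x, youngC (f x / a) ∂μ ≠ ⊤) : Integrable f μ := by
  refine ⟨hf, ?_⟩
  rw [hasFiniteIntegral_iff_norm]
  have := setLIntegral_abs_le (μ := μ) ha one_pos hf.aemeasurable Set.univ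
  rw [Measure.restrict_univ] at this
  exact this.trans_lt (ENNReal.mul_lt_top ENNReal.ofReal_lt_top
    (ENNReal.add_lt_top.2 ⟨hK.lt_top, ENNReal.mul_lt_top ENNReal.ofReal_lt_top
      (measure_lt_top _ _)⟩))

/-- Orlicz bounds imply equi-integrability (the de la Vallée Poussin criterion). The modulus `δ`
depends on the bounds only. -/
lemma exists_equiintegrability_modulus {a : ℝ} (ha : 0 < a) (K : ℝ≥0) {e : ℝ} (he : 0 < e) :
    ∃ δ : ℝ, 0 < δ ∧ ∀ f : X → ℝ, AEStronglyMeasurable f μ → ∫⁻ x, youngC (f x / a) ∂μ ≤ K →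
      ∀ E, μ.real E < δ → ∫ x in E, |f x| ∂μ ≤ e := by
  -- with the scale `l` the two terms of the bound on the integral become at most `e / 2` each
  set l : ℝ := 2 * a * (K + 1) / e with hl
  have hlpos : 0 < l := by positivity
  have hc : 0 ≤ 2 * Real.cosh l - 2 := by linarith [Real.one_le_cosh l]
  refine ⟨1 / (2 * Real.cosh l - 1), by apply one_div_pos.2; linarith, fun f hf hfK E hE => ?_⟩
  refine (setIntegral_abs_le ha hlpos hf hfK E).trans ?_
  have h1 : (2 * Real.cosh l - 2) * μ.real E ≤ 1 := by
    rw [lt_div_iff₀ (by linarith)] at hE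
    nlinarith [measureReal_nonneg (μ := μ) (s := E)]
  calc a / l * (K + (2 * Real.cosh l - 2) * μ.real E) ≤ a / l * (K + 1) := by gcongr
    _ = e / 2 := by rw [hl]; field_simp
    _ ≤ e := by linarith

lemma exists_setLIntegral_tail_le {ζ : X → ℝ} (hζ : Measurable ζ) {G : X → ℝ≥0∞}
    (hG : ∫⁻ x, G x ∂μ ≠ ⊤) {e : ℝ≥0∞} (he : 0 < e) :
    ∃ k : ℝ, ∫⁻ x in {x | k < |ζ x|}, G x ∂μ ≤ e := by
  have hm : Tendsto (fun k : ℕ => μ {x | (k : ℝ) < |ζ x|}) atTop (𝓝 0) := by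
    have h := tendsto_measure_iInter_atTop (μ := μ) (s := fun k : ℕ => {x | (k : ℝ) < |ζ x|})
      (fun k => (measurableSet_lt measurable_const hζ.abs).nullMeasurableSet)
      (fun i j hij x hx => lt_of_le_of_lt (Nat.cast_le.2 hij) (Set.mem_ofPred_eq ▸ hx))
      ⟨0, measure_ne_top _ _⟩
    have h0 : ⋂ k : ℕ, {x | (k : ℝ) < |ζ x|} = ∅ := by
      ext x
      simp only [Set.mem_iInter, Set.mem_ofPred_eq, Set.mem_empty_iff_false, iff_false, not_forall,
        not_lt]
      exact exists_nat_ge _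
    rwa [h0, measure_empty] at h
  have := tendsto_setLIntegral_zero hG hm
  obtain ⟨k, hk⟩ := (this.eventually (eventually_le_nhds he)).exists
  exact ⟨k, hk⟩

/-- The Orlicz bound is preserved by weak limits, since `𝒞` is a supremum of affine functions. -/
lemma lintegral_youngC_le_of_tendsto {a : ℝ} (ha : 0 < a) {K : ℝ≥0} {f : ℕ → X → ℝ} {g : X → ℝ}
    (hfm : ∀ n, AEStronglyMeasurable (f n) μ) (hfK : ∀ n, ∫⁻ x, youngC (f n x / a) ∂μ ≤ K)
    (hg : Integrable g μ) (hfg : ∀ h : X → ℝ, Measurable h → ∀ B : ℝ, (∀ x, |h x| ≤ B) →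
      Tendsto (fun n => ∫ x, f n x * h x ∂μ) atTop (𝓝 (∫ x, g x * h x ∂μ))) :
    ∫⁻ x, youngC (g x / a) ∂μ ≤ K := by
  wlog hgm : Measurable g generalizing g
  · obtain ⟨g', hg'm, hgae⟩ := hg.1.aemeasurable
    have := this (g := g') (hg.congr hgae) (fun h hh B hB => by
      have h1 : ∫ x, g' x * h x ∂μ = ∫ x, g x * h x ∂μ :=
        integral_congr_ae (by filter_upwards [hgae] with x hx; rw [hx])
      rw [h1]
      exact hfg h hh B hB) hg'm
    refine le_trans (le_of_eq (lintegral_congr_ae ?_)) this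
    filter_upwards [hgae] with x hx
    rw [hx]
  set q : X → ℝ := fun x => Real.arsinh (g x / a / 2) with hq
  have hqm : Measurable q := Real.continuous_arsinh.measurable.comp (by fun_prop)
  set A : ℕ → Set X := fun k => {x | |q x| ≤ k} with hA
  have hAm : ∀ k, MeasurableSet (A k) := fun k => measurableSet_le hqm.abs measurable_const
  have hAmono : Monotone A := fun i j hij x (hx : |q x| ≤ i) =>
    show |q x| ≤ j from hx.trans (Nat.cast_le.2 hij)
  have hAU : ⋃ k, A k = Set.univ := by
    ext x
    simpa [hA] using exists_nat_ge |q x|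
  have key : ∀ k, ∫⁻ x in A k, youngC (g x / a) ∂μ ≤ K := by
    intro k
    set h : X → ℝ := (A k).indicator q with hh
    have hhm : Measurable h := hqm.indicator (hAm k)
    have hhB : ∀ x, |h x| ≤ k := by
      intro x
      by_cases hx : x ∈ A k
      · rw [hh, Set.indicator_of_mem hx]
        exact hx
      · simp [hh, hx]
    set c : X → ℝ := fun x => 2 * Real.cosh (h x) - 2 with hc
    have hcm : Measurable c := by
      have := Real.continuous_cosh.measurable.comp hhm
      simp only [hc]
      exact (this.const_mul 2).sub_const 2
    have hci : Integrable c μ := by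
      refine Integrable.of_bound hcm.aestronglyMeasurable (2 * Real.cosh k - 2)
        (Eventually.of_forall fun x => ?_)
      have h1 := Real.one_le_cosh (h x)
      have h2 : Real.cosh (h x) ≤ Real.cosh k := by
        rw [Real.cosh_le_cosh]
        exact (hhB x).trans (le_abs_self _)
      rw [Real.norm_eq_abs, abs_of_nonneg (by simp only [hc]; linarith)]
      simp only [hc]
      linarith
    have hint : ∀ u : X → ℝ, Integrable u μ → Integrable (fun x => u x * h x) μ :=
      fun u hu => hu.mul_bdd hhm.aestronglyMeasurable (Eventually.of_forall hhB)
    have hfi : ∀ n, Integrable (f n) μ := fun n =>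
      integrable_of_youngC ha (hfm n) ((hfK n).trans_lt ENNReal.coe_lt_top).ne
    have hle : ∀ n, (∫ x, f n x * h x ∂μ) / a - ∫ x, c x ∂μ ≤ K := by
      intro n
      rw [← integral_div, ← integral_sub ((hint _ (hfi n)).div_const a) hci]
      refine integral_le_of_lintegral_ofReal_le (((hint _ (hfi n)).div_const a).sub hci)
        (le_trans (lintegral_mono fun x => ?_) (hfK n))
      have := ofReal_fenchel_le_youngC (f n x / a) (h x)
      rwa [div_mul_eq_mul_div] at this
    have hlim : (∫ x, g x * h x ∂μ) / a - ∫ x, c x ∂μ ≤ K :=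
      le_of_tendsto (((hfg h hhm k hhB).div_const a).sub_const _) (Eventually.of_forall hle)
    have hgc : ∀ x, g x * h x / a - c x = (A k).indicator (fun x => g x / a * q x -
        (2 * Real.cosh (q x) - 2)) x := by
      intro x
      by_cases hx : x ∈ A k
      · simp [hh, hc, hx]; ring
      · simp [hh, hc, hx]
    have hFi : Integrable ((A k).indicator fun x => g x / a * q x -
        (2 * Real.cosh (q x) - 2)) μ :=
      (((hint g hg).div_const a).sub hci).congr (Eventually.of_forall hgc)
    have hF0 : ∀ x, 0 ≤ (A k).indicator (fun x => g x / a * q x -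
        (2 * Real.cosh (q x) - 2)) x := fun x =>
      Set.indicator_nonneg (fun x _ => youngC_formula_nonneg (g x / a)) x
    calc ∫⁻ x in A k, youngC (g x / a) ∂μ
        = ∫⁻ x, ENNReal.ofReal ((A k).indicator (fun x => g x / a * q x -
          (2 * Real.cosh (q x) - 2)) x) ∂μ := by
          rw [← lintegral_indicator (hAm k)]
          refine lintegral_congr fun x => ?_
          by_cases hx : x ∈ A k
          · simp only [hx, Set.indicator_of_mem, youngC_eq, hq]
          · simp [hx]
      _ = ENNReal.ofReal (∫ x, (A k).indicator (fun x => g x / a * q x -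
          (2 * Real.cosh (q x) - 2)) x ∂μ) :=
          (ofReal_integral_eq_lintegral_ofReal hFi (Eventually.of_forall hF0)).symm
      _ ≤ K := by
          rw [← ENNReal.ofReal_coe_nnreal]
          refine ENNReal.ofReal_le_ofReal ?_
          rw [← integral_congr_ae (Eventually.of_forall hgc), integral_sub
            ((hint g hg).div_const a) hci, integral_div]
          exact hlim
  have hdir : Directed (· ⊆ ·) A := hAmono.directed_le
  calc ∫⁻ x, youngC (g x / a) ∂μ = ∫⁻ x in ⋃ k, A k, youngC (g x / a) ∂μ := by
        rw [hAU, Measure.restrict_univ]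
    _ = ⨆ k, ∫⁻ x in A k, youngC (g x / a) ∂μ := setLIntegral_iUnion_of_directed _ hdir
    _ ≤ K := iSup_le key

end Orlicz

/-! ### Sequential compactness in the four kinds of spaces -/

section Subsequences

variable {X : Type*} [MeasurableSpace X] {μ : Measure X} [IsFiniteMeasure μ]

/-- Sequential weak-* compactness of bounded sets of the Orlicz space. -/
theorem exists_subseq_tendsto_orlicz [IsSeparable μ] {a : ℝ} (ha : 0 < a) {K : ℝ≥0}
    {f : ℕ → X → ℝ} (hfm : ∀ n, AEStronglyMeasurable (f n) μ)
    (hfK : ∀ n, ∫⁻ x, youngC (f n x / a) ∂μ ≤ K) :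
    ∃ φ : ℕ → ℕ, StrictMono φ ∧ ∃ g : X → ℝ, AEStronglyMeasurable g μ ∧
      ∫⁻ x, youngC (g x / a) ∂μ ≤ K ∧ ∀ ζ : X → ℝ, AEStronglyMeasurable ζ μ →
        (∀ b : ℝ, 0 < b → ∫⁻ x, youngCconj (ζ x / b) ∂μ < ⊤) →
        Tendsto (fun n => ∫ x, f (φ n) x * ζ x ∂μ) atTop (𝓝 (∫ x, g x * ζ x ∂μ)) := by
  have hK : ∀ {u : X → ℝ}, ∫⁻ x, youngC (u x / a) ∂μ ≤ K → ∫⁻ x, youngC (u x / a) ∂μ ≠ ⊤ :=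
    fun h => (h.trans_lt ENNReal.coe_lt_top).ne
  have hfi : ∀ n, Integrable (f n) μ := fun n => integrable_of_youngC ha (hfm n) (hK (hfK n))
  set L : ℝ := a / 1 * (K + (2 * Real.cosh 1 - 2) * μ.real Set.univ) with hL
  have hfL : ∀ n, ∫ x, |f n x| ∂μ ≤ L := fun n => by
    rw [← setIntegral_univ]
    exact setIntegral_abs_le ha one_pos (hfm n) (hfK n) Set.univ
  obtain ⟨φ, hφ, g, hg, hfg⟩ := exists_subseq_tendsto_setIntegral hfi hfL (fun e he => by
    obtain ⟨δ, hδ, h⟩ := exists_equiintegrability_modulus (μ := μ) ha K he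
    exact ⟨δ, hδ, fun n E _ hE => h (f n) (hfm n) (hfK n) E hE⟩)
  have hgK : ∫⁻ x, youngC (g x / a) ∂μ ≤ K :=
    lintegral_youngC_le_of_tendsto ha (fun n => hfm (φ n)) (fun n => hfK (φ n)) hg
      fun h hh B hB => tendsto_integral_mul_of_bounded (fun n => hfi (φ n)) hg
        (fun n => hfL (φ n)) hfg hh hB
  refine ⟨φ, hφ, g, hg.1, hgK, fun ζ hζ hζb => ?_⟩
  obtain ⟨ζ', hζ'm, hζζ'⟩ := hζ.aemeasurable
  have hζ'b : ∀ b : ℝ, 0 < b → ∫⁻ x, youngCconj (ζ' x / b) ∂μ ≠ ⊤ := fun b hb => by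
    rw [← lintegral_congr_ae (f := fun x => youngCconj (ζ x / b))
      (by filter_upwards [hζζ'] with x hx; rw [hx])]
    exact (hζb b hb).ne
  have hcongr : ∀ u : X → ℝ, ∫ x, u x * ζ x ∂μ = ∫ x, u x * ζ' x ∂μ := fun u =>
    integral_congr_ae (by filter_upwards [hζζ'] with x hx; rw [hx])
  simp only [hcongr]
  refine tendsto_integral_mul_of_tail (fun n => hfi (φ n)) hg (fun n => hfL (φ n)) hfg hζ'm
    (fun n => integrable_mul_of_young ha (hfm _) hζ'm.aestronglyMeasurable (hK (hfK _)) one_pos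
      (hζ'b 1 one_pos))
    (integrable_mul_of_young ha hg.1 hζ'm.aestronglyMeasurable (hK hgK) one_pos
      (hζ'b 1 one_pos)) fun e he => ?_
  -- the scale `b` of `ζ` makes the contribution of the Orlicz bound `K` small
  set b : ℝ := e / (a * (K + 1)) with hb
  have hbpos : 0 < b := by positivity
  obtain ⟨k, hk⟩ := exists_setLIntegral_tail_le hζ'm (hζ'b b hbpos) one_pos
  have key : ∀ u : X → ℝ, AEStronglyMeasurable u μ → ∫⁻ x, youngC (u x / a) ∂μ ≤ K →
      ∫ x in {x | k < |ζ' x|}, |u x * ζ' x| ∂μ ≤ e := by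
    intro u hu huK
    have hm : AEStronglyMeasurable (fun x => |u x * ζ' x|) (μ.restrict {x | k < |ζ' x|}) :=
      (hu.mul hζ'm.aestronglyMeasurable).norm.restrict
    rw [integral_eq_lintegral_of_nonneg_ae (Eventually.of_forall fun x => abs_nonneg _) hm]
    refine ENNReal.toReal_le_of_le_ofReal he.le ?_
    calc ∫⁻ x in {x | k < |ζ' x|}, ENNReal.ofReal |u x * ζ' x| ∂μ
        ≤ ENNReal.ofReal (a * b) * (∫⁻ x in {x | k < |ζ' x|}, youngC (u x / a) ∂μ +
          ∫⁻ x in {x | k < |ζ' x|}, youngCconj (ζ' x / b) ∂μ) :=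
          lintegral_abs_mul_le ha hbpos hu.aemeasurable.restrict ζ'
      _ ≤ ENNReal.ofReal (a * b) * (K + 1) := by
          gcongr
          exact (setLIntegral_le_lintegral _ _).trans huK
      _ = ENNReal.ofReal e := by
          have h1 : (K : ℝ≥0∞) + 1 = ENNReal.ofReal ((K : ℝ) + 1) := by
            rw [ENNReal.ofReal_add (NNReal.coe_nonneg K) zero_le_one, ENNReal.ofReal_coe_nnreal, ENNReal.ofReal_one]
          rw [h1, ← ENNReal.ofReal_mul (by positivity), hb]
          congr 1
          field_simp
  exact ⟨k, fun n => key _ (hfm _) (hfK _), key g hg.1 hgK⟩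

/-- Sequential weak-* compactness of bounded sets of `L^∞`. -/
theorem exists_subseq_tendsto_linfty [IsSeparable μ] {B : ℝ} {f : ℕ → X → ℝ}
    (hfm : ∀ n, AEStronglyMeasurable (f n) μ) (hfB : ∀ n, ∀ᵐ x ∂μ, |f n x| ≤ B) :
    ∃ φ : ℕ → ℕ, StrictMono φ ∧ ∃ g : X → ℝ, AEStronglyMeasurable g μ ∧
      (∀ᵐ x ∂μ, |g x| ≤ B) ∧ ∀ ζ : X → ℝ, Integrable ζ μ →
        Tendsto (fun n => ∫ x, f (φ n) x * ζ x ∂μ) atTop (𝓝 (∫ x, g x * ζ x ∂μ)) := by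
  have hfi : ∀ n, Integrable (f n) μ := fun n => Integrable.of_bound (hfm n) B (hfB n)
  have hfE : ∀ n (E : Set X), ∫ x in E, |f n x| ∂μ ≤ B * μ.real E := fun n E => by
    calc ∫ x in E, |f n x| ∂μ ≤ ∫ _ in E, B ∂μ :=
          integral_mono_ae (hfi n).abs.integrableOn (integrable_const _)
            (ae_restrict_of_ae (hfB n))
      _ = B * μ.real E := by simp [mul_comm]
  have hfL : ∀ n, ∫ x, |f n x| ∂μ ≤ B * μ.real Set.univ := fun n => by
    rw [← setIntegral_univ]; exact hfE n _
  obtain ⟨φ, hφ, g, hg, hfg⟩ := exists_subseq_tendsto_setIntegral hfi hfL (fun e he => by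
    refine ⟨e / (|B| + 1), by positivity, fun n E _ hE => (hfE n E).trans ?_⟩
    rw [lt_div_iff₀ (by positivity)] at hE
    have h1 : B * μ.real E ≤ |B| * μ.real E := by gcongr; exact le_abs_self B
    nlinarith [measureReal_nonneg (μ := μ) (s := E)])
  have hgB : ∀ᵐ x ∂μ, |g x| ≤ B := by
    have h1 : g ≤ᵐ[μ] fun _ => B := by
      refine ae_le_of_forall_setIntegral_le hg (integrable_const _) fun E hE _ => ?_
      refine le_of_tendsto (hfg E hE) (Eventually.of_forall fun n => ?_)
      exact setIntegral_mono_ae (hfi _).integrableOn (integrable_const _).integrableOn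
        ((hfB _).mono fun x hx => (abs_le.1 hx).2)
    have h2 : (fun _ => -B) ≤ᵐ[μ] g := by
      refine ae_le_of_forall_setIntegral_le (integrable_const _) hg fun E hE _ => ?_
      refine ge_of_tendsto (hfg E hE) (Eventually.of_forall fun n => ?_)
      exact setIntegral_mono_ae (integrable_const _).integrableOn (hfi _).integrableOn
        ((hfB _).mono fun x hx => (abs_le.1 hx).1)
    filter_upwards [h1, h2] with x hx1 hx2 using abs_le.2 ⟨hx2, hx1⟩
  refine ⟨φ, hφ, g, hg.1, hgB, fun ζ hζ => ?_⟩
  obtain ⟨ζ', hζ'm, hζζ'⟩ := hζ.1.aemeasurable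
  have hcongr : ∀ u : X → ℝ, ∫ x, u x * ζ x ∂μ = ∫ x, u x * ζ' x ∂μ := fun u =>
    integral_congr_ae (by filter_upwards [hζζ'] with x hx; rw [hx])
  simp only [hcongr]
  have hζ' : Integrable ζ' μ := hζ.congr hζζ'
  refine tendsto_integral_mul_of_tail (fun n => hfi (φ n)) hg (fun n => hfL (φ n)) hfg hζ'm
    (fun n => hζ'.bdd_mul (hfm _) (hfB _)) (hζ'.bdd_mul hg.1 hgB) fun e he => ?_
  have hfin : ∫⁻ x, ENNReal.ofReal |B * ζ' x| ∂μ ≠ ⊤ := by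
    have := (hζ'.const_mul B).2
    rw [hasFiniteIntegral_iff_norm] at this
    exact this.ne
  obtain ⟨k, hk⟩ := exists_setLIntegral_tail_le hζ'm hfin (ENNReal.ofReal_pos.2 he)
  have key : ∀ u : X → ℝ, AEStronglyMeasurable u μ → (∀ᵐ x ∂μ, |u x| ≤ B) →
      ∫ x in {x | k < |ζ' x|}, |u x * ζ' x| ∂μ ≤ e := by
    intro u hu huB
    have hm : AEStronglyMeasurable (fun x => |u x * ζ' x|) (μ.restrict {x | k < |ζ' x|}) :=
      (hu.mul hζ'm.aestronglyMeasurable).norm.restrict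
    rw [integral_eq_lintegral_of_nonneg_ae (Eventually.of_forall fun x => abs_nonneg _) hm]
    refine ENNReal.toReal_le_of_le_ofReal he.le (le_trans (lintegral_mono_ae ?_) hk)
    filter_upwards [ae_restrict_of_ae huB] with x hx
    refine ENNReal.ofReal_le_ofReal ?_
    rw [abs_mul, abs_mul]
    exact mul_le_mul_of_nonneg_right (hx.trans (le_abs_self B)) (abs_nonneg _)
  exact ⟨k, fun n => key _ (hfm _) (hfB _), key g hg.1 hgB⟩

end Subsequences

/-- Sequential narrow compactness of nonnegative densities with bounded integral, on a compact
metric space. -/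
theorem exists_subseq_tendsto_narrow {X : Type*} [MetricSpace X] [CompactSpace X]
    [MeasurableSpace X] [BorelSpace X] {μ : Measure X} {K : ℝ≥0} {f : ℕ → X → ℝ}
    (hf : ∀ n, Integrable (f n) μ) (hf0 : ∀ n, ∀ᵐ x ∂μ, 0 ≤ f n x)
    (hfK : ∀ n, ∫ x, f n x ∂μ ≤ K) :
    ∃ φ : ℕ → ℕ, StrictMono φ ∧ ∃ ν : Measure X, IsFiniteMeasure ν ∧ ∀ h : C(X, ℝ),
      Tendsto (fun n => ∫ x, h x * f (φ n) x ∂μ) atTop (𝓝 (∫ x, h x ∂ν)) := by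
  have hfin : ∀ n, IsFiniteMeasure (μ.withDensity fun x => ENNReal.ofReal (f n x)) := fun n =>
    isFiniteMeasure_withDensity_ofReal (hf n).2
  let m : ℕ → FiniteMeasure X := fun n => ⟨μ.withDensity fun x => ENNReal.ofReal (f n x), hfin n⟩
  have hint : ∀ n (h : C(X, ℝ)), ∫ x, h x ∂(m n : Measure X) = ∫ x, h x * f n x ∂μ := by
    intro n h
    change ∫ x, h x ∂(μ.withDensity fun x => ENNReal.ofReal (f n x)) = _
    rw [integral_withDensity_eq_integral_toReal_smul₀ (by
      exact (hf n).1.aemeasurable.ennreal_ofReal) (by simp)]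
    refine integral_congr_ae ?_
    filter_upwards [hf0 n] with x hx
    rw [ENNReal.toReal_ofReal hx, smul_eq_mul, mul_comm]
  have hmass : ∀ n, (m n).mass ≤ K := by
    intro n
    have h1 : (((m n).mass : ℝ≥0) : ℝ) = ∫ x, f n x ∂μ := by
      have := hint n 1
      simp only [ContinuousMap.one_apply, one_mul, integral_const, smul_eq_mul, mul_one] at this
      rw [← this]
      rfl
    rw [← NNReal.coe_le_coe, h1]
    exact hfK n
  let Λ : ℕ → StrongDual ℝ C(X, ℝ) := fun n => LinearMap.mkContinuous
    { toFun := fun h => ∫ x, h x ∂(m n : Measure X)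
      map_add' := fun h h' => integral_add (h.continuous.integrable_of_hasCompactSupport
        (HasCompactSupport.of_compactSpace _)) (h'.continuous.integrable_of_hasCompactSupport
        (HasCompactSupport.of_compactSpace _))
      map_smul' := fun c h => integral_const_mul c _ } K fun h => by
        refine (norm_integral_le_of_norm_le_const (C := ‖h‖)
          (Eventually.of_forall fun x => h.norm_coe_le_norm x)).trans ?_
        rw [mul_comm]
        have : ((m n : Measure X).real Set.univ) ≤ K := NNReal.coe_le_coe.2 (hmass n)
        gcongr
  obtain ⟨Λ₀, -, φ, hφ, hΛ⟩ := WeakDual.isSeqCompact_closedBall ℝ C(X, ℝ) 0 (K : ℝ)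
    (x := fun n => StrongDual.toWeakDual (Λ n)) (fun n => by
      rw [Set.mem_preimage, mem_closedBall_zero_iff]
      change ‖Λ n‖ ≤ K
      exact LinearMap.mkContinuous_norm_le _ K.2 _)
  -- the limit functional is represented by any cluster point of the finite measures
  obtain ⟨ν, -, hν⟩ := (isCompact_setOfPred_finiteMeasure_le_of_compactSpace X K).exists_mapClusterPt
    (f := atTop) (u := m ∘ φ) (by
      rw [le_principal_iff]
      exact Eventually.of_forall (f := atTop) fun n => hmass (φ n))
  refine ⟨φ, hφ, (ν : Measure X), inferInstance, fun h => ?_⟩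
  have h1 : Tendsto (fun n => ∫ x, h x ∂(m (φ n) : Measure X)) atTop (𝓝 (Λ₀ h)) :=
    ((WeakDual.eval_continuous h).tendsto Λ₀).comp hΛ
  have hcont : Continuous fun ν : FiniteMeasure X => ∫ x, h x ∂(ν : Measure X) :=
    FiniteMeasure.continuous_integral_boundedContinuousFunction
      (f := BoundedContinuousFunction.mkOfCompact h)
  have h2 : MapClusterPt (∫ x, h x ∂(ν : Measure X)) atTop
      (fun n => ∫ x, h x ∂(m (φ n) : Measure X)) := hν.continuousAt_comp hcont.continuousAt
  have h3 : ∫ x, h x ∂(ν : Measure X) = Λ₀ h := by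
    obtain ⟨ψ, hψ, hlim⟩ := h2.tendsto_subseq
    exact tendsto_nhds_unique hlim (h1.comp hψ.tendsto_atTop)
  rw [h3]
  simpa only [hint] using h1

/-- The Arzelà–Ascoli theorem for sequences which are equicontinuous only asymptotically: the modulus
of continuity at scale `e` is required only for all large `n`. -/
theorem exists_subseq_tendsto_uniform {X E : Type*} [MetricSpace X] [CompactSpace X]
    [NormedAddCommGroup E] [ProperSpace E] {f : ℕ → C(X, E)} {B : ℝ} (hB : ∀ n x, ‖f n x‖ ≤ B)
    (hf : ∀ e : ℝ, 0 < e → ∃ δ : ℝ, 0 < δ ∧ ∃ N, ∀ n, N ≤ n → ∀ x y, dist x y < δ →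
      dist (f n x) (f n y) ≤ e) :
    ∃ φ : ℕ → ℕ, StrictMono φ ∧ ∃ g : C(X, E), Tendsto (fun n => f (φ n)) atTop (𝓝 g) := by
  have hunif : ∀ e : ℝ, 0 < e → ∃ δ : ℝ, 0 < δ ∧ ∀ n, ∀ x y, dist x y < δ →
      dist (f n x) (f n y) ≤ e := by
    intro e he
    obtain ⟨δ, hδ, N, hN⟩ := hf e he
    have hn : ∀ n, ∃ d : ℝ, 0 < d ∧ ∀ x y, dist x y < d → dist (f n x) (f n y) ≤ e := fun n => by
      obtain ⟨d, hd, h⟩ := Metric.uniformContinuous_iff.1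
        (CompactSpace.uniformContinuous_of_continuous (f n).continuous) e he
      exact ⟨d, hd, fun x y hxy => (h hxy).le⟩
    choose d hd hdf using hn
    obtain ⟨d₀, hd₀, hd₀le⟩ : ∃ d₀ : ℝ, 0 < d₀ ∧ ∀ n < N, d₀ ≤ d n := by
      clear hN
      induction N with
      | zero => exact ⟨1, one_pos, by simp⟩
      | succ k ih =>
        obtain ⟨d₁, hd₁, h⟩ := ih
        refine ⟨min d₁ (d k), lt_min hd₁ (hd k), fun n hn => ?_⟩
        rcases Nat.lt_succ_iff_lt_or_eq.1 hn with h' | rfl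
        · exact (min_le_left _ _).trans (h n h')
        · exact min_le_right _ _
    refine ⟨min δ d₀, lt_min hδ hd₀, fun n x y hxy => ?_⟩
    rcases lt_or_ge n N with h | h
    · exact hdf n x y (hxy.trans_le ((min_le_right _ _).trans (hd₀le n h)))
    · exact hN n h x y (hxy.trans_le (min_le_left _ _))
  let F : ℕ → BoundedContinuousFunction X E := fun n => BoundedContinuousFunction.mkOfCompact (f n)
  have hcomp := BoundedContinuousFunction.arzela_ascoli (Metric.closedBall (0 : E) B)
    (isCompact_closedBall 0 B) (Set.range F)
    (by rintro _ x ⟨n, rfl⟩; rw [mem_closedBall_zero_iff]; exact hB n x)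
    (by
      intro x₀
      rw [Metric.equicontinuousAt_iff]
      intro e he
      obtain ⟨δ, hδ, h⟩ := hunif (e / 2) (by positivity)
      refine ⟨δ, hδ, fun x hx => ?_⟩
      rintro ⟨_, n, rfl⟩
      rw [dist_comm] at hx
      exact (h n x₀ x hx).trans_lt (by linarith))
  obtain ⟨G, -, φ, hφ, hG⟩ := hcomp.tendsto_subseq (x := F) fun n => subset_closure ⟨n, rfl⟩
  refine ⟨φ, hφ, G.toContinuousMap, ?_⟩
  have : Continuous fun G : BoundedContinuousFunction X E => G.toContinuousMap :=
    (ContinuousMap.isometryEquivBoundedOfCompact X E).symm.continuous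
  exact (this.tendsto G).comp hG

/-! ### Nodes, fast cycles and divergence-free flows -/

namespace SlowFastNetwork

variable {V R : Type*} (N : SlowFastNetwork V R) {π : ℝ → V → ℝ}

lemma tendsto_zero_of_mem_nodesV1 {x : V} (hx : x ∈ nodesV1 π) :
    Tendsto (fun ε => π ε x) (𝓝[>] 0) (𝓝 0) := by
  obtain ⟨p, -, hp⟩ := hx
  have h0 : Tendsto (fun ε : ℝ => ε) (𝓝[>] 0) (𝓝 0) := tendsto_nhdsWithin_of_tendsto_nhds tendsto_id
  have h := hp.mul h0
  rw [mul_zero] at h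
  refine h.congr' ?_
  filter_upwards [self_mem_nhdsWithin] with ε hε
  exact div_mul_cancel₀ _ (ne_of_gt hε)

lemma notMem_nodesV1_of_mem_nodesV0 {x : V} (hx : x ∈ nodesV0 π) : x ∉ nodesV1 π := by
  obtain ⟨p, hp, h⟩ := hx
  exact fun h1 => hp.ne' (tendsto_nhds_unique h (tendsto_zero_of_mem_nodesV1 h1))

lemma limit_pos_of_mem_nodesV0 {x : V} {q : ℝ} (hx : x ∈ nodesV0 π)
    (hq : Tendsto (fun ε => π ε x) (𝓝[>] 0) (𝓝 q)) : 0 < q := by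
  obtain ⟨p, hp, h⟩ := hx
  rwa [tendsto_nhds_unique hq h]

open Classical in
/-- Summation by parts against the indicator of a set of nodes. -/
lemma sum_div [Fintype R] (A : R → ℝ) (S : Finset V) : ∑ x ∈ S, N.div A x =
    ∑ r, ((if N.src r ∈ S then 1 else 0) - (if N.tgt r ∈ S then 1 else 0)) * A r := by
  have h : ∀ f : R → V, ∑ x ∈ S, ∑ r with f r = x, A r = ∑ r, (if f r ∈ S then 1 else 0) * A r := by
    intro f
    simp_rw [Finset.sum_filter]
    rw [Finset.sum_comm]
    simp
  simp_rw [div, Finset.sum_sub_distrib, h, sub_mul, Finset.sum_sub_distrib]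

/-- Every edge that carries a positive amount of a nonnegative divergence-free flow lies on a cycle
of such edges: nothing flows out of the set of nodes that are reachable from its target, hence
nothing flows into that set. -/
lemma reflTransGen_of_div_eq_zero [Fintype V] [Fintype R] {k : R → ℝ} (hk : ∀ r, 0 ≤ k r)
    (hdiv : ∀ x, N.div k x = 0) {r : R} (hr : 0 < k r) :
    Relation.ReflTransGen (fun a b => ∃ r, 0 < k r ∧ N.src r = a ∧ N.tgt r = b)
      (N.tgt r) (N.src r) := by
  classical
  set rel := fun a b => ∃ r, 0 < k r ∧ N.src r = a ∧ N.tgt r = b with hrel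
  set S : Finset V := Finset.univ.filter fun y => Relation.ReflTransGen rel (N.tgt r) y with hS
  have hmem : ∀ y, y ∈ S ↔ Relation.ReflTransGen rel (N.tgt r) y := fun y => by simp [hS]
  have h0 := N.sum_div k S
  rw [Finset.sum_eq_zero fun x _ => hdiv x] at h0
  have hle : ∀ r' ∈ Finset.univ, ((if N.src r' ∈ S then (1 : ℝ) else 0) -
      (if N.tgt r' ∈ S then 1 else 0)) * k r' ≤ 0 := by
    intro r' _
    rcases (hk r').eq_or_lt with h | h
    · simp [← h]
    · by_cases hs : N.src r' ∈ S
      · have ht : N.tgt r' ∈ S := by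
          rw [hmem] at hs ⊢
          exact hs.tail ⟨r', h, rfl, rfl⟩
        simp [hs, ht]
      · rw [if_neg hs]
        split_ifs <;> linarith
  have hz := (Finset.sum_eq_zero_iff_of_nonpos hle).1 h0.symm r (Finset.mem_univ r)
  have ht : N.tgt r ∈ S := (hmem _).2 Relation.ReflTransGen.refl
  by_contra hs
  rw [← hmem] at hs
  rw [if_neg hs, if_pos ht] at hz
  linarith

open Classical in
/-- At leading order `1 / ε` the equilibrium fluxes form a divergence-free flow, carried by the
fast-cycle edges. -/
lemma div_leading_flow_eq_zero [Fintype V] [Fintype R]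
    (hπ : ∀ ε : ℝ, 0 < ε → N.IsEquilibrium ε (π ε))
    (hnodes : ∀ x : V, x ∈ nodesV0 π ∨ x ∈ nodesV1 π) {π₀ : V → ℝ}
    (hπ₀ : ∀ x ∈ nodesV0 π, Tendsto (fun ε => π ε x) (𝓝[>] 0) (𝓝 (π₀ x))) (x : V) :
    N.div (fun r => if r ∈ N.Rfcyc π then N.κ r * π₀ (N.src r) else 0) x = 0 := by
  have h0 : Tendsto (fun ε : ℝ => ε) (𝓝[>] 0) (𝓝 0) := tendsto_nhdsWithin_of_tendsto_nhds tendsto_id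
  have hr : ∀ r, Tendsto (fun ε => ε * (N.rate ε r * π ε (N.src r))) (𝓝[>] 0)
      (𝓝 (if r ∈ N.Rfcyc π then N.κ r * π₀ (N.src r) else 0)) := by
    intro r
    by_cases hf : r ∈ N.fast
    · have heq : (fun ε => N.κ r * π ε (N.src r)) =ᶠ[𝓝[>] 0]
          fun ε => ε * (N.rate ε r * π ε (N.src r)) := by
        filter_upwards [self_mem_nhdsWithin] with ε hε
        have : ε ≠ 0 := ne_of_gt hε
        rw [rate, if_pos hf]
        field_simp
      refine Tendsto.congr' heq ?_
      rcases hnodes (N.src r) with h | h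
      · rw [if_pos ⟨hf, h⟩]
        exact (hπ₀ _ h).const_mul _
      · rw [if_neg fun h' => notMem_nodesV1_of_mem_nodesV0 h'.2 h]
        simpa using (tendsto_zero_of_mem_nodesV1 h).const_mul (N.κ r)
    · rw [if_neg fun h' => hf h'.1]
      simp only [rate, if_neg hf]
      obtain ⟨q, hq⟩ : ∃ q, Tendsto (fun ε => π ε (N.src r)) (𝓝[>] 0) (𝓝 q) := by
        rcases hnodes (N.src r) with h | h
        · exact ⟨_, hπ₀ _ h⟩
        · exact ⟨_, tendsto_zero_of_mem_nodesV1 h⟩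
      simpa using h0.mul (hq.const_mul (N.κ r))
  have hlim : Tendsto (fun ε => N.div (fun r => ε * (N.rate ε r * π ε (N.src r))) x) (𝓝[>] 0)
      (𝓝 (N.div (fun r => if r ∈ N.Rfcyc π then N.κ r * π₀ (N.src r) else 0) x)) :=
    (tendsto_finsetSum _ fun r _ => hr r).sub (tendsto_finsetSum _ fun r _ => hr r)
  refine tendsto_nhds_unique hlim (tendsto_const_nhds.congr' ?_)
  filter_upwards [self_mem_nhdsWithin] with ε hε
  have h1 := (hπ ε hε).stationary x
  simp only [div, ← Finset.mul_sum, ← mul_sub] at h1 ⊢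
  rw [h1, mul_zero]

/-- A fast-cycle edge of positive weight lies on a cycle of fast-cycle edges. -/
lemma fcycPath_of_pos [Fintype V] [Fintype R]
    (hπ : ∀ ε : ℝ, 0 < ε → N.IsEquilibrium ε (π ε))
    (hnodes : ∀ x : V, x ∈ nodesV0 π ∨ x ∈ nodesV1 π) {r : R} (hr : r ∈ N.Rfcyc π)
    (hκ : 0 < N.κ r) :
    N.FcycPath π (N.src r) (N.tgt r) ∧ N.FcycPath π (N.tgt r) (N.src r) := by
  classical
  obtain ⟨π₀, hπ₀⟩ : ∃ π₀ : V → ℝ, ∀ x ∈ nodesV0 π,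
      Tendsto (fun ε => π ε x) (𝓝[>] 0) (𝓝 (π₀ x)) := by
    have : ∀ x, ∃ q, x ∈ nodesV0 π → Tendsto (fun ε => π ε x) (𝓝[>] 0) (𝓝 q) := by
      intro x
      by_cases hx : x ∈ nodesV0 π
      · obtain ⟨p, -, hp⟩ := hx
        exact ⟨p, fun _ => hp⟩
      · exact ⟨0, fun h => absurd h hx⟩
    choose π₀ hπ₀ using this
    exact ⟨π₀, hπ₀⟩
  have h1 : N.FcycPath π (N.src r) (N.tgt r) := Relation.TransGen.single ⟨r, hr, rfl, rfl⟩
  refine ⟨h1, ?_⟩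
  have hpos : ∀ x ∈ nodesV0 π, 0 < π₀ x := fun x hx => limit_pos_of_mem_nodesV0 hx (hπ₀ x hx)
  have hback := N.reflTransGen_of_div_eq_zero
    (k := fun r => if r ∈ N.Rfcyc π then N.κ r * π₀ (N.src r) else 0) (fun r => by
      split_ifs with h
      · exact mul_nonneg (N.κ_nonneg r) (hpos _ h.2).le
      · exact le_rfl) (N.div_leading_flow_eq_zero hπ hnodes hπ₀) (r := r) (by
      rw [if_pos hr]
      exact mul_pos hκ (hpos _ hr.2))
  have hback' : Relation.ReflTransGen
      (fun a b => ∃ r ∈ N.Rfcyc π, N.src r = a ∧ N.tgt r = b) (N.tgt r) (N.src r) := by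
    refine hback.lift id ?_
    rintro a b ⟨r', hr', ha, hb⟩
    by_cases h : r' ∈ N.Rfcyc π
    · exact ⟨r', h, ha, hb⟩
    · rw [if_neg h] at hr'
      exact absurd hr' (lt_irrefl _)
  rcases Relation.reflTransGen_iff_eq_or_transGen.1 hback' with h | h
  · -- a loop
    rw [h] at h1
    rw [h]
    exact h1
  · exact h

lemma mem_V0fcyc_of_fcycPath {x y : V} (h : N.FcycPath π x y) : x ∈ N.V0fcyc π := by
  obtain ⟨z, ⟨r, hr, hs, -⟩, -⟩ := Relation.TransGen.head'_iff.1 h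
  exact ⟨hs ▸ hr.2, r, hr, hs⟩

lemma subset_V0fcyc_of_mem_components {c : Set V} (hc : c ∈ N.components π) :
    c ⊆ N.V0fcyc π := fun x hx => N.mem_V0fcyc_of_fcycPath (hc.1.2.2 x hx x hx)

lemma mem_component_of_fcycPath {c : Set V} (hc : c ∈ N.components π) {x y : V} (hx : x ∈ c)
    (hxy : N.FcycPath π x y) (hyx : N.FcycPath π y x) : y ∈ c := by
  have hd : insert y c ⊆ c := by
    refine hc.2 ⟨Set.insert_nonempty _ _, ?_, ?_⟩ (Set.subset_insert _ _)
    · exact Set.insert_subset (N.mem_V0fcyc_of_fcycPath hyx).1 hc.1.2.1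
    · have hcc := hc.1.2.2
      rintro a (rfl | ha) b (rfl | hb)
      · exact hyx.trans hxy
      · exact hyx.trans (hcc x hx b hb)
      · exact (hcc a ha x hx).trans hxy
      · exact hcc a ha b hb
  exact hd (Set.mem_insert _ _)

/-- A set of nodes in `V₀` with no fast-cycle edge of positive weight entering or leaving it. The
mass of such a set does not see the fluxes of order `1 / ε`. -/
def FastClosed (π : ℝ → V → ℝ) (S : Finset V) : Prop :=
  (∀ x ∈ S, x ∈ nodesV0 π) ∧ ∀ r ∈ N.Rfcyc π, 0 < N.κ r → (N.src r ∈ S ↔ N.tgt r ∈ S)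

open Classical in
lemma fastClosed_component [Fintype V] [Fintype R]
    (hπ : ∀ ε : ℝ, 0 < ε → N.IsEquilibrium ε (π ε))
    (hnodes : ∀ x : V, x ∈ nodesV0 π ∨ x ∈ nodesV1 π)
    {c : Set V} (hc : c ∈ N.components π) :
    N.FastClosed π (Finset.univ.filter (· ∈ c)) := by
  refine ⟨fun x hx => hc.1.2.1 (by simpa using hx), fun r hr hκ => ?_⟩
  obtain ⟨h1, h2⟩ := N.fcycPath_of_pos hπ hnodes hr hκ
  simp only [Finset.mem_filter, Finset.mem_univ, true_and]
  exact ⟨fun h => N.mem_component_of_fcycPath hc h h1 h2,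
    fun h => N.mem_component_of_fcycPath hc h h2 h1⟩

lemma fastClosed_singleton [Fintype V] [Fintype R]
    (hπ : ∀ ε : ℝ, 0 < ε → N.IsEquilibrium ε (π ε))
    (hnodes : ∀ x : V, x ∈ nodesV0 π ∨ x ∈ nodesV1 π)
    {x : V} (hx : x ∈ N.V0slow π) : N.FastClosed π {x} := by
  refine ⟨fun y hy => by rw [Finset.mem_singleton.1 hy]; exact hx.1, fun r hr hκ => ?_⟩
  obtain ⟨h1, h2⟩ := N.fcycPath_of_pos hπ hnodes hr hκ
  simp only [Finset.mem_singleton]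
  exact ⟨fun h => absurd (h ▸ N.mem_V0fcyc_of_fcycPath h1) hx.2,
    fun h => absurd (h ▸ N.mem_V0fcyc_of_fcycPath h2) hx.2⟩

lemma tgt_notMem_nodesV1 [Fintype V] [Fintype R]
    (hπ : ∀ ε : ℝ, 0 < ε → N.IsEquilibrium ε (π ε))
    (hnodes : ∀ x : V, x ∈ nodesV0 π ∨ x ∈ nodesV1 π)
    {r : R} (hr : r ∈ N.Rfcyc π) (hκ : 0 < N.κ r) :
    N.tgt r ∉ nodesV1 π :=
  notMem_nodesV1_of_mem_nodesV0
    (N.mem_V0fcyc_of_fcycPath (N.fcycPath_of_pos hπ hnodes hr hκ).2).1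

lemma exists_mem_nodesV0 [Fintype V] [Fintype R]
    (hπ : ∀ ε : ℝ, 0 < ε → N.IsEquilibrium ε (π ε))
    (hnodes : ∀ x : V, x ∈ nodesV0 π ∨ x ∈ nodesV1 π) :
    ∃ x, x ∈ nodesV0 π := by
  by_contra! h
  have h1 : ∀ x, x ∈ nodesV1 π := fun x => (hnodes x).resolve_left (h x)
  have hlim : Tendsto (fun ε => ∑ x, π ε x) (𝓝[>] 0) (𝓝 (∑ _x : V, 0)) :=
    tendsto_finsetSum _ fun x _ => tendsto_zero_of_mem_nodesV1 (h1 x)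
  have hone : Tendsto (fun ε => ∑ x, π ε x) (𝓝[>] 0) (𝓝 1) :=
    tendsto_const_nhds.congr' (by
      filter_upwards [self_mem_nhdsWithin] with ε hε
      exact (hπ ε hε).sum_eq_one.symm)
  have := tendsto_nhds_unique hlim hone
  simp at this

end SlowFastNetwork

/-! ### Estimates for paths of bounded cost -/

namespace SlowFastNetwork

variable {V R : Type*} (N : SlowFastNetwork V R) {π : ℝ → V → ℝ}

/-- Concentrations `ρ` and fluxes `J` on `[0,T]` that solve the continuity equation, each of whose
initial costs and flux costs is at most `C`. -/
structure BoundedCost [Fintype R] (T ε : ℝ) (C : ℝ≥0) (p : V → ℝ) (ρ : V → ℝ → ℝ)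
    (J : R → ℝ → ℝ) : Prop where
  absCont : ∀ x, AbsolutelyContinuousOnInterval (ρ x) 0 T
  integrableOn : ∀ r, IntegrableOn (J r) (Set.Icc 0 T)
  hasDerivAt : ∀ x, ∀ᵐ t ∂(volume.restrict (Set.Icc 0 T)),
    HasDerivAt (ρ x) (-(N.div (fun r => J r t) x)) t
  initial : ∀ x, relEnt (ρ x 0) (p x) ≤ C
  flux : ∀ r, ∫⁻ t in Set.Icc 0 T, relEnt (J r t) (N.rate ε r * ρ (N.src r) t) ≤ C

lemma rate_nonneg {ε : ℝ} (hε : 0 < ε) (r : R) : 0 ≤ N.rate ε r := by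
  unfold rate
  have := N.κ_nonneg r
  split_ifs <;> positivity

lemma fenchel_of_relEnt_le {a b : ℝ} {C : ℝ≥0} (h : relEnt a b ≤ C) (q : ℝ) :
    a * q - b * (Real.exp q - 1) ≤ C := by
  have := (ofReal_fenchel_le_relEnt a b q).trans h
  rw [← ENNReal.ofReal_coe_nnreal] at this
  exact (ENNReal.ofReal_le_ofReal_iff C.2).1 this

namespace BoundedCost

variable {N} [Fintype R] {T ε : ℝ} {C : ℝ≥0} {p : V → ℝ} {ρ : V → ℝ → ℝ} {J : R → ℝ → ℝ}

section

variable (h : N.BoundedCost T ε C p ρ J) (hT : 0 < T)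

include h hT

lemma continuousOn (x : V) : ContinuousOn (ρ x) (Set.Icc 0 T) := by
  have := (h.absCont x).continuousOn
  rwa [Set.uIcc_of_le hT.le] at this

lemma integrableOn_concentration (x : V) : IntegrableOn (ρ x) (Set.Icc 0 T) :=
  (h.continuousOn hT x).integrableOn_Icc

lemma intervalIntegrable_concentration (x : V) {s t : ℝ} (hs : 0 ≤ s) (hst : s ≤ t) (ht : t ≤ T) :
    IntervalIntegrable (ρ x) volume s t :=
  ((h.continuousOn hT x).mono (by
    rw [Set.uIcc_of_le hst]; exact Set.Icc_subset_Icc hs ht)).intervalIntegrable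

omit hT in
lemma intervalIntegrable_flux (r : R) {s t : ℝ} (hs : 0 ≤ s) (hst : s ≤ t) (ht : t ≤ T) :
    IntervalIntegrable (J r) volume s t :=
  ((h.integrableOn r).mono_set (by
    rw [Set.uIcc_of_le hst]; exact Set.Icc_subset_Icc hs ht)).intervalIntegrable

lemma ae_relEnt_ne_top (r : R) : ∀ᵐ t ∂(volume.restrict (Set.Icc 0 T)),
    relEnt (J r t) (N.rate ε r * ρ (N.src r) t) ≠ ⊤ := by
  have hm : AEMeasurable (fun t => relEnt (J r t) (N.rate ε r * ρ (N.src r) t))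
      (volume.restrict (Set.Icc 0 T)) :=
    measurable_relEnt.comp_aemeasurable ((h.integrableOn r).aemeasurable.prodMk
      ((h.integrableOn_concentration hT (N.src r)).aemeasurable.const_mul _))
  filter_upwards [ae_lt_top' hm ((h.flux r).trans_lt ENNReal.coe_lt_top).ne] with t ht using ht.ne

lemma ae_flux_nonneg (r : R) : ∀ᵐ t ∂(volume.restrict (Set.Icc 0 T)), 0 ≤ J r t := by
  filter_upwards [h.ae_relEnt_ne_top hT r] with t ht using (nonneg_of_relEnt_ne_top ht).1

lemma ae_flux_eq_zero {r : R} (hr : N.κ r = 0) :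
    ∀ᵐ t ∂(volume.restrict (Set.Icc 0 T)), J r t = 0 := by
  filter_upwards [h.ae_relEnt_ne_top hT r] with t ht
  have : N.rate ε r = 0 := by simp [rate, hr]
  rw [this, zero_mul] at ht
  exact eq_zero_of_relEnt_zero_right_ne_top ht

lemma flux_integral_nonneg (r : R) {s t : ℝ} (hs : 0 ≤ s) (hst : s ≤ t) (ht : t ≤ T) :
    0 ≤ ∫ τ in s..t, J r τ := by
  refine intervalIntegral.integral_nonneg_of_ae_restrict hst ?_
  exact ae_restrict_of_ae_restrict_of_subset (Set.Icc_subset_Icc hs ht) (h.ae_flux_nonneg hT r)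

lemma flux_integral_eq_zero {r : R} (hr : N.κ r = 0) {s t : ℝ} (hs : 0 ≤ s) (hst : s ≤ t)
    (ht : t ≤ T) : ∫ τ in s..t, J r τ = 0 := by
  rw [intervalIntegral.integral_of_le hst]
  refine integral_eq_zero_of_ae ?_
  exact ae_restrict_of_ae_restrict_of_subset
    (Set.Ioc_subset_Icc_self.trans (Set.Icc_subset_Icc hs ht)) (h.ae_flux_eq_zero hT hr)

open Classical in
/-- Conservation of mass: the change of the mass of a set of nodes is the flux into it minus the
flux out of it. -/
lemma mass_balance (S : Finset V) {s t : ℝ} (hs : 0 ≤ s) (hst : s ≤ t) (ht : t ≤ T) :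
    ∑ x ∈ S, ρ x t - ∑ x ∈ S, ρ x s =
      ∑ r, ((if N.tgt r ∈ S then 1 else 0) - (if N.src r ∈ S then 1 else 0)) *
        ∫ τ in s..t, J r τ := by
  have hac : ∀ x, AbsolutelyContinuousOnInterval (ρ x) s t := fun x =>
    (h.absCont x).mono (by
      rw [Set.uIcc_of_le hst, Set.uIcc_of_le hT.le]; exact Set.Icc_subset_Icc hs ht)
  have hJ : ∀ r, IntervalIntegrable (J r) volume s t := fun r =>
    h.intervalIntegrable_flux r hs hst ht
  calc ∑ x ∈ S, ρ x t - ∑ x ∈ S, ρ x s = ∑ x ∈ S, ∫ τ in s..t, deriv (ρ x) τ := by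
        rw [← Finset.sum_sub_distrib]
        exact Finset.sum_congr rfl fun x _ => (hac x).integral_deriv_eq_sub.symm
    _ = ∫ τ in s..t, ∑ x ∈ S, deriv (ρ x) τ :=
        (intervalIntegral.integral_finsetSum fun x _ => (hac x).intervalIntegrable_deriv).symm
    _ = ∫ τ in s..t, ∑ r, ((if N.tgt r ∈ S then 1 else 0) - (if N.src r ∈ S then 1 else 0)) *
          J r τ := by
        rw [intervalIntegral.integral_of_le hst, intervalIntegral.integral_of_le hst]
        refine integral_congr_ae ?_
        refine ae_restrict_of_ae_restrict_of_subset
          (Set.Ioc_subset_Icc_self.trans (Set.Icc_subset_Icc hs ht)) ?_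
        filter_upwards [ae_all_iff.2 fun x : S => h.hasDerivAt x] with τ hτ
        calc ∑ x ∈ S, deriv (ρ x) τ = ∑ x ∈ S, -(N.div (fun r => J r τ) x) :=
              Finset.sum_congr rfl fun x hx => (hτ ⟨x, hx⟩).deriv
          _ = _ := by
              rw [Finset.sum_neg_distrib, N.sum_div, ← Finset.sum_neg_distrib]
              exact Finset.sum_congr rfl fun r _ => by ring
    _ = ∑ r, ∫ τ in s..t, ((if N.tgt r ∈ S then 1 else 0) - (if N.src r ∈ S then 1 else 0)) *
          J r τ := intervalIntegral.integral_finsetSum fun r _ => (hJ r).const_mul _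
    _ = _ := Finset.sum_congr rfl fun r _ => intervalIntegral.integral_const_mul _ _

/-- The integrated Fenchel inequality for the flux cost. -/
lemma flux_fenchel (r : R) (q : ℝ) :
    (∫ τ in (0 : ℝ)..T, J r τ) * q -
      N.rate ε r * (∫ τ in (0 : ℝ)..T, ρ (N.src r) τ) * (Real.exp q - 1) ≤ C := by
  have h1 := h.integrableOn r
  have h2 := h.integrableOn_concentration hT (N.src r)
  have h3 : Integrable (fun t => J r t * q - N.rate ε r * ρ (N.src r) t * (Real.exp q - 1))
      (volume.restrict (Set.Icc 0 T)) :=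
    (h1.mul_const q).sub ((h2.const_mul _).mul_const _)
  have h4 := integral_le_of_lintegral_ofReal_le h3
    ((lintegral_mono fun t => ofReal_fenchel_le_relEnt _ _ _).trans (h.flux r))
  rw [integral_sub (h1.mul_const q) ((h2.const_mul _).mul_const _), integral_mul_const,
    integral_mul_const, integral_const_mul] at h4
  rwa [intervalIntegral.integral_of_le hT.le, intervalIntegral.integral_of_le hT.le,
    ← integral_Icc_eq_integral_Ioc, ← integral_Icc_eq_integral_Ioc]

/-- The flux is controlled by the rate. -/
lemma flux_integral_le (r : R) (hρ : 0 ≤ N.rate ε r * ∫ τ in (0 : ℝ)..T, ρ (N.src r) τ) :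
    ∫ τ in (0 : ℝ)..T, J r τ ≤ C + 2 * (N.rate ε r * ∫ τ in (0 : ℝ)..T, ρ (N.src r) τ) := by
  have h1 := h.flux_fenchel hT r 1
  have h2 : Real.exp 1 - 1 ≤ 2 := by linarith [Real.exp_one_lt_d9]
  nlinarith [mul_le_mul_of_nonneg_left h2 hρ]

/-- The rate is controlled by the flux. -/
lemma rate_integral_le (r : R) (hρ : 0 ≤ N.rate ε r * ∫ τ in (0 : ℝ)..T, ρ (N.src r) τ) :
    N.rate ε r * ∫ τ in (0 : ℝ)..T, ρ (N.src r) τ ≤ 2 * (C + ∫ τ in (0 : ℝ)..T, J r τ) := by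
  have h1 := h.flux_fenchel hT r (-1)
  have h2 : Real.exp (-1) ≤ 1 / 2 := by
    rw [Real.exp_neg, ← one_div]
    have := Real.exp_one_gt_d9
    gcongr
    linarith
  nlinarith [mul_le_mul_of_nonneg_left h2 hρ]

omit hT in
lemma initial_nonneg (x : V) : 0 ≤ ρ x 0 :=
  (nonneg_of_relEnt_ne_top ((h.initial x).trans_lt ENNReal.coe_lt_top).ne).1

variable [Fintype V]

lemma sum_concentration_eq {t : ℝ} (ht : t ∈ Set.Icc 0 T) : ∑ x, ρ x t = ∑ x, ρ x 0 := by
  have := h.mass_balance hT Finset.univ le_rfl ht.1 ht.2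
  simp only [Finset.mem_univ, if_true, sub_self, zero_mul, Finset.sum_const_zero] at this
  linarith

/-- Finite cost forces the rates, hence the concentrations, to be nonnegative. -/
lemma concentration_nonneg (hε : 0 < ε) (x : V) {t : ℝ} (ht : t ∈ Set.Icc 0 T) : 0 ≤ ρ x t := by
  by_cases hx : ∃ r, 0 < N.κ r ∧ N.src r = x
  · obtain ⟨r, hr, rfl⟩ := hx
    have hrate : 0 < N.rate ε r := by
      unfold rate
      split_ifs <;> positivity
    have hae : ρ (N.src r) =ᵐ[volume.restrict (Set.Icc 0 T)] fun t => |ρ (N.src r) t| := by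
      filter_upwards [h.ae_relEnt_ne_top hT r] with t ht
      exact (abs_of_nonneg (nonneg_of_mul_nonneg_right
        (nonneg_of_relEnt_ne_top ht).2 hrate)).symm
    have hc := h.continuousOn hT (N.src r)
    rw [Measure.eqOn_Icc_of_ae_eq volume hT.ne hae hc hc.abs ht]
    exact abs_nonneg _
  · -- a node without outgoing edges of positive weight is the only node, and its mass is constant
    have hsub : ∀ y, y = x := by
      intro y
      rcases (N.diconnected x y).cases_head with h' | ⟨z, ⟨r, hr, hs, -⟩, -⟩
      · exact h'.symm
      · exact absurd ⟨r, hr, hs⟩ hx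
    have huniv : (Finset.univ : Finset V) = {x} := by
      ext y
      simp [hsub y]
    have := h.sum_concentration_eq hT ht
    rw [huniv, Finset.sum_singleton, Finset.sum_singleton] at this
    rw [this]
    exact h.initial_nonneg x

lemma sum_concentration_le (hp : N.IsEquilibrium ε p) {t : ℝ} (ht : t ∈ Set.Icc 0 T) :
    ∑ x, ρ x t ≤ Fintype.card V * C + 2 := by
  rw [h.sum_concentration_eq hT ht]
  have h1 : ∀ x ∈ Finset.univ, ρ x 0 ≤ C + 2 * p x := by
    intro x _
    have h1 := fenchel_of_relEnt_le (h.initial x) 1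
    have h2 : Real.exp 1 - 1 ≤ 2 := by linarith [Real.exp_one_lt_d9]
    nlinarith [mul_le_mul_of_nonneg_left h2 (hp.pos x).le]
  refine (Finset.sum_le_sum h1).trans ?_
  rw [Finset.sum_add_distrib, ← Finset.mul_sum, hp.sum_eq_one]
  simp

lemma sum_subset_concentration_le (hε : 0 < ε) (hp : N.IsEquilibrium ε p) (S : Finset V) {t : ℝ}
    (ht : t ∈ Set.Icc 0 T) : ∑ x ∈ S, ρ x t ≤ Fintype.card V * C + 2 :=
  (Finset.sum_le_univ_sum_of_nonneg fun x => h.concentration_nonneg hT hε x ht).trans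
    (h.sum_concentration_le hT hp ht)

lemma concentration_le (hε : 0 < ε) (hp : N.IsEquilibrium ε p) (x : V) {t : ℝ}
    (ht : t ∈ Set.Icc 0 T) : ρ x t ≤ Fintype.card V * C + 2 := by
  simpa using h.sum_subset_concentration_le hT hε hp {x} ht

lemma concentration_integral_nonneg (hε : 0 < ε) (x : V) : 0 ≤ ∫ τ in (0 : ℝ)..T, ρ x τ :=
  intervalIntegral.integral_nonneg hT.le fun _ ht => h.concentration_nonneg hT hε x ht

lemma rate_mul_integral_nonneg (hε : 0 < ε) (r : R) :
    0 ≤ N.rate ε r * ∫ τ in (0 : ℝ)..T, ρ (N.src r) τ :=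
  mul_nonneg (N.rate_nonneg hε r) (h.concentration_integral_nonneg hT hε _)

end

end BoundedCost

end SlowFastNetwork

/-! ### Slow fluxes and the nodes of order `ε` -/

namespace SlowFastNetwork

variable {V R : Type*} (N : SlowFastNetwork V R) {π : ℝ → V → ℝ}

namespace BoundedCost

variable {N} [Fintype V] [Fintype R] {T ε : ℝ} {C : ℝ≥0} {p : V → ℝ} {ρ : V → ℝ → ℝ}
  {J : R → ℝ → ℝ}

/-- An upper bound for all slow rates `κ_r ρ_{r₋}` along a path of cost at most `C`. -/
def slowRateBound (N : SlowFastNetwork V R) (C : ℝ≥0) : ℝ :=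
  (∑ r, N.κ r) * (Fintype.card V * C + 2) + 1

lemma slowRateBound_pos (N : SlowFastNetwork V R) (C : ℝ≥0) : 0 < slowRateBound N C := by
  have : 0 ≤ ∑ r, N.κ r := Finset.sum_nonneg fun r _ => N.κ_nonneg r
  unfold slowRateBound
  positivity

/-- The slow fluxes are bounded in the Orlicz class. -/
lemma lintegral_youngC_slow_le (h : N.BoundedCost T ε C p ρ J) (hT : 0 < T) (hε : 0 < ε)
    (hp : N.IsEquilibrium ε p) {r : R} (hr : r ∈ N.Rslow) :
    ∫⁻ t in Set.Icc 0 T, youngC (J r t / slowRateBound N C) ≤ (C + T.toNNReal : ℝ≥0) := by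
  set W := slowRateBound N C with hW
  have hM : (0 : ℝ) ≤ Fintype.card V * C + 2 := by positivity
  have hκ : N.κ r ≤ ∑ r, N.κ r :=
    Finset.single_le_sum (fun r _ => N.κ_nonneg r) (Finset.mem_univ r)
  have hκ0 : 0 ≤ ∑ r, N.κ r := Finset.sum_nonneg fun r _ => N.κ_nonneg r
  have hW1 : 1 ≤ W := by
    rw [hW, slowRateBound]
    have := mul_nonneg hκ0 hM
    linarith
  have hrate : N.rate ε r = N.κ r := if_neg hr
  have hpt : ∀ t ∈ Set.Icc (0 : ℝ) T, youngC (J r t / W) ≤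
      relEnt (J r t) (N.rate ε r * ρ (N.src r) t) + 1 := by
    intro t ht
    have h0 := h.concentration_nonneg hT hε (N.src r) ht
    have h1 : N.rate ε r * ρ (N.src r) t ≤ W := by
      rw [hrate, hW, slowRateBound]
      have := mul_le_mul hκ (h.concentration_le hT hε hp (N.src r) ht) h0 hκ0
      linarith
    have h2 := mul_youngC_le_relEnt_add (j := J r t) (slowRateBound_pos N C)
      (mul_nonneg (N.rate_nonneg hε r) h0) h1
    -- divide by `W ≥ 1`
    have hW0 : ENNReal.ofReal W ≠ 0 := by simpa using slowRateBound_pos N C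
    have hWinv : (ENNReal.ofReal W)⁻¹ ≤ 1 := by simpa using hW1
    calc youngC (J r t / W)
        = (ENNReal.ofReal W)⁻¹ * (ENNReal.ofReal W * youngC (J r t / W)) := by
          rw [← mul_assoc, ENNReal.inv_mul_cancel hW0 ENNReal.ofReal_ne_top, one_mul]
      _ ≤ (ENNReal.ofReal W)⁻¹ *
          (relEnt (J r t) (N.rate ε r * ρ (N.src r) t) + ENNReal.ofReal W) :=
          mul_le_mul_right h2 _
      _ = (ENNReal.ofReal W)⁻¹ * relEnt (J r t) (N.rate ε r * ρ (N.src r) t) + 1 := by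
          rw [mul_add, ENNReal.inv_mul_cancel hW0 ENNReal.ofReal_ne_top]
      _ ≤ _ := by
          gcongr
          exact mul_le_of_le_one_left' hWinv
  calc ∫⁻ t in Set.Icc 0 T, youngC (J r t / W)
      ≤ ∫⁻ t in Set.Icc 0 T, (relEnt (J r t) (N.rate ε r * ρ (N.src r) t) + 1) :=
        setLIntegral_mono' measurableSet_Icc hpt
    _ = (∫⁻ t in Set.Icc 0 T, relEnt (J r t) (N.rate ε r * ρ (N.src r) t)) +
        ∫⁻ _ in Set.Icc 0 T, 1 := lintegral_add_right _ measurable_const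
    _ ≤ (C + T.toNNReal : ℝ≥0) := by
        rw [ENNReal.coe_add]
        refine add_le_add (h.flux r) ?_
        simp [ENNReal.ofReal]

/-- The slow fluxes are equi-integrable in time. -/
lemma exists_slow_modulus (N : SlowFastNetwork V R) (hT : 0 < T) (C : ℝ≥0) {e : ℝ} (he : 0 < e) :
    ∃ δ : ℝ, 0 < δ ∧ ∀ (ε : ℝ) (p : V → ℝ) (ρ : V → ℝ → ℝ) (J : R → ℝ → ℝ), 0 < ε →
      N.IsEquilibrium ε p → N.BoundedCost T ε C p ρ J → ∀ r ∈ N.Rslow, ∀ s t : ℝ, 0 ≤ s → s ≤ t →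
      t ≤ T → t - s < δ → ∫ τ in s..t, J r τ ≤ e := by
  obtain ⟨δ, hδ, hmod⟩ := exists_equiintegrability_modulus
    (μ := volume.restrict (Set.Icc 0 T)) (slowRateBound_pos N C) (C + T.toNNReal) he
  refine ⟨δ, hδ, fun ε p ρ J hε hp h r hr s t hs hst ht hd => ?_⟩
  have hsub : Set.Ioc s t ⊆ Set.Icc 0 T :=
    Set.Ioc_subset_Icc_self.trans (Set.Icc_subset_Icc hs ht)
  have h1 := hmod (J r) (h.integrableOn r).aestronglyMeasurable
    (h.lintegral_youngC_slow_le hT hε hp hr) (Set.Ioc s t) (by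
      rw [measureReal_restrict_apply measurableSet_Ioc, Set.inter_eq_left.2 hsub,
        Real.volume_real_Ioc_of_le hst]
      exact hd)
  rw [Measure.restrict_restrict measurableSet_Ioc, Set.inter_eq_left.2 hsub] at h1
  rw [intervalIntegral.integral_of_le hst]
  exact (le_abs_self _).trans (abs_integral_le_integral_abs.trans h1)

lemma slow_flux_integral_le (h : N.BoundedCost T ε C p ρ J) (hT : 0 < T) (hε : 0 < ε)
    (hp : N.IsEquilibrium ε p) {r : R} (hr : r ∈ N.Rslow) :
    ∫ τ in (0 : ℝ)..T, J r τ ≤ C + 2 * (slowRateBound N C * T) := by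
  refine (h.flux_integral_le hT r (h.rate_mul_integral_nonneg hT hε r)).trans ?_
  have hrate : N.rate ε r = N.κ r := if_neg hr
  have hκ : N.κ r ≤ ∑ r, N.κ r :=
    Finset.single_le_sum (fun r _ => N.κ_nonneg r) (Finset.mem_univ r)
  have hint : ∫ τ in (0 : ℝ)..T, ρ (N.src r) τ ≤ ∫ _ in (0 : ℝ)..T, (Fintype.card V * C + 2 : ℝ) :=
    intervalIntegral.integral_mono_on hT.le
      (h.intervalIntegrable_concentration hT _ le_rfl hT.le le_rfl) intervalIntegrable_const
      fun t ht => h.concentration_le hT hε hp _ ht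
  rw [intervalIntegral.integral_const, sub_zero, smul_eq_mul] at hint
  have := mul_le_mul hκ hint (h.concentration_integral_nonneg hT hε _)
    ((N.κ_nonneg r).trans hκ)
  rw [hrate, slowRateBound]
  nlinarith

open Classical in
/-- The mass of `V₁` is fed by the slow edges only: positive fast-cycle edges do not enter `V₁`.
So the flux out of `V₁` is controlled by the mass of `V₁` and the slow fluxes. -/
lemma nodesV1_balance (hπ : ∀ ε : ℝ, 0 < ε → N.IsEquilibrium ε (π ε))
    (hnodes : ∀ x : V, x ∈ nodesV0 π ∨ x ∈ nodesV1 π)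
    (hleak : ∀ r ∈ N.Rslow, N.src r ∉ nodesV1 π)
    (h : N.BoundedCost T ε C p ρ J) (hT : 0 < T) {s t : ℝ} (hs : 0 ≤ s) (hst : s ≤ t)
    (ht : t ≤ T) :
    ∑ x with x ∈ nodesV1 π, ρ x t +
        ∑ r with N.src r ∈ nodesV1 π ∧ N.tgt r ∉ nodesV1 π, ∫ τ in s..t, J r τ ≤
      ∑ x with x ∈ nodesV1 π, ρ x s + ∑ r with r ∈ N.Rslow, ∫ τ in s..t, J r τ := by
  have hb := h.mass_balance hT (Finset.univ.filter (· ∈ nodesV1 π)) hs hst ht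
  have hle : ∀ r ∈ Finset.univ, ((if N.tgt r ∈ Finset.univ.filter (· ∈ nodesV1 π) then (1 : ℝ) else 0)
      - (if N.src r ∈ Finset.univ.filter (· ∈ nodesV1 π) then 1 else 0)) * ∫ τ in s..t, J r τ ≤
      (if r ∈ N.Rslow then ∫ τ in s..t, J r τ else 0) -
      (if N.src r ∈ nodesV1 π ∧ N.tgt r ∉ nodesV1 π then ∫ τ in s..t, J r τ else 0) := by
    intro r _
    have hF := h.flux_integral_nonneg hT r hs hst ht
    simp only [Finset.mem_filter, Finset.mem_univ, true_and]
    by_cases hr : r ∈ N.Rslow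
    · have := hleak r hr
      simp only [hr, this, if_true, if_false, false_and]
      split_ifs <;> linarith
    · by_cases hsrc : N.src r ∈ nodesV1 π
      · by_cases htgt : N.tgt r ∈ nodesV1 π <;> simp [hr, hsrc, htgt]
      · have hfc : r ∈ N.Rfcyc π := ⟨not_not.1 hr, (hnodes _).resolve_right hsrc⟩
        rcases (N.κ_nonneg r).eq_or_lt with hκ | hκ
        · simp [h.flux_integral_eq_zero hT hκ.symm hs hst ht]
        · have := N.tgt_notMem_nodesV1 hπ hnodes hfc hκ
          simp [hr, hsrc, this]
  have hsum := Finset.sum_le_sum hle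
  rw [Finset.sum_sub_distrib, ← hb, ← Finset.sum_filter, ← Finset.sum_filter] at hsum
  linarith

omit [Fintype V] in
open Classical in
/-- The mass of a set of nodes that is closed for the fast cycles changes only through the slow
edges and the edges that leave `V₁`. -/
lemma abs_mass_sub_le (hnodes : ∀ x : V, x ∈ nodesV0 π ∨ x ∈ nodesV1 π)
    (h : N.BoundedCost T ε C p ρ J) (hT : 0 < T) {S : Finset V} (hS : N.FastClosed π S)
    {s t : ℝ} (hs : 0 ≤ s) (hst : s ≤ t) (ht : t ≤ T) :
    |∑ x ∈ S, ρ x t - ∑ x ∈ S, ρ x s| ≤ (∑ r with r ∈ N.Rslow, ∫ τ in s..t, J r τ) +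
      ∑ r with N.src r ∈ nodesV1 π ∧ N.tgt r ∉ nodesV1 π, ∫ τ in s..t, J r τ := by
  rw [h.mass_balance hT S hs hst ht, Finset.sum_filter, Finset.sum_filter,
    ← Finset.sum_add_distrib]
  refine (Finset.abs_sum_le_sum_abs _ _).trans (Finset.sum_le_sum fun r _ => ?_)
  have hF := h.flux_integral_nonneg hT r hs hst ht
  have hS1 : ∀ x ∈ S, x ∉ nodesV1 π := fun x hx => notMem_nodesV1_of_mem_nodesV0 (hS.1 x hx)
  have hexit : 0 ≤ if N.src r ∈ nodesV1 π ∧ N.tgt r ∉ nodesV1 π then ∫ τ in s..t, J r τ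
      else 0 := by split_ifs <;> simp [hF]
  rw [abs_mul, abs_of_nonneg hF]
  by_cases hr : r ∈ N.Rslow
  · have h1 : |(if N.tgt r ∈ S then (1 : ℝ) else 0) - (if N.src r ∈ S then 1 else 0)| ≤ 1 := by
      split_ifs <;> norm_num
    rw [if_pos hr]
    nlinarith
  · rw [if_neg hr, zero_add]
    by_cases hsrc : N.src r ∈ nodesV1 π
    · have h2 : N.src r ∉ S := fun h' => hS1 _ h' hsrc
      by_cases htgt : N.tgt r ∈ S
      · simp [hsrc, h2, htgt, hS1 _ htgt]
      · simpa [h2, htgt] using hexit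
    · have hfc : r ∈ N.Rfcyc π := ⟨not_not.1 hr, (hnodes _).resolve_right hsrc⟩
      rcases (N.κ_nonneg r).eq_or_lt with hκ | hκ
      · simp [h.flux_integral_eq_zero hT hκ.symm hs hst ht]
      · have := hS.2 r hfc hκ
        by_cases h3 : N.tgt r ∈ S
        · simp [h3, this.2 h3, hsrc]
        · have h4 : N.src r ∉ S := fun h' => h3 (this.1 h')
          simp [h3, h4, hsrc]

/-- The concentrations of the nodes of `V₁` are of order `ε` in `L¹`. Every node of `V₁` has a path
of positive edges to `V₀`; the bound for the fluxes out of `V₁` is propagated backwards along it,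
since a bounded flux on an edge bounds the rate of that edge, hence all fluxes with the same
source. -/
lemma exists_integral_concentration_le (hπ : ∀ ε : ℝ, 0 < ε → N.IsEquilibrium ε (π ε))
    (hnodes : ∀ x : V, x ∈ nodesV0 π ∨ x ∈ nodesV1 π)
    (hleak : ∀ r ∈ N.Rslow, N.src r ∉ nodesV1 π) (hT : 0 < T) (C : ℝ≥0) (x : V)
    (hx : x ∈ nodesV1 π) :
    ∃ K : ℝ, 0 ≤ K ∧ ∀ (ε : ℝ) (ρ : V → ℝ → ℝ) (J : R → ℝ → ℝ), 0 < ε →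
      N.BoundedCost T ε C (π ε) ρ J → ∫ τ in (0 : ℝ)..T, ρ x τ ≤ K * ε := by
  classical
  obtain ⟨y₀, hy₀⟩ := N.exists_mem_nodesV0 hπ hnodes
  have hpath := N.diconnected x y₀
  set M : ℝ := Fintype.card V * C + 2 with hM
  have hM0 : 0 ≤ M := by positivity
  set L : ℝ := C + 2 * (slowRateBound N C * T) with hL
  have hL0 : 0 ≤ L := by
    have := slowRateBound_pos N C
    positivity
  have hmem0 : (0 : ℝ) ∈ Set.Icc 0 T := ⟨le_rfl, hT.le⟩
  have hmemT : T ∈ Set.Icc 0 T := ⟨hT.le, le_rfl⟩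
  have hrate : ∀ r, N.src r ∈ nodesV1 π → ∀ ε, N.rate ε r = 1 / ε * N.κ r := fun r hr ε =>
    if_pos (by by_contra hf; exact hleak r hf hr)
  induction hpath using Relation.ReflTransGen.head_induction_on with
  | refl => exact absurd hx (notMem_nodesV1_of_mem_nodesV0 hy₀)
  | @head x y hxy _ ih =>
    obtain ⟨r, hr, rfl, rfl⟩ := hxy
    -- it suffices to bound the flux on the edge `r`
    suffices hF : ∃ F : ℝ, 0 ≤ F ∧ ∀ (ε : ℝ) (ρ : V → ℝ → ℝ) (J : R → ℝ → ℝ), 0 < ε →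
        N.BoundedCost T ε C (π ε) ρ J → N.tgt r ≠ N.src r → ∫ τ in (0 : ℝ)..T, J r τ ≤ F by
      by_cases hloop : N.tgt r = N.src r
      · exact hloop ▸ ih (hloop ▸ hx)
      obtain ⟨F, hF0, hF⟩ := hF
      refine ⟨2 * (C + F) / N.κ r, by positivity, fun ε ρ J hε h => ?_⟩
      have h1 := h.rate_integral_le hT r (h.rate_mul_integral_nonneg hT hε r)
      have h2 := hF ε ρ J hε h hloop
      rw [hrate r hx] at h1
      have h3 : 1 / ε * N.κ r * ∫ τ in (0 : ℝ)..T, ρ (N.src r) τ ≤ 2 * (C + F) := by linarith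
      rw [div_mul_eq_mul_div, le_div_iff₀ hr]
      calc (∫ τ in (0 : ℝ)..T, ρ (N.src r) τ) * N.κ r
          = (1 / ε * N.κ r * ∫ τ in (0 : ℝ)..T, ρ (N.src r) τ) * ε := by field_simp
        _ ≤ _ := by gcongr
    by_cases hy : N.tgt r ∈ nodesV1 π
    · obtain ⟨K, hK0, hK⟩ := ih hy
      have hκ0 : 0 ≤ ∑ r, N.κ r := Finset.sum_nonneg fun r _ => N.κ_nonneg r
      refine ⟨M + Fintype.card R * (C + 2 * ((∑ r, N.κ r) * K)), by positivity,
        fun ε ρ J hε h hne => ?_⟩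
      have hb := h.mass_balance hT {N.tgt r} le_rfl hT.le le_rfl
      have hJ0 := fun r' => h.flux_integral_nonneg hT r' le_rfl hT.le le_rfl
      simp only [Finset.sum_singleton, Finset.mem_singleton] at hb
      have hle : ∀ r' ∈ Finset.univ,
          (if r' = r then ∫ τ in (0 : ℝ)..T, J r' τ else 0) - (C + 2 * ((∑ r, N.κ r) * K)) ≤
          ((if N.tgt r' = N.tgt r then 1 else 0) - (if N.src r' = N.tgt r then 1 else 0)) *
            ∫ τ in (0 : ℝ)..T, J r' τ := by
        intro r' _
        have hc : 0 ≤ C + 2 * ((∑ r, N.κ r) * K) := by positivity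
        have := hJ0 r'
        by_cases hsrc : N.src r' = N.tgt r
        · have hne' : r' ≠ r := by
            rintro rfl
            exact hne hsrc.symm
          have h1 := h.flux_integral_le hT r' (h.rate_mul_integral_nonneg hT hε r')
          rw [hrate r' (hsrc ▸ hy), hsrc] at h1
          have h2 : 1 / ε * N.κ r' * ∫ τ in (0 : ℝ)..T, ρ (N.tgt r) τ ≤ (∑ r, N.κ r) * K := by
            calc 1 / ε * N.κ r' * ∫ τ in (0 : ℝ)..T, ρ (N.tgt r) τ
                ≤ 1 / ε * N.κ r' * (K * ε) := by
                  have := N.κ_nonneg r'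
                  gcongr
                  exact hK ε ρ J hε h
              _ = N.κ r' * K := by field_simp
              _ ≤ _ := by
                  gcongr
                  exact Finset.single_le_sum (fun r _ => N.κ_nonneg r) (Finset.mem_univ r')
          rw [if_neg hne', if_pos hsrc]
          split_ifs <;> linarith
        · rw [if_neg hsrc]
          by_cases hrr : r' = r
          · simp [hrr]
            linarith
          · rw [if_neg hrr]
            split_ifs <;> linarith
      have hsum := Finset.sum_le_sum hle
      rw [← hb, Finset.sum_sub_distrib, Finset.sum_ite_eq' Finset.univ r, if_pos (Finset.mem_univ r),
        Finset.sum_const, Finset.card_univ, nsmul_eq_mul] at hsum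
      have h5 := h.concentration_le hT hε (hπ ε hε) (N.tgt r) hmemT
      have h6 := h.concentration_nonneg hT hε (N.tgt r) hmem0
      linarith
    · refine ⟨M + Fintype.card R * L, by positivity, fun ε ρ J hε h _ => ?_⟩
      have hb := nodesV1_balance hπ hnodes hleak h hT le_rfl hT.le le_rfl
      have h1 : ∫ τ in (0 : ℝ)..T, J r τ ≤
          ∑ r with N.src r ∈ nodesV1 π ∧ N.tgt r ∉ nodesV1 π, ∫ τ in (0 : ℝ)..T, J r τ :=
        Finset.single_le_sum (f := fun r => ∫ τ in (0 : ℝ)..T, J r τ)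
          (fun r' _ => h.flux_integral_nonneg hT r' le_rfl hT.le le_rfl)
          (by simp [hx, hy])
      have h2 : ∑ r with r ∈ N.Rslow, ∫ τ in (0 : ℝ)..T, J r τ ≤ Fintype.card R * L := by
        calc ∑ r with r ∈ N.Rslow, ∫ τ in (0 : ℝ)..T, J r τ ≤ ∑ r with r ∈ N.Rslow, L :=
              Finset.sum_le_sum fun r' hr' =>
                h.slow_flux_integral_le hT hε (hπ ε hε) (Finset.mem_filter.1 hr').2
          _ ≤ ∑ _r : R, L := Finset.sum_le_univ_sum_of_nonneg fun _ => hL0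
          _ = _ := by simp
      have h3 := h.sum_subset_concentration_le hT hε (hπ ε hε)
        (Finset.univ.filter (· ∈ nodesV1 π)) hmem0
      have h4 : 0 ≤ ∑ x with x ∈ nodesV1 π, ρ x T :=
        Finset.sum_nonneg fun x _ => h.concentration_nonneg hT hε x hmemT
      linarith

/-- The damped fluxes are bounded in `L¹`. -/
lemma exists_damp_flux_integral_le (hπ : ∀ ε : ℝ, 0 < ε → N.IsEquilibrium ε (π ε))
    (hnodes : ∀ x : V, x ∈ nodesV0 π ∨ x ∈ nodesV1 π)
    (hleak : ∀ r ∈ N.Rslow, N.src r ∉ nodesV1 π) (hT : 0 < T) (C : ℝ≥0) (r : R)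
    (hr : r ∈ N.Rdamp π) :
    ∃ K : ℝ, 0 ≤ K ∧ ∀ (ε : ℝ) (ρ : V → ℝ → ℝ) (J : R → ℝ → ℝ), 0 < ε →
      N.BoundedCost T ε C (π ε) ρ J → ∫ τ in (0 : ℝ)..T, J r τ ≤ K := by
  obtain ⟨K, hK0, hK⟩ := exists_integral_concentration_le hπ hnodes hleak hT C (N.src r) hr.2
  have hκ := N.κ_nonneg r
  refine ⟨C + 2 * (N.κ r * K), by positivity, fun ε ρ J hε h => ?_⟩
  refine (h.flux_integral_le hT r (h.rate_mul_integral_nonneg hT hε r)).trans ?_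
  have h1 : N.rate ε r = 1 / ε * N.κ r := if_pos hr.1
  have h2 : 1 / ε * N.κ r * ∫ τ in (0 : ℝ)..T, ρ (N.src r) τ ≤ N.κ r * K := by
    calc 1 / ε * N.κ r * ∫ τ in (0 : ℝ)..T, ρ (N.src r) τ ≤ 1 / ε * N.κ r * (K * ε) := by
          gcongr
          exact hK ε ρ J hε h
      _ = N.κ r * K := by field_simp
  rw [h1]
  linarith

end BoundedCost

end SlowFastNetwork

/-! ### Asymptotic equicontinuity -/

namespace SlowFastNetwork

variable {V R : Type*} {N : SlowFastNetwork V R} {π : ℝ → V → ℝ}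

namespace BoundedCost

variable [Fintype V] [Fintype R] {T : ℝ}

omit [Fintype V] in
/-- The initial mass of `V₁` vanishes: mass of order one on a node whose equilibrium mass tends to
zero has large relative entropy. -/
lemma eventually_initial_le (C : ℝ≥0) {x : V} (hx : x ∈ nodesV1 π) {e : ℝ} (he : 0 < e) :
    ∀ᶠ ε in 𝓝[>] (0 : ℝ), ∀ (ρ : V → ℝ → ℝ) (J : R → ℝ → ℝ),
      N.BoundedCost T ε C (π ε) ρ J → ρ x 0 ≤ e := by
  set l : ℝ := (C + 1) / e with hl
  have hlpos : 0 < l := by positivity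
  have hlim : Tendsto (fun ε => π ε x * (Real.exp l - 1)) (𝓝[>] 0) (𝓝 0) := by
    simpa using (tendsto_zero_of_mem_nodesV1 hx).mul_const (Real.exp l - 1)
  filter_upwards [hlim.eventually (eventually_le_nhds one_pos)] with ε hε ρ J h
  have h1 := fenchel_of_relEnt_le (h.initial x) l
  have h2 : ρ x 0 * l ≤ C + 1 := by linarith
  rw [hl, ← mul_div_assoc, div_le_iff₀ he] at h2
  exact le_of_mul_le_mul_right (by linarith) (by positivity : (0 : ℝ) < C + 1)

open Classical in
/-- The mass of `V₁` tends to zero uniformly in time. The slow edges feed little mass into `V₁` in a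
short time `d`, so that a large mass at time `t` would have been present during the whole of
`[t - d, t]`, in contradiction to the `L¹` bound of order `ε`. -/
lemma eventually_mass_nodesV1_le (hπ : ∀ ε : ℝ, 0 < ε → N.IsEquilibrium ε (π ε))
    (hnodes : ∀ x : V, x ∈ nodesV0 π ∨ x ∈ nodesV1 π)
    (hleak : ∀ r ∈ N.Rslow, N.src r ∉ nodesV1 π) (hT : 0 < T) (C : ℝ≥0) {e : ℝ} (he : 0 < e) :
    ∀ᶠ ε in 𝓝[>] (0 : ℝ), ∀ (ρ : V → ℝ → ℝ) (J : R → ℝ → ℝ),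
      N.BoundedCost T ε C (π ε) ρ J → ∀ t ∈ Set.Icc 0 T, ∑ x with x ∈ nodesV1 π, ρ x t ≤ e := by
  obtain ⟨δ, hδ, hmod⟩ := exists_slow_modulus N hT C
    (e := e / 2 / (Fintype.card R + 1)) (by positivity)
  have hK : ∀ x, ∃ K : ℝ, 0 ≤ K ∧ (x ∈ nodesV1 π → ∀ (ε : ℝ) (ρ : V → ℝ → ℝ) (J : R → ℝ → ℝ),
      0 < ε → N.BoundedCost T ε C (π ε) ρ J → ∫ τ in (0 : ℝ)..T, ρ x τ ≤ K * ε) := by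
    intro x
    by_cases hx : x ∈ nodesV1 π
    · obtain ⟨K, hK0, hK⟩ := exists_integral_concentration_le hπ hnodes hleak hT C x hx
      exact ⟨K, hK0, fun _ => hK⟩
    · exact ⟨0, le_rfl, fun h => absurd h hx⟩
  choose K hK0 hK using hK
  set d : ℝ := δ / 2 with hd
  have hdpos : 0 < d := by positivity
  have hsmall : ∀ᶠ ε in 𝓝[>] (0 : ℝ), (∑ x, K x) * ε ≤ e / 2 * d := by
    have h0 : Tendsto (fun ε : ℝ => (∑ x, K x) * ε) (𝓝[>] 0) (𝓝 0) := by
      have : Tendsto (fun ε : ℝ => ε) (𝓝[>] 0) (𝓝 0) :=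
        tendsto_nhdsWithin_of_tendsto_nhds tendsto_id
      simpa using this.const_mul (∑ x, K x)
    exact h0.eventually (eventually_le_nhds (by positivity))
  have hinit : ∀ᶠ ε in 𝓝[>] (0 : ℝ), ∀ x, x ∈ nodesV1 π → ∀ (ρ : V → ℝ → ℝ) (J : R → ℝ → ℝ),
      N.BoundedCost T ε C (π ε) ρ J → ρ x 0 ≤ e / 2 / (Fintype.card V + 1) := by
    refine eventually_all.2 fun x => ?_
    by_cases hx : x ∈ nodesV1 π
    · filter_upwards [eventually_initial_le (N := N) (T := T) C hx
        (show 0 < e / 2 / (Fintype.card V + 1) by positivity)] with ε h _ using h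
    · exact Eventually.of_forall fun _ h => absurd h hx
  filter_upwards [hsmall, hinit, self_mem_nhdsWithin] with ε hεs hεi hε ρ J h t ht
  have hε : 0 < ε := hε
  -- the slow edges feed at most `e / 2` into `V₁` during a time `d`
  have hfeed : ∀ s, 0 ≤ s → s ≤ t → t - s < δ →
      ∑ x with x ∈ nodesV1 π, ρ x t ≤ ∑ x with x ∈ nodesV1 π, ρ x s + e / 2 := by
    intro s hs hst hts
    have hb := nodesV1_balance hπ hnodes hleak h hT hs hst ht.2
    have hexit : 0 ≤ ∑ r with N.src r ∈ nodesV1 π ∧ N.tgt r ∉ nodesV1 π, ∫ τ in s..t, J r τ :=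
      Finset.sum_nonneg fun r _ => h.flux_integral_nonneg hT r hs hst ht.2
    have hslow : ∑ r with r ∈ N.Rslow, ∫ τ in s..t, J r τ ≤ e / 2 := by
      calc ∑ r with r ∈ N.Rslow, ∫ τ in s..t, J r τ
          ≤ ∑ r with r ∈ N.Rslow, e / 2 / (Fintype.card R + 1) :=
            Finset.sum_le_sum fun r hr => hmod ε _ ρ J hε (hπ ε hε) h r (Finset.mem_filter.1 hr).2
              s t hs hst ht.2 hts
        _ ≤ ∑ _r : R, e / 2 / (Fintype.card R + 1) :=
            Finset.sum_le_univ_sum_of_nonneg fun _ => by positivity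
        _ = Fintype.card R * (e / 2 / (Fintype.card R + 1)) := by simp
        _ ≤ (Fintype.card R + 1) * (e / 2 / (Fintype.card R + 1)) := by gcongr; linarith
        _ = e / 2 := by field_simp
    linarith
  rcases lt_or_ge t δ with htδ | htδ
  · have h1 := hfeed 0 le_rfl ht.1 (by linarith)
    have h2 : ∑ x with x ∈ nodesV1 π, ρ x 0 ≤ e / 2 := by
      calc ∑ x with x ∈ nodesV1 π, ρ x 0
          ≤ ∑ x with x ∈ nodesV1 π, e / 2 / (Fintype.card V + 1) :=
            Finset.sum_le_sum fun x hx => hεi x (Finset.mem_filter.1 hx).2 ρ J h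
        _ ≤ ∑ _x : V, e / 2 / (Fintype.card V + 1) :=
            Finset.sum_le_univ_sum_of_nonneg fun _ => by positivity
        _ = Fintype.card V * (e / 2 / (Fintype.card V + 1)) := by simp
        _ ≤ (Fintype.card V + 1) * (e / 2 / (Fintype.card V + 1)) := by gcongr; linarith
        _ = e / 2 := by field_simp
    linarith
  · set m := ∑ x with x ∈ nodesV1 π, ρ x t with hm
    have htd : 0 ≤ t - d := by linarith
    have hle : t - d ≤ t := by linarith
    have hii : ∀ x, IntervalIntegrable (ρ x) volume (t - d) t := fun x =>
      h.intervalIntegrable_concentration hT x htd hle ht.2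
    have h1 : (m - e / 2) * d ≤ ∫ s in (t - d)..t, ∑ x with x ∈ nodesV1 π, ρ x s := by
      have h2 : ∫ _ in (t - d)..t, (m - e / 2) ≤
          ∫ s in (t - d)..t, ∑ x with x ∈ nodesV1 π, ρ x s := by
        refine intervalIntegral.integral_mono_on hle intervalIntegrable_const
          (by
            have := IntervalIntegrable.sum (Finset.univ.filter (· ∈ nodesV1 π)) fun x _ => hii x
            rwa [Finset.sum_fn] at this) fun s hs => ?_
        have := hfeed s (htd.trans hs.1) hs.2 (by linarith [hs.1])
        linarith
      rw [intervalIntegral.integral_const, smul_eq_mul] at h2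
      linarith
    rw [intervalIntegral.integral_finsetSum fun x _ => hii x] at h1
    have h3 : ∑ x with x ∈ nodesV1 π, ∫ s in (t - d)..t, ρ x s ≤ (∑ x, K x) * ε := by
      calc ∑ x with x ∈ nodesV1 π, ∫ s in (t - d)..t, ρ x s
          ≤ ∑ x with x ∈ nodesV1 π, K x * ε := by
            refine Finset.sum_le_sum fun x hx => ?_
            refine le_trans ?_ (hK x (Finset.mem_filter.1 hx).2 ε ρ J hε h)
            refine intervalIntegral.integral_mono_interval htd hle ht.2 ?_
              (h.intervalIntegrable_concentration hT x le_rfl hT.le le_rfl)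
            refine (ae_restrict_iff' measurableSet_Ioc).2 (Eventually.of_forall fun s hs => ?_)
            exact h.concentration_nonneg hT hε x ⟨hs.1.le, hs.2⟩
        _ ≤ ∑ x, K x * ε :=
            Finset.sum_le_univ_sum_of_nonneg fun x => mul_nonneg (hK0 x) hε.le
        _ = _ := (Finset.sum_mul _ _ _).symm
    have h4 : (m - e / 2) * d ≤ e / 2 * d := by linarith
    have := le_of_mul_le_mul_right h4 hdpos
    linarith

/-- Asymptotic equicontinuity of the masses of sets of nodes that are closed for the fast cycles. -/
lemma exists_mass_modulus (hπ : ∀ ε : ℝ, 0 < ε → N.IsEquilibrium ε (π ε))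
    (hnodes : ∀ x : V, x ∈ nodesV0 π ∨ x ∈ nodesV1 π)
    (hleak : ∀ r ∈ N.Rslow, N.src r ∉ nodesV1 π) (hT : 0 < T) (C : ℝ≥0) {e : ℝ} (he : 0 < e) :
    ∃ δ : ℝ, 0 < δ ∧ ∀ᶠ ε in 𝓝[>] (0 : ℝ), ∀ (ρ : V → ℝ → ℝ) (J : R → ℝ → ℝ),
      N.BoundedCost T ε C (π ε) ρ J → ∀ S : Finset V, N.FastClosed π S →
      ∀ s ∈ Set.Icc 0 T, ∀ t ∈ Set.Icc 0 T, |t - s| < δ →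
        |∑ x ∈ S, ρ x t - ∑ x ∈ S, ρ x s| ≤ e := by
  classical
  obtain ⟨δ, hδ, hmod⟩ := exists_slow_modulus N hT C
    (e := e / 4 / (Fintype.card R + 1)) (by positivity)
  refine ⟨δ, hδ, ?_⟩
  filter_upwards [eventually_mass_nodesV1_le hπ hnodes hleak hT C (half_pos he),
    self_mem_nhdsWithin] with ε hεm hε ρ J h S hS
  have hε : 0 < ε := hε
  have key : ∀ s t, 0 ≤ s → s ≤ t → t ≤ T → t - s < δ →
      |∑ x ∈ S, ρ x t - ∑ x ∈ S, ρ x s| ≤ e := by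
    intro s t hs hst ht hd
    have h1 := h.abs_mass_sub_le hnodes hT hS hs hst ht
    have h2 := nodesV1_balance hπ hnodes hleak h hT hs hst ht
    have h3 := hεm ρ J h s ⟨hs, hst.trans ht⟩
    have h4 : 0 ≤ ∑ x with x ∈ nodesV1 π, ρ x t :=
      Finset.sum_nonneg fun x _ => h.concentration_nonneg hT hε x ⟨hs.trans hst, ht⟩
    have hslow : ∑ r with r ∈ N.Rslow, ∫ τ in s..t, J r τ ≤ e / 4 := by
      calc ∑ r with r ∈ N.Rslow, ∫ τ in s..t, J r τ
          ≤ ∑ r with r ∈ N.Rslow, e / 4 / (Fintype.card R + 1) :=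
            Finset.sum_le_sum fun r hr => hmod ε _ ρ J hε (hπ ε hε) h r (Finset.mem_filter.1 hr).2
              s t hs hst ht hd
        _ ≤ ∑ _r : R, e / 4 / (Fintype.card R + 1) :=
            Finset.sum_le_univ_sum_of_nonneg fun _ => by positivity
        _ = Fintype.card R * (e / 4 / (Fintype.card R + 1)) := by simp
        _ ≤ (Fintype.card R + 1) * (e / 4 / (Fintype.card R + 1)) := by gcongr; linarith
        _ = e / 4 := by field_simp
    linarith
  intro s hs t ht hd
  rcases le_total s t with hst | hst
  · exact key s t hs.1 hst ht.2 ((le_abs_self _).trans_lt hd)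
  · rw [abs_sub_comm] at hd ⊢
    exact key t s ht.1 hst hs.2 ((le_abs_self _).trans_lt hd)

end BoundedCost

end SlowFastNetwork

/-! ### The time interval and extraction of subsequences -/

section TimeInterval

variable {T : ℝ}

instance isFiniteMeasure_timeVol : IsFiniteMeasure (timeVol T) := by
  refine ⟨?_⟩
  rw [timeVol, comap_subtype_coe_apply measurableSet_Icc, Set.image_univ, Subtype.range_coe]
  exact measure_Icc_lt_top

lemma ae_timeVol_iff {P : ℝ → Prop} :
    (∀ᵐ t : TimeIcc T ∂(timeVol T), P t) ↔ ∀ᵐ t ∂(volume.restrict (Set.Icc 0 T)), P t :=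
  (ae_restrict_iff_subtype measurableSet_Icc).symm

lemma measurePreserving_timeVol :
    MeasurePreserving ((↑) : TimeIcc T → ℝ) (timeVol T) (volume.restrict (Set.Icc 0 T)) :=
  ⟨measurable_subtype_coe, map_comap_subtype_coe measurableSet_Icc _⟩

lemma lintegral_timeVol (f : ℝ → ℝ≥0∞) :
    ∫⁻ t : TimeIcc T, f t ∂(timeVol T) = ∫⁻ t in Set.Icc 0 T, f t :=
  measurePreserving_timeVol.lintegral_comp_emb (MeasurableEmbedding.subtype_coe measurableSet_Icc) f

lemma integral_timeVol (f : ℝ → ℝ) :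
    ∫ t : TimeIcc T, f t ∂(timeVol T) = ∫ t in Set.Icc 0 T, f t :=
  measurePreserving_timeVol.integral_comp (MeasurableEmbedding.subtype_coe measurableSet_Icc) f

/-- Continuous functions on `[0,T]` that agree almost everywhere agree everywhere. -/
lemma eq_of_ae_eq_timeVol (hT : 0 < T) {f g : TimeIcc T → ℝ} (hf : Continuous f)
    (hg : Continuous g) (h : ∀ᵐ t ∂(timeVol T), f t = g t) (t : TimeIcc T) : f t = g t := by
  have h1 : Set.IccExtend hT.le f =ᵐ[volume.restrict (Set.Icc 0 T)] Set.IccExtend hT.le g := by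
    refine ae_timeVol_iff.1 ?_
    filter_upwards [h] with t ht
    rwa [Set.IccExtend_val, Set.IccExtend_val]
  have h2 := Measure.eqOn_Icc_of_ae_eq volume hT.ne h1 (hf.Icc_extend').continuousOn
    (hg.Icc_extend').continuousOn t.2
  rwa [Set.IccExtend_val, Set.IccExtend_val] at h2

lemma vectorIntegral_withDensity {f : TimeIcc T → ℝ} (hf : Integrable f (timeVol T))
    (hf0 : ∀ᵐ t ∂(timeVol T), 0 ≤ f t) (h : C(TimeIcc T, ℝ)) :
    ∫ᵛ t, h t ∂<•((timeVol T).withDensityᵥ f) = ∫ t, h t * f t ∂(timeVol T) := by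
  have hm : AEMeasurable (fun t => ENNReal.ofReal (f t)) (timeVol T) :=
    hf.1.aemeasurable.ennreal_ofReal
  have hfin : ∫⁻ t, ENNReal.ofReal (f t) ∂(timeVol T) ≠ ⊤ := by
    rw [← ofReal_integral_eq_lintegral_ofReal hf hf0]
    exact ENNReal.ofReal_ne_top
  have heq : (fun t => (ENNReal.ofReal (f t)).toReal) =ᵐ[timeVol T] f := by
    filter_upwards [hf0] with t ht using ENNReal.toReal_ofReal ht
  have := isFiniteMeasure_withDensity hfin
  rw [← WithDensityᵥEq.congr_ae heq, withDensityᵥ_toReal hm hfin,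
    VectorMeasure.integral_toSignedMeasure,
    integral_withDensity_eq_integral_toReal_smul₀ hm (by simp)]
  refine integral_congr_ae ?_
  filter_upwards [heq] with t ht
  rw [ht, smul_eq_mul, mul_comm]

end TimeInterval

/-- Every subsequence of the sequence has a convergent subsequence. -/
def SubseqPrecompact {X : Type*} [TopologicalSpace X] (x : ℕ → X) : Prop :=
  ∀ φ : ℕ → ℕ, StrictMono φ → ∃ ψ : ℕ → ℕ, StrictMono ψ ∧ ∃ a,
    Tendsto (fun n => x (φ (ψ n))) atTop (𝓝 a)

namespace SubseqPrecompact

lemma prodMk {X Y : Type*} [TopologicalSpace X] [TopologicalSpace Y] {x : ℕ → X} {y : ℕ → Y}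
    (hx : SubseqPrecompact x) (hy : SubseqPrecompact y) :
    SubseqPrecompact fun n => (x n, y n) := by
  intro φ hφ
  obtain ⟨ψ, hψ, a, ha⟩ := hx φ hφ
  obtain ⟨χ, hχ, b, hb⟩ := hy (φ ∘ ψ) (hφ.comp hψ)
  exact ⟨ψ ∘ χ, hψ.comp hχ, (a, b), (ha.comp hχ.tendsto_atTop).prodMk_nhds hb⟩

lemma pi {ι : Type*} [Finite ι] {X : ι → Type*} [∀ i, TopologicalSpace (X i)] {x : ℕ → ∀ i, X i}
    (hx : ∀ i, SubseqPrecompact fun n => x n i) : SubseqPrecompact x := by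
  classical
  have := Fintype.ofFinite ι
  intro φ hφ
  have key : ∀ s : Finset ι, ∃ ψ : ℕ → ℕ, StrictMono ψ ∧ ∀ i ∈ s, ∃ a,
      Tendsto (fun n => x (φ (ψ n)) i) atTop (𝓝 a) := by
    intro s
    induction s using Finset.induction_on with
    | empty => exact ⟨id, strictMono_id, by simp⟩
    | insert i s _ ih =>
      obtain ⟨ψ, hψ, h⟩ := ih
      obtain ⟨χ, hχ, a, ha⟩ := hx i (φ ∘ ψ) (hφ.comp hψ)
      refine ⟨ψ ∘ χ, hψ.comp hχ, fun i' hi' => ?_⟩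
      rcases Finset.mem_insert.1 hi' with rfl | hi'
      · exact ⟨a, ha⟩
      · obtain ⟨b, hb⟩ := h i' hi'
        exact ⟨b, hb.comp hχ.tendsto_atTop⟩
  obtain ⟨ψ, hψ, h⟩ := key Finset.univ
  choose a ha using fun i => h i (Finset.mem_univ i)
  exact ⟨ψ, hψ, a, tendsto_pi_nhds.2 ha⟩

end SubseqPrecompact

section Spaces

variable {T : ℝ}

lemma subseqPrecompact_linfTime {B : ℝ} {f : ℕ → LInfTime T}
    (hf : ∀ n, ∀ᵐ t ∂(timeVol T), |(f n).toLp t| ≤ B) : SubseqPrecompact f := by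
  intro φ hφ
  obtain ⟨ψ, hψ, g, hgm, hgB, hg⟩ := exists_subseq_tendsto_linfty
    (f := fun n => ((f (φ n)).toLp : TimeIcc T → ℝ)) (fun n => Lp.aestronglyMeasurable _)
    (fun n => hf (φ n))
  refine ⟨ψ, hψ, ⟨(memLp_top_of_bound hgm B hgB).toLp g⟩, ?_⟩
  rw [nhds_induced, tendsto_comap_iff, tendsto_pi_nhds]
  intro ζ
  have h1 : ∫ t, ((memLp_top_of_bound hgm B hgB).toLp g) t * ζ t ∂(timeVol T) =
      ∫ t, g t * ζ t ∂(timeVol T) := by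
    refine integral_congr_ae ?_
    filter_upwards [(memLp_top_of_bound hgm B hgB).coeFn_toLp] with t ht
    rw [ht]
  simp only [h1]
  exact hg ζ (L1.integrable_coeFn ζ)

lemma subseqPrecompact_orliczTime {a : ℝ} (ha : 0 < a) {K : ℝ≥0} {f : ℕ → OrliczTime T}
    (hf : ∀ n, ∫⁻ t, youngC ((f n).toFun t / a) ∂(timeVol T) ≤ K) : SubseqPrecompact f := by
  intro φ hφ
  obtain ⟨ψ, hψ, g, hgm, hgK, hg⟩ := exists_subseq_tendsto_orlicz ha
    (f := fun n => ((f (φ n)).toFun : TimeIcc T → ℝ))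
    (fun n => AEEqFun.aestronglyMeasurable _) (fun n => hf (φ n))
  have hae := AEEqFun.coeFn_mk g hgm
  refine ⟨ψ, hψ, ⟨AEEqFun.mk g hgm, a, ha, ?_⟩, ?_⟩
  · refine lt_of_le_of_lt (le_of_eq_of_le (lintegral_congr_ae ?_) hgK) ENNReal.coe_lt_top
    filter_upwards [hae] with t ht
    rw [ht]
  · rw [nhds_induced, tendsto_comap_iff, tendsto_pi_nhds]
    intro ζ
    have h1 : ∫ t, (AEEqFun.mk g hgm) t * ζ.1 t ∂(timeVol T) =
        ∫ t, g t * ζ.1 t ∂(timeVol T) := by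
      refine integral_congr_ae ?_
      filter_upwards [hae] with t ht
      rw [ht]
    simp only [h1]
    exact hg _ (AEEqFun.aestronglyMeasurable _) ζ.2

lemma subseqPrecompact_measTime {K : ℝ≥0} {μ : ℕ → MeasTime T} {f : ℕ → TimeIcc T → ℝ}
    (hf : ∀ n, Integrable (f n) (timeVol T)) (hf0 : ∀ n, ∀ᵐ t ∂(timeVol T), 0 ≤ f n t)
    (hfK : ∀ n, ∫ t, f n t ∂(timeVol T) ≤ K)
    (hμ : ∀ n, (μ n).toSigned = (timeVol T).withDensityᵥ (f n)) : SubseqPrecompact μ := by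
  intro φ hφ
  obtain ⟨ψ, hψ, ν, hν, hlim⟩ := exists_subseq_tendsto_narrow (f := fun n => f (φ n))
    (fun n => hf (φ n)) (fun n => hf0 (φ n)) (fun n => hfK (φ n))
  refine ⟨ψ, hψ, ⟨ν.toSignedMeasure⟩, ?_⟩
  rw [nhds_induced, tendsto_comap_iff, tendsto_pi_nhds]
  intro h
  simp only [Function.comp_def, hμ, vectorIntegral_withDensity (hf _) (hf0 _),
    VectorMeasure.integral_toSignedMeasure]
  exact hlim h

lemma subseqPrecompact_continuousMap {ι : Type*} [Finite ι] {f : ℕ → C(TimeIcc T, ι → ℝ)} {B : ℝ}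
    (hB : ∀ n t i, |f n t i| ≤ B)
    (hf : ∀ e : ℝ, 0 < e → ∃ δ : ℝ, 0 < δ ∧ ∃ M, ∀ n, M ≤ n → ∀ i (s t : TimeIcc T),
      |(t : ℝ) - s| < δ → |f n t i - f n s i| ≤ e) : SubseqPrecompact f := by
  intro φ hφ
  have := Fintype.ofFinite ι
  refine exists_subseq_tendsto_uniform (f := fun n => f (φ n)) (B := |B|) (fun n t => ?_)
    fun e he => ?_
  · exact (pi_norm_le_iff_of_nonneg (abs_nonneg B)).2 fun i => (hB _ t i).trans (le_abs_self B)
  · obtain ⟨δ, hδ, M, h⟩ := hf e he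
    refine ⟨δ, hδ, M, fun n hn s t hst => (dist_pi_le_iff he.le).2 fun i => ?_⟩
    rw [Real.dist_eq]
    refine h (φ n) (hn.trans (hφ.id_le n)) i t s ?_
    rwa [Subtype.dist_eq, Real.dist_eq] at hst

end Spaces

/-! ### Compactness of the components and the theorem -/

namespace SlowFastNetwork

variable {V R : Type*} [Fintype V] [Fintype R] {N : SlowFastNetwork V R} {π : ℝ → V → ℝ}

/-- Finite cost provides representing functions; the infimum in the cost need not be attained a
priori, whence the `1`. -/
lemma exists_represents_of_cost_le {T ε : ℝ} {C : ℝ≥0} {θ : N.Theta π T} (h : N.cost ε θ ≤ C) :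
    N.ComponentRelation (π ε) θ ∧ ∃ (u : V → ℝ → ℝ) (j : R → ℝ → ℝ), N.Represents θ u j ∧
      N.BoundedCost T ε (C + 1) (π ε) (fun x t => π ε x * u x t) (N.physicalFlux π ε u j) := by
  unfold cost at h
  split_ifs at h with hrel
  · refine ⟨hrel, ?_⟩
    have hlt := h.trans_lt (ENNReal.coe_lt_coe.2 (lt_add_one C))
    simp only [iInf_lt_iff] at hlt
    obtain ⟨u, j, hrep, hlt⟩ := hlt
    refine ⟨u, j, hrep, ?_⟩
    have h1 := (le_self_add.trans hlt.le : initialCost _ _ ≤ _)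
    have h2 := (le_add_self.trans hlt.le : N.fluxCost _ _ _ _ ≤ _)
    unfold fluxCost at h2
    split_ifs at h2 with hc
    · exact ⟨hc.1, hc.2.1, hc.2.2,
        fun x => (Finset.single_le_sum (f := fun x => relEnt (π ε x * u x 0) (π ε x))
          (fun _ _ => zero_le) (Finset.mem_univ x)).trans h1,
        fun r => (Finset.single_le_sum (f := fun r => ∫⁻ t in Set.Icc 0 T,
          relEnt (N.physicalFlux π ε u j r t) (N.rate ε r * (π ε (N.src r) * u (N.src r) t)))
          (fun _ _ => zero_le) (Finset.mem_univ r)).trans h2⟩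
    · exact absurd h2 (by simp)
  · exact absurd h (by simp)

/-- The rescaled excess fluxes on the fast-cycle edges are bounded in the Orlicz class, for
`ε ≤ 1`. -/
lemma lintegral_youngC_fcyc_le {T ε : ℝ} {C : ℝ≥0} {u : V → ℝ → ℝ} {j : R → ℝ → ℝ}
    (h : N.BoundedCost T ε C (π ε) (fun x t => π ε x * u x t) (N.physicalFlux π ε u j))
    (hT : 0 < T) (hε : 0 < ε) (hε1 : ε ≤ 1) (hp : N.IsEquilibrium ε (π ε)) {r : R}
    (hr : r ∈ N.Rfcyc π) :
    ∫⁻ t in Set.Icc 0 T, youngC (j r t / BoundedCost.slowRateBound N C) ≤ C := by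
  set W := BoundedCost.slowRateBound N C with hW
  have hM : (0 : ℝ) ≤ Fintype.card V * C + 2 := by positivity
  have hκ : N.κ r ≤ ∑ r, N.κ r :=
    Finset.single_le_sum (fun r _ => N.κ_nonneg r) (Finset.mem_univ r)
  have hκ0 : 0 ≤ ∑ r, N.κ r := Finset.sum_nonneg fun r _ => N.κ_nonneg r
  have hW1 : 1 ≤ W := by
    rw [hW, BoundedCost.slowRateBound]
    have := mul_nonneg hκ0 hM
    linarith
  have hpt : ∀ t ∈ Set.Icc (0 : ℝ) T, youngC (j r t / W) ≤
      relEnt (N.physicalFlux π ε u j r t) (N.rate ε r * (π ε (N.src r) * u (N.src r) t)) := by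
    intro t ht
    have h0 := h.concentration_nonneg hT hε (N.src r) ht
    have hw0 : 0 ≤ N.κ r * (π ε (N.src r) * u (N.src r) t) := mul_nonneg (N.κ_nonneg r) h0
    have hwW : N.κ r * (π ε (N.src r) * u (N.src r) t) ≤ W := by
      rw [hW, BoundedCost.slowRateBound]
      have := mul_le_mul hκ (h.concentration_le hT hε hp (N.src r) ht) h0 hκ0
      linarith
    have h1 := mul_youngC_le_relEnt_rescaled (j := j r t)
      (BoundedCost.slowRateBound_pos N C) hw0 hwW hε hε1
    have h2 : N.physicalFlux π ε u j r t =
        1 / ε * (N.κ r * (π ε (N.src r) * u (N.src r) t)) + 1 / √ε * j r t := by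
      rw [physicalFlux, if_pos hr]
      ring
    have h3 : N.rate ε r * (π ε (N.src r) * u (N.src r) t) =
        1 / ε * (N.κ r * (π ε (N.src r) * u (N.src r) t)) := by
      rw [rate, if_pos hr.1]
      ring
    rw [h2, h3]
    refine le_trans ?_ h1
    exact le_mul_of_one_le_left' (by simpa using hW1)
  exact (setLIntegral_mono' measurableSet_Icc hpt).trans (h.flux r)

/-- In terms of the concentrations, the mass of a fast component is `π_𝔠 u_𝔠`, at all times. -/
lemma component_mass_eq {T ε : ℝ} (hT : 0 < T) {C : ℝ≥0} {θ : N.Theta π T} {u : V → ℝ → ℝ}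
    {j : R → ℝ → ℝ} {p : V → ℝ} (hrel : N.ComponentRelation p θ) (hrep : N.Represents θ u j)
    {J : R → ℝ → ℝ} (h : N.BoundedCost T ε C p (fun x t => p x * u x t) J)
    (c : N.components π) (t : TimeIcc T) [DecidablePred (· ∈ (c : Set V))] :
    (∑ x with x ∈ (c : Set V), p x) * θ.uComp t c = ∑ x with x ∈ (c : Set V), p x * u x t := by
  classical
  refine eq_of_ae_eq_timeVol hT (f := fun t => (∑ x with x ∈ (c : Set V), p x) * θ.uComp t c)
    (g := fun t => ∑ x with x ∈ (c : Set V), p x * u x t) ?_ ?_ ?_ t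
  · exact continuous_const.mul ((continuous_apply c).comp θ.uComp.continuous)
  · exact continuous_finsetSum _ fun x _ => (h.continuousOn hT x).domRestrict
  · filter_upwards [hrel c, ae_all_iff.2 hrep.uFcyc] with t h1 h2
    have h3 : ∑ x : N.V0fcyc π, (if (x : V) ∈ (c : Set V) then p x * (θ.uFcyc x).toLp t else 0) =
        ∑ x : N.V0fcyc π, (fun x : V => if x ∈ (c : Set V) then p x * u x t else 0) x :=
      Finset.sum_congr rfl fun x _ => by simp only [h2 x]
    have h4 : ∑ x : N.V0fcyc π, (fun x : V => if x ∈ (c : Set V) then p x * u x t else 0) x =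
        ∑ x ∈ (N.V0fcyc π).toFinset, (if x ∈ (c : Set V) then p x * u x t else 0) :=
      Finset.sum_set_coe (f := fun x : V => if x ∈ (c : Set V) then p x * u x t else 0) _
    have h5 : ∑ x ∈ (N.V0fcyc π).toFinset, (if x ∈ (c : Set V) then p x * u x t else 0) =
        ∑ x with x ∈ (c : Set V), p x * u x t := by
      rw [Finset.sum_filter]
      refine Finset.sum_subset (Finset.subset_univ _) fun x _ hx => if_neg fun hxc => hx ?_
      simpa using N.subset_V0fcyc_of_mem_components c.2 hxc
    rw [← h5, ← h4, ← h3]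
    convert h1

/-- A sequence of elements of `Θ` of bounded cost, together with representing functions. The constant
`m` bounds the equilibrium masses, rescaled by `ε` on `V₁`, from below. -/
structure BoundedSeq (N : SlowFastNetwork V R) (π : ℝ → V → ℝ) (T m : ℝ) (C : ℝ≥0) (ε : ℕ → ℝ)
    (θ : ℕ → N.Theta π T) (u : ℕ → V → ℝ → ℝ) (j : ℕ → R → ℝ → ℝ) : Prop where
  equilibrium : ∀ ε : ℝ, 0 < ε → N.IsEquilibrium ε (π ε)
  nodes : ∀ x : V, x ∈ nodesV0 π ∨ x ∈ nodesV1 π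
  noLeak : ∀ r ∈ N.Rslow, N.src r ∉ nodesV1 π
  T_pos : 0 < T
  m_pos : 0 < m
  ε_pos : ∀ n, 0 < ε n
  ε_le_one : ∀ n, ε n ≤ 1
  tendsto : Tendsto ε atTop (𝓝 0)
  le_V0 : ∀ n, ∀ x ∈ nodesV0 π, m ≤ π (ε n) x
  le_V1 : ∀ n, ∀ x ∈ nodesV1 π, m * ε n ≤ π (ε n) x
  relation : ∀ n, N.ComponentRelation (π (ε n)) (θ n)
  represents : ∀ n, N.Represents (θ n) (u n) (j n)
  bounded : ∀ n, N.BoundedCost T (ε n) C (π (ε n)) (fun x t => π (ε n) x * u n x t)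
    (N.physicalFlux π (ε n) (u n) (j n))

namespace BoundedSeq

variable {T m : ℝ} {C : ℝ≥0} {ε : ℕ → ℝ} {θ : ℕ → N.Theta π T} {u : ℕ → V → ℝ → ℝ}
  {j : ℕ → R → ℝ → ℝ} (h : N.BoundedSeq π T m C ε θ u j)

include h

lemma density_nonneg (n : ℕ) (x : V) {t : ℝ} (ht : t ∈ Set.Icc 0 T) : 0 ≤ u n x t :=
  nonneg_of_mul_nonneg_right ((h.bounded n).concentration_nonneg h.T_pos (h.ε_pos n) x ht)
    ((h.equilibrium _ (h.ε_pos n)).pos x)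

lemma abs_density_le (n : ℕ) {x : V} (hx : x ∈ nodesV0 π) {t : ℝ} (ht : t ∈ Set.Icc 0 T) :
    |u n x t| ≤ (Fintype.card V * C + 2) / m := by
  rw [abs_of_nonneg (h.density_nonneg n x ht), le_div_iff₀ h.m_pos, mul_comm]
  refine le_trans ?_ ((h.bounded n).concentration_le h.T_pos (h.ε_pos n)
    (h.equilibrium _ (h.ε_pos n)) x ht)
  have := h.density_nonneg n x ht
  have := h.le_V0 n x hx
  gcongr

/-- The masses of sets that are closed for the fast cycles are asymptotically equicontinuous. -/
lemma exists_modulus {e : ℝ} (he : 0 < e) : ∃ δ : ℝ, 0 < δ ∧ ∃ M, ∀ n, M ≤ n →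
    ∀ S : Finset V, N.FastClosed π S → ∀ s ∈ Set.Icc 0 T, ∀ t ∈ Set.Icc 0 T, |t - s| < δ →
      |∑ x ∈ S, π (ε n) x * u n x t - ∑ x ∈ S, π (ε n) x * u n x s| ≤ e := by
  obtain ⟨δ, hδ, hev⟩ := BoundedCost.exists_mass_modulus h.equilibrium h.nodes h.noLeak h.T_pos C he
  have hlim : Tendsto ε atTop (𝓝[>] 0) :=
    tendsto_nhdsWithin_iff.2 ⟨h.tendsto, Eventually.of_forall h.ε_pos⟩
  obtain ⟨M, hM⟩ := eventually_atTop.1 (hlim.eventually hev)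
  exact ⟨δ, hδ, M, fun n hn => hM n hn _ _ (h.bounded n)⟩

lemma subseqPrecompact_uSlow : SubseqPrecompact fun n => (θ n).uSlow := by
  refine subseqPrecompact_continuousMap (B := (Fintype.card V * C + 2) / m) (fun n t x => ?_)
    fun e he => ?_
  · rw [(h.represents n).uSlow]
    exact h.abs_density_le n x.2.1 t.2
  · obtain ⟨δ, hδ, M, hM⟩ := h.exists_modulus (mul_pos h.m_pos he)
    refine ⟨δ, hδ, M, fun n hn x s t hst => ?_⟩
    have h1 := hM n hn {(x : V)} (N.fastClosed_singleton h.equilibrium h.nodes x.2) s s.2 t t.2 hst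
    rw [Finset.sum_singleton, Finset.sum_singleton, ← mul_sub, abs_mul] at h1
    rw [(h.represents n).uSlow, (h.represents n).uSlow]
    have h2 : m ≤ |π (ε n) x| := (h.le_V0 n x x.2.1).trans (le_abs_self _)
    refine le_of_mul_le_mul_left (le_trans ?_ h1) h.m_pos
    gcongr

open Classical in
lemma le_component_mass (n : ℕ) (c : N.components π) :
    m ≤ ∑ x with x ∈ (c : Set V), π (ε n) x := by
  obtain ⟨x, hx⟩ := c.2.1.1
  refine (h.le_V0 n x (c.2.1.2.1 hx)).trans ?_
  exact Finset.single_le_sum (f := fun x => π (ε n) x)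
    (fun y _ => ((h.equilibrium _ (h.ε_pos n)).pos y).le) (by simpa using hx)

lemma abs_uComp_le (n : ℕ) (t : TimeIcc T) (c : N.components π) :
    |(θ n).uComp t c| ≤ (Fintype.card V * C + 2) / m := by
  classical
  have h1 := component_mass_eq h.T_pos (h.relation n) (h.represents n) (h.bounded n) c t
  have h2 := h.le_component_mass n c
  have h3 : 0 ≤ ∑ x with x ∈ (c : Set V), π (ε n) x * u n x t :=
    Finset.sum_nonneg fun x _ =>
      (h.bounded n).concentration_nonneg h.T_pos (h.ε_pos n) x t.2
  have h4 := (h.bounded n).sum_subset_concentration_le h.T_pos (h.ε_pos n)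
    (h.equilibrium _ (h.ε_pos n)) (Finset.univ.filter (· ∈ (c : Set V))) t.2
  rw [le_div_iff₀ h.m_pos, mul_comm]
  calc m * |(θ n).uComp t c| ≤ (∑ x with x ∈ (c : Set V), π (ε n) x) * |(θ n).uComp t c| := by
        gcongr
    _ = |∑ x with x ∈ (c : Set V), π (ε n) x * u n x t| := by
        rw [← h1, abs_mul, abs_of_pos (h.m_pos.trans_le h2)]
    _ ≤ _ := by rwa [abs_of_nonneg h3]

lemma subseqPrecompact_uComp : SubseqPrecompact fun n => (θ n).uComp := by
  classical
  refine subseqPrecompact_continuousMap (fun n t c => h.abs_uComp_le n t c) fun e he => ?_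
  obtain ⟨δ, hδ, M, hM⟩ := h.exists_modulus (mul_pos h.m_pos he)
  refine ⟨δ, hδ, M, fun n hn c s t hst => ?_⟩
  have h1 := hM n hn _ (N.fastClosed_component h.equilibrium h.nodes c.2) s s.2 t t.2 hst
  have h2 := h.le_component_mass n c
  have heq := component_mass_eq h.T_pos (h.relation n) (h.represents n) (h.bounded n) c
  rw [← heq, ← heq, ← mul_sub, abs_mul] at h1
  refine le_of_mul_le_mul_left (le_trans ?_ h1) h.m_pos
  have := h2.trans (le_abs_self _)
  gcongr

lemma subseqPrecompact_uFcyc : SubseqPrecompact fun n => (θ n).uFcyc := by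
  refine SubseqPrecompact.pi fun x => subseqPrecompact_linfTime
    (B := (Fintype.card V * C + 2) / m) fun n => ?_
  filter_upwards [(h.represents n).uFcyc x] with t ht
  rw [ht]
  exact h.abs_density_le n x.2.1 t.2

lemma subseqPrecompact_uOne : SubseqPrecompact fun n => (θ n).uOne := by
  refine SubseqPrecompact.pi fun x => ?_
  obtain ⟨K, hK0, hK⟩ := BoundedCost.exists_integral_concentration_le h.equilibrium h.nodes h.noLeak
    h.T_pos C x x.2
  have hm := h.m_pos
  refine subseqPrecompact_measTime (K := (K / m).toNNReal)
    (fun n => (h.represents n).uOne_integrable x)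
    (fun n => Eventually.of_forall fun t => h.density_nonneg n x t.2) (fun n => ?_)
    fun n => (h.represents n).uOne x
  rw [Real.coe_toNNReal _ (by positivity), integral_timeVol, integral_Icc_eq_integral_Ioc,
    ← intervalIntegral.integral_of_le h.T_pos.le]
  have h1 := hK _ _ _ (h.ε_pos n) (h.bounded n)
  simp only [intervalIntegral.integral_const_mul] at h1
  have h2 : 0 ≤ ∫ t in (0 : ℝ)..T, u n x t :=
    intervalIntegral.integral_nonneg h.T_pos.le fun t ht => h.density_nonneg n x ht
  have h3 := mul_le_mul_of_nonneg_right (h.le_V1 n x x.2) h2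
  rw [le_div_iff₀ hm]
  refine le_of_mul_le_mul_right ?_ (h.ε_pos n)
  linarith

lemma subseqPrecompact_jSlow : SubseqPrecompact fun n => (θ n).jSlow := by
  refine SubseqPrecompact.pi fun r => subseqPrecompact_orliczTime
    (BoundedCost.slowRateBound_pos N C) (K := C + T.toNNReal) fun n => ?_
  have h1 := (h.bounded n).lintegral_youngC_slow_le h.T_pos (h.ε_pos n)
    (h.equilibrium _ (h.ε_pos n)) r.2
  rw [← lintegral_timeVol (fun t => youngC (N.physicalFlux π (ε n) (u n) (j n) r t /
    BoundedCost.slowRateBound N C))] at h1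
  refine le_of_eq_of_le (lintegral_congr_ae ?_) h1
  filter_upwards [(h.represents n).jSlow r] with t ht
  have hr : (r : R) ∉ N.Rfcyc π := fun h' => r.2 h'.1
  rw [ht, physicalFlux, if_neg hr]

lemma subseqPrecompact_jFcyc : SubseqPrecompact fun n => (θ n).jFcyc := by
  refine SubseqPrecompact.pi fun r => subseqPrecompact_orliczTime
    (BoundedCost.slowRateBound_pos N C) (K := C) fun n => ?_
  have h1 := lintegral_youngC_fcyc_le (h.bounded n) h.T_pos (h.ε_pos n) (h.ε_le_one n)
    (h.equilibrium _ (h.ε_pos n)) r.2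
  rw [← lintegral_timeVol (fun t => youngC (j n r t / BoundedCost.slowRateBound N C))] at h1
  refine le_of_eq_of_le (lintegral_congr_ae ?_) h1
  filter_upwards [(h.represents n).jFcyc r] with t ht
  rw [ht]

lemma subseqPrecompact_jDamp : SubseqPrecompact fun n => (θ n).jDamp := by
  refine SubseqPrecompact.pi fun r => ?_
  obtain ⟨K, hK0, hK⟩ := BoundedCost.exists_damp_flux_integral_le h.equilibrium h.nodes h.noLeak
    h.T_pos C r r.2
  have hflux : ∀ n, N.physicalFlux π (ε n) (u n) (j n) r = j n r := by
    intro n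
    have hr : (r : R) ∉ N.Rfcyc π := fun h' => notMem_nodesV1_of_mem_nodesV0 h'.2 r.2.2
    funext t
    rw [physicalFlux, if_neg hr]
  refine subseqPrecompact_measTime (K := K.toNNReal)
    (fun n => (h.represents n).jDamp_integrable r) (fun n => ?_) (fun n => ?_)
    fun n => (h.represents n).jDamp r
  · have := (h.bounded n).ae_flux_nonneg h.T_pos r
    rw [hflux] at this
    exact ae_timeVol_iff.2 this
  · have h1 := hK _ _ _ (h.ε_pos n) (h.bounded n)
    rw [hflux] at h1
    rwa [Real.coe_toNNReal _ hK0, integral_timeVol, integral_Icc_eq_integral_Ioc,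
      ← intervalIntegral.integral_of_le h.T_pos.le]

lemma exists_subseq_tendsto : ∃ φ : ℕ → ℕ, StrictMono φ ∧ ∃ θ₀,
    Tendsto (fun n => θ (φ n)) atTop (𝓝 θ₀) := by
  obtain ⟨φ, hφ, ⟨a₁, a₂, a₃, a₄, a₅, a₆, a₇⟩, ha⟩ :=
    (h.subseqPrecompact_uSlow.prodMk <| h.subseqPrecompact_uFcyc.prodMk <|
      h.subseqPrecompact_uComp.prodMk <| h.subseqPrecompact_uOne.prodMk <|
      h.subseqPrecompact_jSlow.prodMk <| h.subseqPrecompact_jDamp.prodMk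
      h.subseqPrecompact_jFcyc) id strictMono_id
  refine ⟨φ, hφ, ⟨a₁, a₂, a₃, a₄, a₅, a₆, a₇⟩, ?_⟩
  rw [nhds_induced, tendsto_comap_iff]
  exact ha

end BoundedSeq

omit [Fintype V] [Fintype R] in
lemma tendsto_uComp {T : ℝ} {θ : ℕ → N.Theta π T} {θ₀ : N.Theta π T}
    (h : Tendsto θ atTop (𝓝 θ₀)) : Tendsto (fun n => (θ n).uComp) atTop (𝓝 θ₀.uComp) := by
  rw [nhds_induced, tendsto_comap_iff] at h
  exact ((continuous_fst.comp (continuous_snd.comp continuous_snd)).tendsto _).comp h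

omit [Fintype V] [Fintype R] in
lemma tendsto_integral_uFcyc {T : ℝ} {θ : ℕ → N.Theta π T} {θ₀ : N.Theta π T}
    (h : Tendsto θ atTop (𝓝 θ₀)) (x : N.V0fcyc π) {E : Set (TimeIcc T)} (hE : MeasurableSet E) :
    Tendsto (fun n => ∫ t in E, ((θ n).uFcyc x).toLp t ∂(timeVol T)) atTop
      (𝓝 (∫ t in E, (θ₀.uFcyc x).toLp t ∂(timeVol T))) := by
  rw [nhds_induced, tendsto_comap_iff] at h
  have h1 : Tendsto (fun n => (θ n).uFcyc x) atTop (𝓝 (θ₀.uFcyc x)) :=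
    (((continuous_apply x).comp (continuous_fst.comp continuous_snd)).tendsto _).comp h
  rw [nhds_induced, tendsto_comap_iff, tendsto_pi_nhds] at h1
  have h2 : ∀ f : TimeIcc T → ℝ, ∫ t, f t * (indicatorConstLp 1 hE (measure_ne_top _ _) (1 : ℝ) :
      Lp ℝ 1 (timeVol T)) t ∂(timeVol T) = ∫ t in E, f t ∂(timeVol T) := by
    intro f
    rw [← integral_indicator hE]
    refine integral_congr_ae ?_
    filter_upwards [indicatorConstLp_coeFn (p := 1) (hs := hE)
      (hμs := measure_ne_top (timeVol T) E) (c := (1 : ℝ))] with t ht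
    rw [ht]
    by_cases htE : t ∈ E <;> simp [htE]
  have h3 := h1 (indicatorConstLp 1 hE (measure_ne_top _ _) (1 : ℝ))
  simpa only [Function.comp_def, h2] using h3

omit [Fintype V] [Fintype R] in
lemma tendsto_integral_uComp {T B : ℝ} {θ : ℕ → N.Theta π T} {θ₀ : N.Theta π T}
    (h : Tendsto θ atTop (𝓝 θ₀)) (hB : ∀ n t c, |(θ n).uComp t c| ≤ B) (c : N.components π)
    (E : Set (TimeIcc T)) :
    Tendsto (fun n => ∫ t in E, (θ n).uComp t c ∂(timeVol T)) atTop
      (𝓝 (∫ t in E, θ₀.uComp t c ∂(timeVol T))) := by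
  refine tendsto_integral_of_dominated_convergence (fun _ => B) (fun n => ?_)
    (integrable_const _) (fun n => Eventually.of_forall fun t => hB n t c)
    (Eventually.of_forall fun t => ?_)
  · exact ((continuous_apply c).comp (θ n).uComp.continuous).aestronglyMeasurable
  · exact (((continuous_apply c).comp (continuous_eval_const t)).tendsto _).comp
      (tendsto_uComp h)

omit [Fintype R] in
/-- The relation between the densities of the fast components and of their nodes passes to the limit:
it is equivalent to its integrals over all measurable sets of times. -/
lemma componentRelation_of_tendsto {T B : ℝ} {θ : ℕ → N.Theta π T} {θ₀ : N.Theta π T}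
    (hθ : Tendsto θ atTop (𝓝 θ₀)) {p : ℕ → V → ℝ} {p₀ : V → ℝ}
    (hp : ∀ x ∈ nodesV0 π, Tendsto (fun n => p n x) atTop (𝓝 (p₀ x)))
    (hB : ∀ n t c, |(θ n).uComp t c| ≤ B) (hrel : ∀ n, N.ComponentRelation (p n) (θ n)) :
    N.ComponentRelation p₀ θ₀ := by
  classical
  intro c
  have hint₁ : ∀ (θ : N.Theta π T) (p : V → ℝ) (x : N.V0fcyc π), Integrable (fun t =>
      if (x : V) ∈ (c : Set V) then p x * (θ.uFcyc x).toLp t else 0) (timeVol T) := by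
    intro θ p x
    split_ifs
    · exact ((Lp.memLp (θ.uFcyc x).toLp).integrable le_top).const_mul _
    · exact integrable_zero _ _ _
  have hint₂ : Integrable (fun t => (∑ x with x ∈ (c : Set V), p₀ x) * θ₀.uComp t c)
      (timeVol T) :=
    (((continuous_apply c).comp θ₀.uComp.continuous).integrable_of_hasCompactSupport
      (HasCompactSupport.of_compactSpace _)).const_mul _
  refine Integrable.ae_eq_of_forall_setIntegral_eq _ _ hint₂
    (integrable_finsetSum _ fun x _ => hint₁ θ₀ p₀ x) fun E hE _ => ?_
  have hsum : ∀ (θ : N.Theta π T) (p : V → ℝ), ∫ t in E, (∑ x : N.V0fcyc π,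
      if (x : V) ∈ (c : Set V) then p x * (θ.uFcyc x).toLp t else 0) ∂(timeVol T) =
      ∑ x : N.V0fcyc π, if (x : V) ∈ (c : Set V) then
        p x * ∫ t in E, (θ.uFcyc x).toLp t ∂(timeVol T) else 0 := by
    intro θ p
    rw [integral_finsetSum _ fun x _ => (hint₁ θ p x).integrableOn]
    refine Finset.sum_congr rfl fun x _ => ?_
    split_ifs
    · exact integral_const_mul _ _
    · exact integral_zero _ _
  have hl : Tendsto (fun n => ∫ t in E, (∑ x with x ∈ (c : Set V), p n x) * (θ n).uComp t c
      ∂(timeVol T)) atTop (𝓝 (∫ t in E, (∑ x with x ∈ (c : Set V), p₀ x) * θ₀.uComp t c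
      ∂(timeVol T))) := by
    simp only [integral_const_mul]
    exact (tendsto_finsetSum _ fun x hx =>
      hp x (c.2.1.2.1 (Finset.mem_filter.1 hx).2)).mul (tendsto_integral_uComp hθ hB c E)
  have hr : Tendsto (fun n => ∫ t in E, (∑ x : N.V0fcyc π,
      if (x : V) ∈ (c : Set V) then p n x * ((θ n).uFcyc x).toLp t else 0) ∂(timeVol T)) atTop
      (𝓝 (∫ t in E, (∑ x : N.V0fcyc π,
      if (x : V) ∈ (c : Set V) then p₀ x * (θ₀.uFcyc x).toLp t else 0) ∂(timeVol T))) := by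
    simp only [hsum]
    refine tendsto_finsetSum _ fun x _ => ?_
    split_ifs
    · exact (hp x x.2.1).mul (tendsto_integral_uFcyc hθ x hE)
    · exact tendsto_const_nhds
  refine tendsto_nhds_unique hl (hr.congr fun n => ?_)
  refine integral_congr_ae (ae_restrict_of_ae ?_)
  filter_upwards [hrel n c] with t ht
  convert ht.symm

/-- Lower bounds for the equilibrium masses, uniform in the node. -/
lemma exists_equilibrium_lower_bound (π : ℝ → V → ℝ) : ∃ m : ℝ, 0 < m ∧
    ∀ᶠ ε in 𝓝[>] (0 : ℝ), (∀ x ∈ nodesV0 π, m ≤ π ε x) ∧ ∀ x ∈ nodesV1 π, m * ε ≤ π ε x := by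
  have hx : ∀ x, ∃ m : ℝ, 0 < m ∧ ∀ᶠ ε in 𝓝[>] (0 : ℝ),
      (x ∈ nodesV0 π → m ≤ π ε x) ∧ (x ∈ nodesV1 π → m * ε ≤ π ε x) := by
    intro x
    by_cases h0 : x ∈ nodesV0 π
    · have h1 := notMem_nodesV1_of_mem_nodesV0 h0
      obtain ⟨p, hp, hlim⟩ := h0
      refine ⟨p / 2, half_pos hp, ?_⟩
      filter_upwards [hlim.eventually (eventually_ge_nhds (half_lt_self hp))] with ε hε
      exact ⟨fun _ => hε, fun h => absurd h h1⟩
    · by_cases h1 : x ∈ nodesV1 π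
      · obtain ⟨p, hp, hlim⟩ := h1
        refine ⟨p / 2, half_pos hp, ?_⟩
        filter_upwards [hlim.eventually (eventually_ge_nhds (half_lt_self hp)),
          self_mem_nhdsWithin] with ε hε hpos
        exact ⟨fun h => absurd h h0, fun _ => (le_div_iff₀ hpos).1 hε⟩
      · exact ⟨1, one_pos, Eventually.of_forall fun ε =>
          ⟨fun h => absurd h h0, fun h => absurd h h1⟩⟩
  choose f hf hfx using hx
  obtain ⟨m, hm, hmf⟩ : ∃ m : ℝ, 0 < m ∧ ∀ x, m ≤ f x := by
    cases isEmpty_or_nonempty V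
    · exact ⟨1, one_pos, fun x => isEmptyElim x⟩
    · obtain ⟨x₀, hx₀⟩ := Finite.exists_min f
      exact ⟨f x₀, hf x₀, hx₀⟩
  refine ⟨m, hm, ?_⟩
  filter_upwards [eventually_all.2 hfx, self_mem_nhdsWithin] with ε h hε
  exact ⟨fun x hx => (hmf x).trans ((h x).1 hx), fun x hx =>
    (mul_le_mul_of_nonneg_right (hmf x) (le_of_lt hε)).trans ((h x).2 hx)⟩

end SlowFastNetwork

theorem theorem1p1 {V R : Type*} [Fintype V] [Fintype R] (N : SlowFastNetwork V R)
    (π : ℝ → V → ℝ) (hπ : ∀ ε : ℝ, 0 < ε → N.IsEquilibrium ε (π ε))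
    (hnodes : ∀ x : V, x ∈ nodesV0 π ∨ x ∈ nodesV1 π)
    (hleak : ∀ r ∈ N.Rslow, N.src r ∉ nodesV1 π)
    (π₀ : V → ℝ)
    (hπ₀ : ∀ x ∈ nodesV0 π, Tendsto (fun ε => π ε x) (𝓝[>] 0) (𝓝 (π₀ x)))
    (T : ℝ) (hT : 0 < T)
    (ε : ℕ → ℝ) (hεpos : ∀ n, 0 < ε n) (hε : Tendsto ε atTop (𝓝 0))
    (θ : ℕ → N.Theta π T) (C : ℝ≥0) (hC : ∀ n, N.cost (ε n) (θ n) ≤ C) :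
    ∃ (φ : ℕ → ℕ) (θ₀ : N.Theta π T), StrictMono φ ∧
      Tendsto (fun k => θ (φ k)) atTop (𝓝 θ₀) ∧ N.ComponentRelation π₀ θ₀ := by
  obtain ⟨m, hm, hlow⟩ := SlowFastNetwork.exists_equilibrium_lower_bound π
  have hε' : Tendsto ε atTop (𝓝[>] 0) :=
    tendsto_nhdsWithin_iff.2 ⟨hε, Eventually.of_forall hεpos⟩
  -- the bounds hold for all large `n` only, so the sequence is shifted
  obtain ⟨M, hM⟩ := eventually_atTop.1
    ((hε'.eventually hlow).and (hε.eventually (eventually_le_nhds one_pos)))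
  have hshift : StrictMono fun n => n + M := fun a b hab => Nat.add_lt_add_right hab M
  choose hrel u j hrep hbdd using fun n => SlowFastNetwork.exists_represents_of_cost_le (hC n)
  have hseq : N.BoundedSeq π T m (C + 1) (fun n => ε (n + M)) (fun n => θ (n + M))
      (fun n => u (n + M)) (fun n => j (n + M)) :=
    { equilibrium := hπ
      nodes := hnodes
      noLeak := hleak
      T_pos := hT
      m_pos := hm
      ε_pos := fun n => hεpos _
      ε_le_one := fun n => (hM _ (Nat.le_add_left M n)).2
      tendsto := hε.comp hshift.tendsto_atTop
      le_V0 := fun n => (hM _ (Nat.le_add_left M n)).1.1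
      le_V1 := fun n => (hM _ (Nat.le_add_left M n)).1.2
      relation := fun n => hrel _
      represents := fun n => hrep _
      bounded := fun n => hbdd _ }
  obtain ⟨φ, hφ, θ₀, hlim⟩ := hseq.exists_subseq_tendsto
  refine ⟨fun n => φ n + M, θ₀, hshift.comp hφ, hlim, ?_⟩
  exact SlowFastNetwork.componentRelation_of_tendsto hlim
    (p := fun n => π (ε (φ n + M)))
    (fun x hx => (hπ₀ x hx).comp (hε'.comp (hshift.comp hφ).tendsto_atTop))
    (fun n => hseq.abs_uComp_le (φ n)) fun n => hrel _
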